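/- Let $n\ge 3$, $a\in\mathbb R$, $r_0>0$, let $r_+$ be the largest positive root of $1+\frac{a}{r^{n-1}}-\frac{r_0^n}{r^n}=0$, put $\beta=\frac{4\pi}{r_+\left(n-1+r_0^n/r_+^n\right)}$, and let $\lambda_3,\dots,\lambda_n>0$. On $\mathbb R^2\times\mathbb T^{n-2}$ use coordinates $(r,\xi,\phi^3,\dots,\phi^n)$, where $\phi^i\in\mathbb R/\lambda_i\mathbb Z$ and where $r\in[r_+,\infty)$, $\xi\in\mathbb R/\beta\mathbb Z$ are polar coordinates on $\mathbb R^2$ (the origin is $r=r_+$; the smooth structure is that of the Cartesian coordinates $\sqrt{r-r_+}\,(\cos\frac{2\pi\xi}{\beta},\sin\frac{2\pi\xi}{\beta})$). A function $f(r,\xi,\phi)$ is said to be of type $O(r^{-m})$ if it is smooth for large $r$ and, for every $k\ge0$, the functions $\partial_r^k f$, $\partial_r^k\partial_a f$, $\partial_r^k\partial_a\partial_b f$ ($a,b$ running over the angles $\xi,\phi^3,\dots,\phi^n$) are bounded by $C_k\,r^{-m-k}$ for all large $r$, uniformly in the angles. Let $g$ be a smooth Riemannian metric on the whole of $\mathbb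 R^2\times\mathbb T^{n-2}$ which for $r>r_+$ has the form $$g=e^{2u(r)}dr^2+e^{2v(r,\xi)}d\xi^2+r^2\Big(\sum_{i=3}^n(d\phi^i)^2+\hat w(r,\xi,\phi)\Big),$$ where $\hat w$ is a 2-tensor on $\mathbb T^{n-2}$ depending on $(r,\xi,\phi)$ and $$u=-\ln r-\tfrac12\ln\Big(1+\tfrac{a}{r^{n-1}}-\tfrac{r_0^n}{r^n}\Big)+\hat u(r),\qquad v=\ln r+\tfrac12\ln\Big(1+\tfrac{a}{r^{n-1}}-\tfrac{r_0^n}{r^n}\Big)+\hat v(r,\xi),$$ $$e^{\hat u}=1+\frac{u_{n-1}}{r^{n-1}}+\frac{u_n}{r^n}+O(r^{-n-1}),\quad e^{\hat v}=1+\frac{v_{n-1}(\xi)}{r^{n-1}}+\frac{v_n(\xi)}{r^n}+O(r^{-n-1}),$$ $$\hat w=\frac{2w_{n-1}(\xi,\phi)}{r^{n-1}}+\frac{2w_n(\xi,\phi)}{r^n}+O(r^{-n-1}),$$ with real constants $u_{n-1},u_n$, smooth functions $v_{n-1},v_n$ of $\xi$, and 2-tensors $w_{n-1},w_n$ on $\mathbb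 T^{n-2}$ depending smoothly on $(\xi,\phi)$ (the last $O$ being meant for each component). A special defining function is a smooth positive function $x$ on some collar $\{r>\rho\}$ such that $|dx|_{x^2g}\equiv1$ and $xr\to1$ as $r\to\infty$, uniformly in the angles. The metric $g$ is called asymptotically Poincaré–Einstein (APE) if there is a special defining function $x$ with $$|\mathrm{Ric}(g)+(n-1)g|_g=O(x^n)\qquad\text{as } r\to\infty,$$ uniformly in the angles. Then $$[R(g)+n(n-1)]\,r\in L^1(\mathbb R^2\times\mathbb T^{n-2},g)\iff g\text{ is APE},$$ where $R(g)$ is the scalar curvature of $g$ and $L^1$ refers to the Riemannian volume of $g$. -/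

import Mathlib

open Filter MeasureTheory Asymptotics
open scoped ContDiff Topology

noncomputable section

namespace AHM

/-! ### Riemannian geometry in a global coordinate system `ι → ℝ` -/

section Curvature

variable {ι : Type} [Fintype ι] [DecidableEq ι]

/-- The partial derivative `∂ᵢ f` in the coordinate system `ι → ℝ`. -/
def pd (i : ι) (f : (ι → ℝ) → ℝ) (y : ι → ℝ) : ℝ :=
  fderiv ℝ f y (Pi.single i 1)

/-- Christoffel symbols
`Γᵏᵢⱼ = ½ gᵏˡ (∂ᵢ gⱼₗ + ∂ⱼ gᵢₗ - ∂ₗ gᵢⱼ)` of the metric with component matrix `g`. -/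
def christoffel (g : (ι → ℝ) → Matrix ι ι ℝ) (k i j : ι) (y : ι → ℝ) : ℝ :=
  (1 / 2 : ℝ) * ∑ l, (g y)⁻¹ k l *
    (pd i (fun z => g z j l) y + pd j (fun z => g z i l) y - pd l (fun z => g z i j) y)

/-- Ricci tensor
`Ricᵢⱼ = ∂ₖ Γᵏᵢⱼ - ∂ⱼ Γᵏᵢₖ + Γᵏₖₗ Γˡᵢⱼ - Γᵏⱼₗ Γˡᵢₖ`
(positive on round spheres). -/
def ricci (g : (ι → ℝ) → Matrix ι ι ℝ) (y : ι → ℝ) : Matrix ι ι ℝ :=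
  Matrix.of fun i j =>
    ∑ k, (pd k (christoffel g k i j) y - pd j (christoffel g k i k) y) +
    ∑ k, ∑ l, (christoffel g k k l y * christoffel g l i j y -
      christoffel g k j l y * christoffel g l i k y)

/-- Scalar curvature `R(g) = gⁱʲ Ricᵢⱼ`. -/
def scalarCurvature (g : (ι → ℝ) → Matrix ι ι ℝ) (y : ι → ℝ) : ℝ :=
  ∑ i, ∑ j, (g y)⁻¹ i j * ricci g y i j

/-- The pointwise norm `|T|` of a covariant 2-tensor `T` in an inner product with component
matrix `h`. -/
def tensorNorm (h T : Matrix ι ι ℝ) : ℝ :=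
  Real.sqrt (∑ i, ∑ j, ∑ k, ∑ l, h⁻¹ i k * h⁻¹ j l * T i j * T k l)

/-- The pointwise squared norm `|α|²` of a covector `α` in an inner product with component
matrix `h`. -/
def covectorNormSq (h : Matrix ι ι ℝ) (α : ι → ℝ) : ℝ :=
  ∑ i, ∑ j, h⁻¹ i j * α i * α j

/-- The Riemannian volume measure `√(det g) dy`. -/
def riemannianVolume (g : (ι → ℝ) → Matrix ι ι ℝ) : Measure (ι → ℝ) :=
  volume.withDensity fun y => ENNReal.ofReal (Real.sqrt (g y).det)

/-- Components of the pull-back `Φ^* g` of a metric under a map `Φ` between coordinate domains. -/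
def pullback (Φ : (ι → ℝ) → (ι → ℝ)) (g : (ι → ℝ) → Matrix ι ι ℝ) (y : ι → ℝ) :
    Matrix ι ι ℝ :=
  Matrix.of fun i j => ∑ k, ∑ l,
    pd i (fun z => Φ z k) y * pd j (fun z => Φ z l) y * g (Φ y) k l

end Curvature

/-! ### The manifold `ℝ² × 𝕋ⁿ⁻²`

It is handled through its universal cover `ℝ² × ℝⁿ⁻²`, with global coordinates
`z = (z¹, z²; φ³, …, φⁿ)` indexed by `Fin 2 ⊕ Fin (n - 2)`. Tensors on `ℝ² × 𝕋ⁿ⁻²` are the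
tensors on the cover that are periodic in each `φⁱ` with period `lam i`.
The same index type is used for polar coordinates `y = (r, ξ; φ³, …, φⁿ)`. -/

/-- Index set of the coordinates `(z¹, z²; φ)` and of the polar coordinates `(r, ξ; φ)`. -/
abbrev Idx (n : ℕ) : Type := Fin 2 ⊕ Fin (n - 2)

/-- A smooth Riemannian metric on `ℝ² × 𝕋ⁿ⁻²`, where the circles have lengths `lam i`. -/
structure IsSmoothMetric {n : ℕ} (lam : Fin (n - 2) → ℝ)
    (G : (Idx n → ℝ) → Matrix (Idx n) (Idx n) ℝ) : Prop where
  smooth : ∀ i j, ContDiff ℝ ∞ fun z => G z i j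
  posDef : ∀ z, (G z).PosDef
  periodic : ∀ (i : Fin (n - 2)) (z : Idx n → ℝ), G (z + Pi.single (Sum.inr i) (lam i)) = G z

/-- A fundamental domain of `ℝ² × ℝⁿ⁻² → ℝ² × 𝕋ⁿ⁻²`. -/
def fundamentalDomain {n : ℕ} (lam : Fin (n - 2) → ℝ) : Set (Idx n → ℝ) :=
  {z | ∀ i : Fin (n - 2), z (Sum.inr i) ∈ Set.Ico 0 (lam i)}

/-- The function `r` on `ℝ² × 𝕋ⁿ⁻²`, normalised by `r = r₊` on the core torus
`{z¹ = z² = 0}`. -/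
def radius {n : ℕ} (rp : ℝ) (z : Idx n → ℝ) : ℝ :=
  rp + z (Sum.inl 0) ^ 2 + z (Sum.inl 1) ^ 2

/-- Polar coordinates: `(r, ξ; φ) ↦ (√(r - r₊) cos (2πξ/β), √(r - r₊) sin (2πξ/β); φ)`. -/
def polarMap {n : ℕ} (rp β : ℝ) (y : Idx n → ℝ) : Idx n → ℝ :=
  Sum.elim
    ![Real.sqrt (y (Sum.inl 0) - rp) * Real.cos (2 * Real.pi * y (Sum.inl 1) / β),
      Real.sqrt (y (Sum.inl 0) - rp) * Real.sin (2 * Real.pi * y (Sum.inl 1) / β)]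
    (fun i => y (Sum.inr i))

/-! ### The class of metrics -/

/-- `1 + a / rⁿ⁻¹ - r₀ⁿ / rⁿ`. -/
def potential (n : ℕ) (a r₀ r : ℝ) : ℝ :=
  1 + a / r ^ (n - 1) - r₀ ^ n / r ^ n

/-- The period `β = 4π / (r₊ (n - 1 + r₀ⁿ / r₊ⁿ))` of `ξ`. -/
def xiPeriod (n : ℕ) (r₀ rp : ℝ) : ℝ :=
  4 * Real.pi / (rp * ((n : ℝ) - 1 + r₀ ^ n / rp ^ n))

/-- Components in the coordinates `(r, ξ; φ)` of
`e^{2u} dr² + e^{2v} dξ² + r² (∑ (dφⁱ)² + ŵ)`, where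
`u = - ln r - ½ ln (1 + a / rⁿ⁻¹ - r₀ⁿ / rⁿ) + û(r)` and
`v = ln r + ½ ln (1 + a / rⁿ⁻¹ - r₀ⁿ / rⁿ) + v̂(r, ξ)`. -/
def polarMetric (n : ℕ) (a r₀ : ℝ) (uhat : ℝ → ℝ) (vhat : ℝ → ℝ → ℝ)
    (what : ℝ → ℝ → (Fin (n - 2) → ℝ) → Matrix (Fin (n - 2)) (Fin (n - 2)) ℝ)
    (y : Idx n → ℝ) : Matrix (Idx n) (Idx n) ℝ :=
  let r := y (Sum.inl 0)
  let ξ := y (Sum.inl 1)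
  let φ : Fin (n - 2) → ℝ := fun i => y (Sum.inr i)
  let u := -Real.log r - (1 / 2) * Real.log (potential n a r₀ r) + uhat r
  let v := Real.log r + (1 / 2) * Real.log (potential n a r₀ r) + vhat r ξ
  Matrix.fromBlocks
    (Matrix.diagonal ![Real.exp (2 * u), Real.exp (2 * v)]) 0
    0 (r ^ 2 • (1 + what r ξ φ))

/-- A function `f` of the polar coordinates `(r, ξ; φ)` is of type `O(1 / rᵐ)`: it is smooth near
infinity and `∂ᵣᵏ f = O(1 / r^{m + k})` as `r → ∞`, uniformly in the angles `(ξ, φ)`, for all `k`;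
the same holds for the first and second derivatives of `f` in the angles. -/
def IsOType {n : ℕ} (m : ℕ) (f : (Idx n → ℝ) → ℝ) : Prop :=
  (∃ ρ : ℝ, ContDiffOn ℝ ∞ f {y | ρ < y (Sum.inl 0)}) ∧
  ∀ (k : ℕ) (l : List (Idx n)), (∀ i ∈ l, i ≠ Sum.inl 0) → l.length ≤ 2 →
    ∃ C ρ : ℝ, ∀ y : Idx n → ℝ, ρ < y (Sum.inl 0) →
      |((pd (Sum.inl 0))^[k] (l.foldr pd f)) y| ≤ C / y (Sum.inl 0) ^ (m + k)

/-! ### Asymptotically Poincaré–Einstein metrics -/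

/-- The filter of neighbourhoods of infinity `{r > ρ}` of `ℝ² × 𝕋ⁿ⁻²`. -/
def atInfinity (n : ℕ) (rp : ℝ) : Filter (Idx n → ℝ) :=
  comap (radius rp) atTop

/-- `x` is a special defining function for the boundary at infinity: on a collar
`{r > ρ}` it is a smooth positive function with `|dx|_{x² G} ≡ 1`, and it vanishes at infinity,
where it is normalised by `x r → 1`. -/
def IsSpecialDefiningFunction {n : ℕ} (lam : Fin (n - 2) → ℝ) (rp : ℝ)
    (G : (Idx n → ℝ) → Matrix (Idx n) (Idx n) ℝ) (x : (Idx n → ℝ) → ℝ) : Prop :=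
  (∃ ρ : ℝ,
    ContDiffOn ℝ ∞ x {z | ρ < radius rp z} ∧
    (∀ z, ρ < radius rp z → ∀ i : Fin (n - 2),
      x (z + Pi.single (Sum.inr i) (lam i)) = x z) ∧
    (∀ z, ρ < radius rp z → 0 < x z) ∧
    (∀ z, ρ < radius rp z →
      covectorNormSq (x z ^ 2 • G z) (fun i => pd i x z) = 1)) ∧
  Tendsto (fun z => x z * radius rp z) (atInfinity n rp) (𝓝 1)

/-- `G` is asymptotically Poincaré–Einstein: `|Ric + (n - 1) G|_G = O(xⁿ)` at infinity for a
special defining function `x`. -/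
def IsAPE {n : ℕ} (lam : Fin (n - 2) → ℝ) (rp : ℝ)
    (G : (Idx n → ℝ) → Matrix (Idx n) (Idx n) ℝ) : Prop :=
  ∃ x : (Idx n → ℝ) → ℝ, IsSpecialDefiningFunction lam rp G x ∧
    (fun z => tensorNorm (G z) (ricci G z + ((n : ℝ) - 1) • G z))
      =O[atInfinity n rp] fun z => x z ^ n

end AHM

end

set_option linter.unusedSectionVars false

noncomputable section

/-! Put m = n - 1 and let `o` denote the radial index. For large r the metric is a perturbation of
the model dr²/r² + r² Σ (dyᵃ)², where yᵃ runs over ξ and the φⁱ. In a frame orthonormal for the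
model the perturbation has the form c r⁻ᵐ + d r⁻ᵐ⁻¹ + O(r⁻ᵐ⁻²), with coefficients depending on the
angles only. One function governs both sides of the equivalence, the trace M = c_oo + Σ c_aa of the
leading coefficient; here M = 2 (uₙ₋₁ + vₙ₋₁ + tr wₙ₋₁), because a cancels between the dr² and the
dξ² terms.

Since n ≥ 3 gives 2m ≥ m + 2, products of perturbations are negligible, and angular derivatives
enter the diagonal blocks of the curvature two orders down. What remains is linear in the Euler
operator r∂ᵣ, which acts on r⁻ᵐ and r⁻ᵐ⁻¹ by scalars. In Ric + m g the coefficient of r⁻ᵐ is (m -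
m²/2) M in the radial component, (m/2) M δ in the tangential block, and zero in the mixed components
(`expansion_defect_oo`, `expansion_defect_ab`, `defect_cross`). So |Ric + m g| = O(r⁻ⁿ) when M = 0,
and conversely the trace m M r⁻ᵐ + O(r⁻ᵐ⁻²) forces M = 0.

In that trace the terms of order r⁻ᵐ⁻¹ cancel whatever d is (`expansion_defect_trace`), so R +
n(n-1) = m M r⁻ᵐ + O(r⁻ᵐ⁻²). The volume density is asymptotic to rᵐ⁻¹ dr dξ dφ. Hence the density of
(R + n(n-1)) r is asymptotic to m M, and is O(r⁻²) if M = 0. It is integrable exactly when M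
vanishes identically (`integrableOn_of_isBigO`, `coefficient_eq_zero_of_integrableOn`). The
cancellation is essential: a leftover term of order r⁻¹ would diverge logarithmically.

Three bridges complete the argument. The expansions live in polar coordinates and the statement in
Cartesian ones, so naturality of the Ricci tensor is proved (`ricci_pullback`). Coefficients are
only known to be smooth on the universal cover, so estimates are made for angles in a bounded box
and become uniform through periodicity (`isBigO_of_polar`). Finally, as the lapse depends on r
alone, an ODE in r yields a special defining function (`exists_specialDefiningFunction`). -/

namespace AHM

/-! ### Calculus of coordinate partial derivatives. -/

section PartialDerivatives

variable {ι : Type} [Fintype ι] [DecidableEq ι] {f g : (ι → ℝ) → ℝ} {y : ι → ℝ}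

theorem ContDiffAt.pd (hf : ContDiffAt ℝ ∞ f y) (i : ι) : ContDiffAt ℝ ∞ (pd i f) y :=
  (hf.fderiv_right (m := ∞) (by simp)).clm_apply contDiffAt_const

theorem smooth_differentiableAt (hf : ContDiffAt ℝ ∞ f y) : DifferentiableAt ℝ f y :=
  hf.differentiableAt (by simp)

theorem pd_congr (i : ι) (h : f =ᶠ[𝓝 y] g) : pd i f y = pd i g y := by
  simp only [pd, h.fderiv_eq]

@[simp] theorem pd_const (i : ι) (c : ℝ) (y : ι → ℝ) : pd i (fun _ => c) y = 0 := by
  simp [pd]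

theorem pd_add (i : ι) (hf : ContDiffAt ℝ ∞ f y) (hg : ContDiffAt ℝ ∞ g y) :
    pd i (fun z => f z + g z) y = pd i f y + pd i g y := by
  simp only [pd]
  rw [fderiv_fun_add (smooth_differentiableAt hf) (smooth_differentiableAt hg)]; rfl

theorem pd_sub (i : ι) (hf : ContDiffAt ℝ ∞ f y) (hg : ContDiffAt ℝ ∞ g y) :
    pd i (fun z => f z - g z) y = pd i f y - pd i g y := by
  simp only [pd]
  rw [fderiv_fun_sub (smooth_differentiableAt hf) (smooth_differentiableAt hg)]; rfl

theorem pd_neg (i : ι) : pd i (fun z => -f z) y = -pd i f y := by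
  simp only [pd]
  rw [fderiv_fun_neg]; rfl

theorem pd_mul (i : ι) (hf : ContDiffAt ℝ ∞ f y) (hg : ContDiffAt ℝ ∞ g y) :
    pd i (fun z => f z * g z) y = pd i f y * g y + f y * pd i g y := by
  simp only [pd]
  rw [fderiv_fun_mul (smooth_differentiableAt hf) (smooth_differentiableAt hg)]
  simp; ring

theorem pd_const_mul (i : ι) (c : ℝ) (hf : ContDiffAt ℝ ∞ f y) :
    pd i (fun z => c * f z) y = c * pd i f y := by
  rw [pd_mul i contDiffAt_const hf]; simp

theorem pd_inv (i : ι) (hf : ContDiffAt ℝ ∞ f y) (h0 : f y ≠ 0) :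
    pd i (fun z => (f z)⁻¹) y = -(pd i f y * (f y)⁻¹ * (f y)⁻¹) := by
  have h1 : ContDiffAt ℝ ∞ (fun z => (f z)⁻¹) y := hf.inv h0
  have h2 : ∀ᶠ z in 𝓝 y, f z ≠ 0 := hf.continuousAt.eventually_ne h0
  have h3 : pd i (fun z => f z * (f z)⁻¹) y = 0 := by
    rw [pd_congr (g := fun _ => 1) i, pd_const]
    filter_upwards [h2] with z hz using mul_inv_cancel₀ hz
  rw [pd_mul i hf h1] at h3
  field_simp at h3 ⊢
  linarith

theorem pd_sum {κ : Type} (s : Finset κ) (i : ι) {F : κ → (ι → ℝ) → ℝ}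
    (hF : ∀ a ∈ s, ContDiffAt ℝ ∞ (F a) y) :
    pd i (fun z => ∑ a ∈ s, F a z) y = ∑ a ∈ s, pd i (F a) y := by
  simp only [pd]
  rw [fderiv_fun_sum fun a ha => smooth_differentiableAt (hF a ha)]
  simp

theorem pd_comm (i j : ι) (hf : ContDiffAt ℝ ∞ f y) :
    pd i (pd j f) y = pd j (pd i f) y := by
  have hd : DifferentiableAt ℝ (fderiv ℝ f) y :=
    (hf.fderiv_right (m := ∞) (by simp)).differentiableAt (by simp)
  have key : ∀ i j : ι, pd i (pd j f) y =
      fderiv ℝ (fderiv ℝ f) y (Pi.single i 1) (Pi.single j 1) := by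
    intro i j
    have : pd j f = fun z => fderiv ℝ f z (Pi.single j 1) := rfl
    rw [this, pd, fderiv_clm_apply hd (by fun_prop)]
    simp
  have hs : IsSymmSndFDerivAt ℝ f y := hf.isSymmSndFDerivAt (by simpa using (by exact_mod_cast le_top : ((2 : ℕ∞) : WithTop ℕ∞) ≤ ((⊤ : ℕ∞) : WithTop ℕ∞)))
  rw [key, key, hs.eq]

theorem pd_comp {κ : Type} [Fintype κ] [DecidableEq κ] {Φ : (ι → ℝ) → (κ → ℝ)}
    {f : (κ → ℝ) → ℝ} (i : ι)
    (hf : ContDiffAt ℝ ∞ f (Φ y)) (hΦ : ContDiffAt ℝ ∞ Φ y) :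
    pd i (fun z => f (Φ z)) y = ∑ k, pd k f (Φ y) * pd i (fun z => Φ z k) y := by
  have hd : DifferentiableAt ℝ Φ y := hΦ.differentiableAt (by simp)
  have h1 : fderiv ℝ (fun z => f (Φ z)) y = (fderiv ℝ f (Φ y)).comp (fderiv ℝ Φ y) :=
    fderiv_comp y (smooth_differentiableAt hf) hd
  have h2 : ∀ k, pd i (fun z => Φ z k) y = fderiv ℝ Φ y (Pi.single i 1) k := by
    intro k
    rw [pd, fderiv_apply hd k]
    rfl
  simp only [h2]
  rw [pd, h1, ContinuousLinearMap.comp_apply]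
  conv_lhs => rw [pi_eq_sum_univ' (fderiv ℝ Φ y (Pi.single i 1))]
  rw [map_sum]
  refine Finset.sum_congr rfl fun k _ => ?_
  rw [map_smul, smul_eq_mul, mul_comm]
  simp [pd]

theorem pd_translate (i : ι) (f : (ι → ℝ) → ℝ) (e y : ι → ℝ) :
    pd i f (y + e) = pd i (fun z => f (z + e)) y := by
  simp only [pd]
  rw [fderiv_comp_add_right]

theorem contDiffAt_sum' {κ : Type} (s : Finset κ) {F : κ → (ι → ℝ) → ℝ}
    (hF : ∀ a ∈ s, ContDiffAt ℝ ∞ (F a) y) :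
    ContDiffAt ℝ ∞ (fun z => ∑ a ∈ s, F a z) y := ContDiffAt.sum hF

theorem contDiffAt_det {κ : Type} [Fintype κ] [DecidableEq κ]
    {A : (ι → ℝ) → Matrix κ κ ℝ} (hA : ∀ i j, ContDiffAt ℝ ∞ (fun z => A z i j) y) :
    ContDiffAt ℝ ∞ (fun z => (A z).det) y := by
  simp only [Matrix.det_apply']
  exact contDiffAt_sum' _ fun σ _ => contDiffAt_const.mul (contDiffAt_prod fun k _ => hA _ _)

/-- Cramer's rule writes each entry as a quotient of polynomials in the entries of `A`. -/
theorem contDiffAt_matrix_inv {κ : Type} [Fintype κ] [DecidableEq κ]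
    {A : (ι → ℝ) → Matrix κ κ ℝ} (hA : ∀ i j, ContDiffAt ℝ ∞ (fun z => A z i j) y)
    (h0 : (A y).det ≠ 0) (i j : κ) :
    ContDiffAt ℝ ∞ (fun z => (A z)⁻¹ i j) y := by
  have : ∀ z, (A z)⁻¹ i j = (A z).det⁻¹ * ((A z).updateRow j (Pi.single i 1)).det := by
    intro z
    rw [Matrix.inv_def, Matrix.smul_apply, Matrix.adjugate_apply, Ring.inverse_eq_inv', smul_eq_mul]
  simp only [this]
  refine ((contDiffAt_det hA).inv h0).mul (contDiffAt_det fun k l => ?_)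
  by_cases h : k = j
  · subst h; simp only [Matrix.updateRow_self]; exact contDiffAt_const
  · simp only [Matrix.updateRow_ne h]; exact hA k l

end PartialDerivatives

/-! ### Smoothness and symmetry of the Christoffel symbols. -/

section Smoothness

variable {ι : Type} [Fintype ι] [DecidableEq ι] {g : (ι → ℝ) → Matrix ι ι ℝ} {y : ι → ℝ}

theorem contDiffAt_christoffel (hg : ∀ i j, ContDiffAt ℝ ∞ (fun z => g z i j) y)
    (h0 : (g y).det ≠ 0) (k i j : ι) : ContDiffAt ℝ ∞ (christoffel g k i j) y := by
  unfold christoffel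
  exact contDiffAt_const.mul (contDiffAt_sum' _ fun l _ => (contDiffAt_matrix_inv hg h0 k l).mul
    (((ContDiffAt.pd (hg j l) i).add (ContDiffAt.pd (hg i l) j)).sub (ContDiffAt.pd (hg i j) l)))

theorem contDiffAt_ricci (hg : ∀ i j, ContDiffAt ℝ ∞ (fun z => g z i j) y)
    (h0 : (g y).det ≠ 0) (i j : ι) : ContDiffAt ℝ ∞ (fun z => ricci g z i j) y := by
  unfold ricci
  simp only [Matrix.of_apply]
  have H := contDiffAt_christoffel hg h0
  exact (contDiffAt_sum' _ fun k _ => (ContDiffAt.pd (H _ _ _) _).sub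
    (ContDiffAt.pd (H _ _ _) _)).add (contDiffAt_sum' _ fun k _ => contDiffAt_sum' _ fun l _ =>
      ((H _ _ _).mul (H _ _ _)).sub ((H _ _ _).mul (H _ _ _)))

theorem christoffel_symm (hg : ∀ᶠ z in 𝓝 y, (g z).IsSymm) (k i j : ι) :
    christoffel g k i j y = christoffel g k j i y := by
  have : ∀ i j l, pd i (fun z => g z j l) y = pd i (fun z => g z l j) y := fun i j l =>
    pd_congr i (hg.mono fun w hw => hw.apply _ _)
  unfold christoffel
  congr 1
  refine Finset.sum_congr rfl fun l _ => ?_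
  rw [this l i j]; ring

end Smoothness

/-! ### The Ricci tensor as a contraction of the curvature of connection matrices. -/

section Naturality

variable {ι : Type} [Fintype ι] [DecidableEq ι]

/-- The connection matrix `(Γⱼ)ᵏᵢ = Γᵏⱼᵢ`. -/
def connMatrix (g : (ι → ℝ) → Matrix ι ι ℝ) (j : ι) (y : ι → ℝ) : Matrix ι ι ℝ :=
  Matrix.of fun k i => christoffel g k j i y

/-- The entrywise partial derivative of a matrix-valued function. -/
def pdM (i : ι) (F : (ι → ℝ) → Matrix ι ι ℝ) (y : ι → ℝ) : Matrix ι ι ℝ :=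
  Matrix.of fun p q => pd i (fun z => F z p q) y

/-- The curvature `∂ᵢ Aⱼ - ∂ⱼ Aᵢ + [Aᵢ, Aⱼ]` of a matrix of connection forms. -/
def gaugeCurvature (A : ι → (ι → ℝ) → Matrix ι ι ℝ) (i j : ι) (y : ι → ℝ) : Matrix ι ι ℝ :=
  pdM i (A j) y - pdM j (A i) y + A i y * A j y - A j y * A i y

/-- The Jacobian matrix `Jᵏᵢ = ∂ᵢ Φᵏ`. -/
def jacobian (Φ : (ι → ℝ) → (ι → ℝ)) (y : ι → ℝ) : Matrix ι ι ℝ :=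
  Matrix.of fun k i => pd i (fun z => Φ z k) y

def SmoothMatrixAt (F : (ι → ℝ) → Matrix ι ι ℝ) (y : ι → ℝ) : Prop :=
  ∀ i j, ContDiffAt ℝ ∞ (fun z => F z i j) y

theorem pullback_eq (Φ : (ι → ℝ) → (ι → ℝ)) (g : (ι → ℝ) → Matrix ι ι ℝ) (y : ι → ℝ) :
    pullback Φ g y = (jacobian Φ y).transpose * g (Φ y) * jacobian Φ y := by
  ext i j
  simp only [pullback, Matrix.of_apply, Matrix.mul_apply, Matrix.transpose_apply, jacobian,
    Finset.sum_mul]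
  rw [Finset.sum_comm]
  exact Finset.sum_congr rfl fun k _ => Finset.sum_congr rfl fun l _ => by ring

theorem SmoothMatrixAt.mul {F G : (ι → ℝ) → Matrix ι ι ℝ} {y : ι → ℝ}
    (hF : SmoothMatrixAt F y) (hG : SmoothMatrixAt G y) :
    SmoothMatrixAt (fun z => F z * G z) y := by
  intro i j
  simp only [Matrix.mul_apply]
  exact contDiffAt_sum' _ fun k _ => (hF i k).mul (hG k j)

theorem pdM_mul (i : ι) {F G : (ι → ℝ) → Matrix ι ι ℝ} {y : ι → ℝ}
    (hF : SmoothMatrixAt F y) (hG : SmoothMatrixAt G y) :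
    pdM i (fun z => F z * G z) y = pdM i F y * G y + F y * pdM i G y := by
  ext p q
  simp only [pdM, Matrix.of_apply, Matrix.mul_apply, Matrix.add_apply]
  rw [pd_sum _ _ fun k _ => (hF p k).mul (hG k q), ← Finset.sum_add_distrib]
  exact Finset.sum_congr rfl fun k _ => pd_mul i (hF p k) (hG k q)

theorem pdM_add (i : ι) {F G : (ι → ℝ) → Matrix ι ι ℝ} {y : ι → ℝ}
    (hF : SmoothMatrixAt F y) (hG : SmoothMatrixAt G y) :
    pdM i (fun z => F z + G z) y = pdM i F y + pdM i G y := by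
  ext p q
  exact pd_add i (hF p q) (hG p q)

theorem SmoothMatrixAt.pdM {F : (ι → ℝ) → Matrix ι ι ℝ} {y : ι → ℝ}
    (hF : SmoothMatrixAt F y) (i : ι) : SmoothMatrixAt (pdM i F) y :=
  fun p q => ContDiffAt.pd (hF p q) i

theorem SmoothMatrixAt.jacobian {Φ : (ι → ℝ) → (ι → ℝ)} {y : ι → ℝ} (hΦ : ContDiffAt ℝ ∞ Φ y) :
    SmoothMatrixAt (jacobian Φ) y :=
  fun p q => ContDiffAt.pd (contDiffAt_pi.1 hΦ p) q

theorem smoothMatrixAt_pullback {Φ : (ι → ℝ) → (ι → ℝ)} {g : (ι → ℝ) → Matrix ι ι ℝ} {y : ι → ℝ}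
    (hΦ : ContDiffAt ℝ ∞ Φ y) (hg : SmoothMatrixAt g (Φ y)) :
    SmoothMatrixAt (pullback Φ g) y := by
  have : pullback Φ g = fun y => (jacobian Φ y).transpose * g (Φ y) * jacobian Φ y :=
    funext fun y => pullback_eq Φ g y
  rw [this]
  have hJ := SmoothMatrixAt.jacobian hΦ
  refine SmoothMatrixAt.mul (SmoothMatrixAt.mul (fun i j => hJ j i) ?_) hJ
  exact fun i j => (hg i j).comp y hΦ

/-- Exchanging the lower Christoffel indices identifies the two formulas. The symmetry is needed on
a neighbourhood because the symbols are differentiated. -/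
theorem ricci_eq_gaugeCurvature {g : (ι → ℝ) → Matrix ι ι ℝ} {y : ι → ℝ}
    (hs : ∀ᶠ z in 𝓝 y, (g z).IsSymm) (i j : ι) :
    ricci g y i j = ∑ k, gaugeCurvature (connMatrix g) k j y k i := by
  have H : ∀ k i j, christoffel g k i j =ᶠ[𝓝 y] christoffel g k j i := fun k i j =>
    hs.eventually_nhds.mono fun z hz => christoffel_symm hz k i j
  simp only [ricci, gaugeCurvature, pdM, connMatrix, Matrix.of_apply, Matrix.add_apply,
    Matrix.sub_apply, Matrix.mul_apply]
  rw [← Finset.sum_add_distrib]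
  refine Finset.sum_congr rfl fun k _ => ?_
  rw [Finset.sum_sub_distrib]
  have e1 : pd k (fun z => christoffel g k j i z) y = pd k (christoffel g k i j) y :=
    pd_congr k (H k j i)
  have e2 : pd j (fun z => christoffel g k k i z) y = pd j (christoffel g k i k) y :=
    pd_congr j (H k k i)
  rw [e1, e2, add_sub]
  congr 2
  · exact Finset.sum_congr rfl fun l _ => by rw [(H l j i).eq_of_nhds]
  · funext l; rw [(H l k i).eq_of_nhds]

end Naturality

/-! ### Naturality of the Ricci tensor under local diffeomorphisms. -/

section Naturality

variable {ι : Type} [Fintype ι] [DecidableEq ι]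

/-- The pulled back connection matrix `∑ₐ (∂ⱼ Φᵃ) Γₐ ∘ Φ`. -/
def pulledConn (Φ : (ι → ℝ) → (ι → ℝ)) (g : (ι → ℝ) → Matrix ι ι ℝ) (j : ι) (y : ι → ℝ) :
    Matrix ι ι ℝ :=
  ∑ a, jacobian Φ y a j • connMatrix g a (Φ y)

/-- Christoffel symbols of the first kind. -/
def christoffelLower (g : (ι → ℝ) → Matrix ι ι ℝ) (i j : ι) (y : ι → ℝ) : ι → ℝ := fun l =>
  (1 / 2 : ℝ) * (pd i (fun z => g z j l) y + pd j (fun z => g z i l) y - pd l (fun z => g z i j) y)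

/-- Lowering the index removes the inverse metric, so that the transformation law can be checked on
first derivatives of `g` alone. -/
theorem mulVec_christoffel {g : (ι → ℝ) → Matrix ι ι ℝ} {y : ι → ℝ} (h0 : (g y).det ≠ 0)
    (i j : ι) : (g y).mulVec (fun k => christoffel g k i j y) = christoffelLower g i j y := by
  have : (fun k => christoffel g k i j y) = (g y)⁻¹.mulVec (christoffelLower g i j y) := by
    funext k
    simp only [christoffel, Matrix.mulVec, dotProduct, christoffelLower, Finset.mul_sum]
    exact Finset.sum_congr rfl fun l _ => by ring
  rw [this, Matrix.mulVec_mulVec, Matrix.mul_nonsing_inv _ (isUnit_iff_ne_zero.2 h0),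
    Matrix.one_mulVec]

variable {Φ : (ι → ℝ) → (ι → ℝ)} {g : (ι → ℝ) → Matrix ι ι ℝ} {y : ι → ℝ}

theorem pd_pullback (hΦ : ContDiffAt ℝ ∞ Φ y) (hg : SmoothMatrixAt g (Φ y)) (i j l : ι) :
    pd i (fun z => pullback Φ g z j l) y =
      ∑ a, ∑ b, pd i (fun z => jacobian Φ z a j) y * jacobian Φ y b l * g (Φ y) a b +
      ∑ a, ∑ b, jacobian Φ y a j * pd i (fun z => jacobian Φ z b l) y * g (Φ y) a b +
      ∑ a, ∑ b, ∑ c, jacobian Φ y c i * jacobian Φ y a j * jacobian Φ y b l *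
        pd c (fun z => g z a b) (Φ y) := by
  have hJ := SmoothMatrixAt.jacobian hΦ
  have hgΦ : ∀ a b, ContDiffAt ℝ ∞ (fun z => g (Φ z) a b) y := fun a b => (hg a b).comp y hΦ
  have : (fun z => pullback Φ g z j l) = fun z => ∑ a, ∑ b,
      jacobian Φ z a j * jacobian Φ z b l * g (Φ z) a b := rfl
  rw [this, pd_sum _ _ fun a _ => contDiffAt_sum' _ fun b _ =>
    ((hJ a j).mul (hJ b l)).mul (hgΦ a b)]
  rw [← Finset.sum_add_distrib, ← Finset.sum_add_distrib]
  refine Finset.sum_congr rfl fun a _ => ?_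
  rw [pd_sum _ _ fun b _ => ((hJ a j).mul (hJ b l)).mul (hgΦ a b)]
  rw [← Finset.sum_add_distrib, ← Finset.sum_add_distrib]
  refine Finset.sum_congr rfl fun b _ => ?_
  rw [pd_mul i ((hJ a j).mul (hJ b l)) (hgΦ a b), pd_mul i (hJ a j) (hJ b l),
    pd_comp (f := fun z => g z a b) i (hg a b) hΦ, add_mul, Finset.mul_sum]
  congr 1
  refine Finset.sum_congr rfl fun c _ => ?_
  simp only [jacobian, Matrix.of_apply]; ring

theorem pd_jacobian_symm (hΦ : ContDiffAt ℝ ∞ Φ y) (i j a : ι) :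
    pd i (fun z => jacobian Φ z a j) y = pd j (fun z => jacobian Φ z a i) y :=
  pd_comm i j (contDiffAt_pi.1 hΦ a)

/-- Six sums contain second derivatives of `Φ`. By the symmetry of `g` and of second derivatives,
four of them cancel in pairs; the remaining two are equal and absorb the factor ½. -/
theorem christoffelLower_pullback (hΦ : ContDiffAt ℝ ∞ Φ y) (hg : SmoothMatrixAt g (Φ y))
    (hs : (g (Φ y)).IsSymm) (i j l : ι) :
    christoffelLower (pullback Φ g) i j y l = ∑ b, jacobian Φ y b l *
      ((∑ a, g (Φ y) b a * pd i (fun z => jacobian Φ z a j) y) +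
        ∑ a, ∑ c, jacobian Φ y c i * jacobian Φ y a j * christoffelLower g c a (Φ y) b) := by
  simp only [christoffelLower]
  rw [pd_pullback hΦ hg, pd_pullback hΦ hg, pd_pullback hΦ hg]
  simp only [pd_jacobian_symm hΦ j i, pd_jacobian_symm hΦ l j, pd_jacobian_symm hΦ l i]
  set J := jacobian Φ y
  set H : ι → ι → ι → ℝ := fun a i j => pd i (fun z => jacobian Φ z a j) y with hH
  set D : ι → ι → ι → ℝ := fun c a b => pd c (fun z => g z a b) (Φ y) with hD
  have hsym : ∀ a b, g (Φ y) a b = g (Φ y) b a := fun a b => hs.apply b a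
  change 1 / 2 * (∑ a, ∑ b, H a i j * J b l * g (Φ y) a b +
      ∑ a, ∑ b, J a j * H b i l * g (Φ y) a b + ∑ a, ∑ b, ∑ c, J c i * J a j * J b l * D c a b +
      (∑ a, ∑ b, H a i j * J b l * g (Φ y) a b +
      ∑ a, ∑ b, J a i * H b j l * g (Φ y) a b + ∑ a, ∑ b, ∑ c, J c j * J a i * J b l * D c a b) -
      (∑ a, ∑ b, H a i l * J b j * g (Φ y) a b +
      ∑ a, ∑ b, J a i * H b j l * g (Φ y) a b + ∑ a, ∑ b, ∑ c, J c l * J a i * J b j * D c a b)) =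
    ∑ b, J b l * ((∑ a, g (Φ y) b a * H a i j) +
      ∑ a, ∑ c, J c i * J a j * (1 / 2 * (D c a b + D a c b - D b c a)))
  have e1 : ∑ a, ∑ b, J a j * H b i l * g (Φ y) a b = ∑ a, ∑ b, H a i l * J b j * g (Φ y) a b := by
    rw [Finset.sum_comm]
    exact Finset.sum_congr rfl fun a _ => Finset.sum_congr rfl fun b _ => by rw [hsym b a]; ring
  have e2 : ∑ a, ∑ b, H a i j * J b l * g (Φ y) a b =
      ∑ b, J b l * (∑ a, g (Φ y) b a * H a i j) := by
    rw [Finset.sum_comm]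
    refine Finset.sum_congr rfl fun b _ => ?_
    rw [Finset.mul_sum]
    exact Finset.sum_congr rfl fun a _ => by rw [hsym a b]; ring
  have e3 : ∑ b, J b l * (∑ a, ∑ c, J c i * J a j * (1 / 2 * (D c a b + D a c b - D b c a))) =
      1 / 2 * (∑ b, ∑ a, ∑ c, J c i * J a j * J b l * D c a b +
        ∑ b, ∑ a, ∑ c, J c i * J a j * J b l * D a c b -
        ∑ b, ∑ a, ∑ c, J c i * J a j * J b l * D b c a) := by
    simp only [Finset.mul_sum, ← Finset.sum_add_distrib, ← Finset.sum_sub_distrib]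
    exact Finset.sum_congr rfl fun b _ => Finset.sum_congr rfl fun a _ =>
      Finset.sum_congr rfl fun c _ => by ring
  have e4 : ∑ a, ∑ b, ∑ c, J c i * J a j * J b l * D c a b =
      ∑ b, ∑ a, ∑ c, J c i * J a j * J b l * D c a b := Finset.sum_comm
  have e5 : ∑ a, ∑ b, ∑ c, J c j * J a i * J b l * D c a b =
      ∑ b, ∑ a, ∑ c, J c i * J a j * J b l * D a c b := by
    rw [Finset.sum_comm]
    refine Finset.sum_congr rfl fun b _ => ?_
    rw [Finset.sum_comm]
    exact Finset.sum_congr rfl fun a _ => Finset.sum_congr rfl fun c _ => by ring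
  have e6 : ∑ a, ∑ b, ∑ c, J c l * J a i * J b j * D c a b =
      ∑ b, ∑ a, ∑ c, J c i * J a j * J b l * D b c a := by
    rw [Finset.sum_comm' (t' := Finset.univ) (s' := fun _ => Finset.univ) (by simp)]
    have : ∀ b, ∑ a, ∑ c, J c l * J a i * J b j * D c a b =
      ∑ c, ∑ a, J c l * J a i * J b j * D c a b := fun b => Finset.sum_comm
    simp only [this]
    rw [Finset.sum_comm]
    exact Finset.sum_congr rfl fun a _ => Finset.sum_congr rfl fun c _ =>
      Finset.sum_congr rfl fun c _ => by ring
  simp only [mul_add, Finset.sum_add_distrib]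
  rw [e3, e1, ← e2, e4, e5, e6]
  ring

/-- The transformation law of the Christoffel symbols. -/
theorem jacobian_mul_connMatrix (hΦ : ContDiffAt ℝ ∞ Φ y) (hg : SmoothMatrixAt g (Φ y))
    (hs : (g (Φ y)).IsSymm) (h0 : (g (Φ y)).det ≠ 0) (hJ0 : (jacobian Φ y).det ≠ 0) (j : ι) :
    jacobian Φ y * connMatrix (pullback Φ g) j y =
      pdM j (jacobian Φ) y + pulledConn Φ g j y * jacobian Φ y := by
  have h0' : (pullback Φ g y).det ≠ 0 := by
    rw [pullback_eq, Matrix.det_mul, Matrix.det_mul, Matrix.det_transpose]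
    exact mul_ne_zero (mul_ne_zero hJ0 h0) hJ0
  have key : ∀ i, (jacobian Φ y).mulVec (fun k => christoffel (pullback Φ g) k j i y) =
      fun e => pd j (fun z => jacobian Φ z e i) y +
        ∑ a, ∑ c, jacobian Φ y c j * jacobian Φ y a i * christoffel g e c a (Φ y) := by
    intro i
    -- The expected right-hand side. It is compared with the left after multiplication by Jᵀ g,
    -- which is injective.
    set V : ι → ℝ := fun e => pd j (fun z => jacobian Φ z e i) y +
        ∑ a, ∑ c, jacobian Φ y c j * jacobian Φ y a i * christoffel g e c a (Φ y) with hV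
    have h1 := mulVec_christoffel h0' j i
    rw [pullback_eq, ← Matrix.mulVec_mulVec, ← Matrix.mulVec_mulVec] at h1
    have h2 : christoffelLower (pullback Φ g) j i y =
        (jacobian Φ y).transpose.mulVec ((g (Φ y)).mulVec V) := by
      funext l
      rw [christoffelLower_pullback hΦ hg hs]
      simp only [Matrix.mulVec, dotProduct, Matrix.transpose_apply]
      refine Finset.sum_congr rfl fun b _ => ?_
      congr 1
      simp only [hV, mul_add, Finset.sum_add_distrib]
      congr 1
      simp only [Finset.mul_sum]
      rw [Finset.sum_comm' (t' := Finset.univ) (s' := fun _ => Finset.univ) (by simp)]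
      conv_rhs => rw [Finset.sum_comm]
      conv_lhs => rw [Finset.sum_comm]
      refine Finset.sum_congr rfl fun a _ => ?_
      conv_rhs => rw [Finset.sum_comm]
      refine Finset.sum_congr rfl fun c _ => ?_
      rw [← mulVec_christoffel h0]
      simp only [Matrix.mulVec, dotProduct, Finset.mul_sum]
      exact Finset.sum_congr rfl fun e _ => by ring
    rw [h2] at h1
    have inj : ∀ A : Matrix ι ι ℝ, A.det ≠ 0 → ∀ v w : ι → ℝ, A.mulVec v = A.mulVec w → v = w :=
      fun A hA v w h => Matrix.mulVec_injective_of_isUnit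
        ((Matrix.isUnit_iff_isUnit_det A).2 (isUnit_iff_ne_zero.2 hA)) h
    exact inj _ h0 _ _ (inj _ (by rwa [Matrix.det_transpose]) _ _ h1)
  ext e i
  have := congrFun (key i) e
  simp only [Matrix.mulVec, dotProduct] at this
  simp only [Matrix.mul_apply, connMatrix, Matrix.of_apply, Matrix.add_apply, pdM, this, pulledConn,
    Matrix.sum_apply, Matrix.smul_apply, smul_eq_mul, Finset.sum_mul]
  congr 1
  rw [Finset.sum_comm]
  exact Finset.sum_congr rfl fun a _ => Finset.sum_congr rfl fun c _ => by ring

theorem smoothMatrixAt_connMatrix (hg : SmoothMatrixAt g y) (h0 : (g y).det ≠ 0) (j : ι) :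
    SmoothMatrixAt (connMatrix g j) y :=
  fun k i => contDiffAt_christoffel hg h0 k j i

theorem pdM_pulledConn (hΦ : ContDiffAt ℝ ∞ Φ y) (hg : SmoothMatrixAt g (Φ y))
    (h0 : (g (Φ y)).det ≠ 0) (i j : ι) :
    pdM i (pulledConn Φ g j) y =
      ∑ a, pd i (fun z => jacobian Φ z a j) y • connMatrix g a (Φ y) +
      ∑ a, ∑ c, (jacobian Φ y c i * jacobian Φ y a j) • pdM c (connMatrix g a) (Φ y) := by
  have hJ := SmoothMatrixAt.jacobian hΦ
  have hC : ∀ a p q, ContDiffAt ℝ ∞ (fun z => connMatrix g a (Φ z) p q) y := fun a p q =>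
    (smoothMatrixAt_connMatrix hg h0 a p q).comp y hΦ
  ext p q
  simp only [pdM, pulledConn, Matrix.of_apply, Matrix.sum_apply, Matrix.add_apply,
    Matrix.smul_apply, smul_eq_mul]
  rw [pd_sum _ _ fun a _ => (hJ a j).mul (hC a p q), ← Finset.sum_add_distrib]
  refine Finset.sum_congr rfl fun a _ => ?_
  rw [pd_mul i (hJ a j) (hC a p q), pd_comp (f := fun z => connMatrix g a z p q) i
    (smoothMatrixAt_connMatrix hg h0 a p q) hΦ, Finset.mul_sum]
  congr 1
  refine Finset.sum_congr rfl fun c _ => ?_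
  simp only [jacobian, Matrix.of_apply]; ring

/-- The second derivatives of `Φ` are symmetric in i and j, hence drop out of the antisymmetrised
derivative; the rest transforms as a 2-form. -/
theorem gaugeCurvature_pulledConn (hΦ : ContDiffAt ℝ ∞ Φ y) (hg : SmoothMatrixAt g (Φ y))
    (h0 : (g (Φ y)).det ≠ 0) (i j : ι) :
    gaugeCurvature (pulledConn Φ g) i j y =
      ∑ a, ∑ b, (jacobian Φ y a i * jacobian Φ y b j) • gaugeCurvature (connMatrix g) a b (Φ y) := by
  have prod : ∀ i j, pulledConn Φ g i y * pulledConn Φ g j y = ∑ a, ∑ b,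
      (jacobian Φ y a i * jacobian Φ y b j) • (connMatrix g a (Φ y) * connMatrix g b (Φ y)) := by
    intro i j
    simp only [pulledConn, Finset.sum_mul, Finset.mul_sum, Matrix.smul_mul, Matrix.mul_smul,
      smul_smul]
    rw [Finset.sum_comm]
    exact Finset.sum_congr rfl fun a _ => Finset.sum_congr rfl fun b _ => by
      rw [mul_comm (jacobian Φ y b j)]
  simp only [gaugeCurvature]
  rw [pdM_pulledConn hΦ hg h0, pdM_pulledConn hΦ hg h0, prod, prod]
  simp only [pd_jacobian_symm hΦ j i]
  simp only [smul_add, smul_sub, Finset.sum_add_distrib, Finset.sum_sub_distrib]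
  have e1 : ∑ a, ∑ c, (jacobian Φ y c i * jacobian Φ y a j) • pdM c (connMatrix g a) (Φ y) =
      ∑ a, ∑ c, (jacobian Φ y a i * jacobian Φ y c j) • pdM a (connMatrix g c) (Φ y) :=
    Finset.sum_comm
  have e2 : ∑ a, ∑ c, (jacobian Φ y c j * jacobian Φ y a i) • pdM c (connMatrix g a) (Φ y) =
      ∑ a, ∑ c, (jacobian Φ y a i * jacobian Φ y c j) • pdM c (connMatrix g a) (Φ y) := by
    simp only [mul_comm]
  have e3 : ∑ a, ∑ b, (jacobian Φ y a j * jacobian Φ y b i) •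
        (connMatrix g a (Φ y) * connMatrix g b (Φ y)) =
      ∑ a, ∑ b, (jacobian Φ y a i * jacobian Φ y b j) •
        (connMatrix g b (Φ y) * connMatrix g a (Φ y)) := by
    rw [Finset.sum_comm]; simp only [mul_comm (jacobian Φ y _ j)]
  rw [e1, e2, e3]
  abel

/-- The connection of the pulled back metric is a gauge transform, by the Jacobian, of the pulled
back connection. Differentiating the transformation law and antisymmetrising kills the second
derivatives of the Jacobian; its first derivatives are eliminated by the law itself. -/
theorem jacobian_mul_gaugeCurvature (hΦ : ∀ᶠ z in 𝓝 y, ContDiffAt ℝ ∞ Φ z)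
    (hg : ∀ z, SmoothMatrixAt g z) (hs : ∀ z, (g z).IsSymm) (h0 : ∀ z, (g z).det ≠ 0)
    (hJ0 : ∀ᶠ z in 𝓝 y, (jacobian Φ z).det ≠ 0) (i j : ι) :
    jacobian Φ y * gaugeCurvature (connMatrix (pullback Φ g)) i j y =
      gaugeCurvature (pulledConn Φ g) i j y * jacobian Φ y := by
  have hΦy := hΦ.self_of_nhds
  have hJ := SmoothMatrixAt.jacobian hΦy
  have h0' : (pullback Φ g y).det ≠ 0 := by
    rw [pullback_eq, Matrix.det_mul, Matrix.det_mul, Matrix.det_transpose]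
    exact mul_ne_zero (mul_ne_zero hJ0.self_of_nhds (h0 _)) hJ0.self_of_nhds
  have hC : ∀ j, SmoothMatrixAt (connMatrix (pullback Φ g) j) y :=
    smoothMatrixAt_connMatrix (smoothMatrixAt_pullback hΦy (hg _)) h0'
  have hA : ∀ j, SmoothMatrixAt (pulledConn Φ g j) y := by
    intro j p q
    simp only [pulledConn, Matrix.sum_apply, Matrix.smul_apply, smul_eq_mul]
    exact contDiffAt_sum' _ fun a _ => (hJ a j).mul
      ((smoothMatrixAt_connMatrix (hg _) (h0 _) a p q).comp y hΦy)
  have law : ∀ j, ∀ᶠ z in 𝓝 y, jacobian Φ z * connMatrix (pullback Φ g) j z =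
      pdM j (jacobian Φ) z + pulledConn Φ g j z * jacobian Φ z := fun j => by
    filter_upwards [hΦ, hJ0] with z hz hz' using
      jacobian_mul_connMatrix hz (hg _) (hs _) (h0 _) hz' j
  have dlaw : ∀ i j, pdM i (jacobian Φ) y * connMatrix (pullback Φ g) j y +
      jacobian Φ y * pdM i (connMatrix (pullback Φ g) j) y =
      pdM i (pdM j (jacobian Φ)) y + (pdM i (pulledConn Φ g j) y * jacobian Φ y +
        pulledConn Φ g j y * pdM i (jacobian Φ) y) := by
    intro i j
    rw [← pdM_mul i hJ (hC j), ← pdM_mul i (hA j) hJ,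
      ← pdM_add i (hJ.pdM j) ((hA j).mul hJ)]
    ext p q
    exact pd_congr i ((law j).mono fun z hz => by simp only [hz])
  have hcomm : pdM i (pdM j (jacobian Φ)) y = pdM j (pdM i (jacobian Φ)) y := by
    ext p q; exact pd_comm i j (hJ p q)
  have hi := (law i).self_of_nhds
  have hj := (law j).self_of_nhds
  have di := dlaw i j
  have dj := dlaw j i
  simp only [gaugeCurvature]
  -- What is left is an identity in a non-commutative ring.
  generalize jacobian Φ y = J at *
  generalize connMatrix (pullback Φ g) i y = Ci at *
  generalize connMatrix (pullback Φ g) j y = Cj at *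
  generalize pulledConn Φ g i y = Ai at *
  generalize pulledConn Φ g j y = Aj at *
  generalize pdM i (connMatrix (pullback Φ g) j) y = dCij at *
  generalize pdM j (connMatrix (pullback Φ g) i) y = dCji at *
  generalize pdM i (pulledConn Φ g j) y = dAij at *
  generalize pdM j (pulledConn Φ g i) y = dAji at *
  generalize pdM i (pdM j (jacobian Φ)) y = HH at *
  subst hcomm
  have di' : J * dCij = pdM j (pdM i (jacobian Φ)) y + dAij * J + Aj * pdM i (jacobian Φ) y -
      pdM i (jacobian Φ) y * Cj := by rw [eq_sub_iff_add_eq, add_comm, di]; abel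
  have dj' : J * dCji = pdM j (pdM i (jacobian Φ)) y + dAji * J + Ai * pdM j (jacobian Φ) y -
      pdM j (jacobian Φ) y * Ci := by rw [eq_sub_iff_add_eq, add_comm, dj]; abel
  have hi' : pdM i (jacobian Φ) y = J * Ci - Ai * J := eq_sub_of_add_eq hi.symm
  have hj' : pdM j (jacobian Φ) y = J * Cj - Aj * J := eq_sub_of_add_eq hj.symm
  rw [mul_sub, mul_add, mul_sub, di', dj', hi', hj']
  noncomm_ring

/-- The Jacobian acting on the contracted form index meets the inverse Jacobian acting on the upper
index, and the two cancel. -/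
theorem contract_gauge (J K : Matrix ι ι ℝ) (hinv : J * K = 1)
    (F : ι → ι → ι → ι → ℝ) (i j : ι) :
    ∑ k, ∑ q, (∑ p, K k p * ∑ a, ∑ b, J a k * J b j * F a b p q) * J q i =
      ∑ b, (∑ q, J q i * ∑ p, F p b p q) * J b j := by
  have hinv' : ∀ a p, ∑ k, J a k * K k p = if a = p then 1 else 0 := fun a p => by
    rw [← Matrix.mul_apply, hinv, Matrix.one_apply]
  have l1 : ∀ q p, ∑ k, K k p * ∑ a, ∑ b, J a k * J b j * F a b p q =
      ∑ b, J b j * F p b p q := by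
    intro q p
    have : ∑ k, K k p * ∑ a, ∑ b, J a k * J b j * F a b p q =
        ∑ a, (∑ k, J a k * K k p) * ∑ b, J b j * F a b p q := by
      simp only [Finset.mul_sum, Finset.sum_mul]
      rw [Finset.sum_comm]
      refine Finset.sum_congr rfl fun a _ => ?_
      rw [Finset.sum_comm]
      exact Finset.sum_congr rfl fun b _ => Finset.sum_congr rfl fun k _ => by ring
    rw [this]
    simp [hinv']
  calc _ = ∑ q, (∑ p, ∑ k, K k p * ∑ a, ∑ b, J a k * J b j * F a b p q) * J q i := by
        rw [Finset.sum_comm]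
        refine Finset.sum_congr rfl fun q _ => ?_
        rw [← Finset.sum_mul, Finset.sum_comm]
    _ = ∑ q, (∑ p, ∑ b, J b j * F p b p q) * J q i := by simp only [l1]
    _ = _ := by
        simp only [Finset.mul_sum, Finset.sum_mul]
        conv_rhs => rw [Finset.sum_comm]
        refine Finset.sum_congr rfl fun q _ => ?_
        rw [Finset.sum_comm]
        exact Finset.sum_congr rfl fun b _ => Finset.sum_congr rfl fun p _ => by ring

/-- The Ricci tensor is natural under local diffeomorphisms. -/
theorem ricci_pullback (hΦ : ∀ᶠ z in 𝓝 y, ContDiffAt ℝ ∞ Φ z)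
    (hg : ∀ z, SmoothMatrixAt g z) (hs : ∀ z, (g z).IsSymm) (h0 : ∀ z, (g z).det ≠ 0)
    (hJ0 : ∀ᶠ z in 𝓝 y, (jacobian Φ z).det ≠ 0) :
    ricci (pullback Φ g) y =
      (jacobian Φ y).transpose * ricci g (Φ y) * jacobian Φ y := by
  have hs' : ∀ z, (pullback Φ g z).IsSymm := fun z => by
    rw [Matrix.IsSymm, pullback_eq]
    simp only [Matrix.transpose_mul, Matrix.transpose_transpose, (hs (Φ z)).eq, Matrix.mul_assoc]
  have hJ : IsUnit (jacobian Φ y).det := isUnit_iff_ne_zero.2 hJ0.self_of_nhds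
  have hF : ∀ i j, gaugeCurvature (connMatrix (pullback Φ g)) i j y =
      (jacobian Φ y)⁻¹ * (∑ a, ∑ b, (jacobian Φ y a i * jacobian Φ y b j) •
        gaugeCurvature (connMatrix g) a b (Φ y)) * jacobian Φ y := by
    intro i j
    rw [← gaugeCurvature_pulledConn hΦ.self_of_nhds (hg _) (h0 _), Matrix.mul_assoc,
      ← jacobian_mul_gaugeCurvature hΦ hg hs h0 hJ0, ← Matrix.mul_assoc,
      Matrix.nonsing_inv_mul _ hJ, Matrix.one_mul]
  ext i j
  rw [ricci_eq_gaugeCurvature (Eventually.of_forall hs')]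
  simp only [hF, Matrix.mul_apply, Matrix.sum_apply, Matrix.smul_apply, smul_eq_mul,
    Matrix.transpose_apply, ricci_eq_gaugeCurvature (Eventually.of_forall hs)]
  exact contract_gauge _ _ (Matrix.mul_nonsing_inv _ hJ)
    (fun a b p q => gaugeCurvature (connMatrix g) a b (Φ y) p q) i j

end Naturality

/-! ### Traces and norms under a change of frame. -/

section Invariants

variable {ι : Type} [Fintype ι] [DecidableEq ι] {J h T : Matrix ι ι ℝ}

theorem inv_congruence (h : Matrix ι ι ℝ) :
    (J.transpose * h * J)⁻¹ = J⁻¹ * h⁻¹ * J⁻¹.transpose := by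
  rw [Matrix.mul_inv_rev, Matrix.mul_inv_rev, Matrix.transpose_nonsing_inv, Matrix.mul_assoc]

theorem sum_inv_mul_eq_trace (h T : Matrix ι ι ℝ) :
    ∑ i, ∑ j, h⁻¹ i j * T i j = (h⁻¹ * T.transpose).trace := by
  simp [Matrix.trace, Matrix.mul_apply]

theorem tensorNorm_eq (h T : Matrix ι ι ℝ) :
    tensorNorm h T = Real.sqrt ((h⁻¹ * (T * h⁻¹ * T.transpose).transpose).trace) := by
  rw [tensorNorm, ← sum_inv_mul_eq_trace]
  congr 1
  refine Finset.sum_congr rfl fun i _ => ?_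
  rw [Finset.sum_comm]
  refine Finset.sum_congr rfl fun k _ => ?_
  simp only [Matrix.mul_apply, Matrix.transpose_apply, Finset.mul_sum, Finset.sum_mul]
  rw [Finset.sum_comm]
  exact Finset.sum_congr rfl fun l _ => Finset.sum_congr rfl fun j _ => by ring

theorem trace_congruence (hJ : IsUnit J.det) (h T : Matrix ι ι ℝ) :
    ((J.transpose * h * J)⁻¹ * (J.transpose * T * J).transpose).trace =
      (h⁻¹ * T.transpose).trace := by
  rw [inv_congruence, Matrix.transpose_mul, Matrix.transpose_mul, Matrix.transpose_transpose]
  have e : J⁻¹ * h⁻¹ * J⁻¹.transpose * (J.transpose * (T.transpose * J)) =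
      J⁻¹ * (h⁻¹ * T.transpose * J) := by
    have : J⁻¹.transpose * J.transpose = 1 := by
      rw [← Matrix.transpose_mul, Matrix.mul_nonsing_inv _ hJ, Matrix.transpose_one]
    calc _ = J⁻¹ * h⁻¹ * (J⁻¹.transpose * J.transpose) * (T.transpose * J) := by
          simp only [Matrix.mul_assoc]
      _ = _ := by rw [this]; simp only [Matrix.mul_assoc, Matrix.one_mul]
  rw [e, Matrix.trace_mul_comm, Matrix.mul_assoc, Matrix.mul_assoc, Matrix.mul_nonsing_inv _ hJ,
    Matrix.mul_one]

theorem tensorNorm_congruence (hJ : IsUnit J.det) (h T : Matrix ι ι ℝ) :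
    tensorNorm (J.transpose * h * J) (J.transpose * T * J) = tensorNorm h T := by
  have h1 : J⁻¹.transpose * J.transpose = 1 := by
    rw [← Matrix.transpose_mul, Matrix.mul_nonsing_inv _ hJ, Matrix.transpose_one]
  have key : J.transpose * T * J * (J.transpose * h * J)⁻¹ * (J.transpose * T * J).transpose =
      J.transpose * (T * h⁻¹ * T.transpose) * J := by
   rw [inv_congruence, Matrix.transpose_mul, Matrix.transpose_mul, Matrix.transpose_transpose]
   calc _ = J.transpose * T * (J * J⁻¹) * h⁻¹ * (J⁻¹.transpose * J.transpose) *
        (T.transpose * J) := by simp only [Matrix.mul_assoc]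
    _ = _ := by
      rw [h1, Matrix.mul_nonsing_inv _ hJ]; simp only [Matrix.mul_assoc, Matrix.one_mul]
  rw [tensorNorm_eq, tensorNorm_eq, key, trace_congruence hJ]

theorem covectorNormSq_eq (h : Matrix ι ι ℝ) (α : ι → ℝ) :
    covectorNormSq h α = α ⬝ᵥ h⁻¹.mulVec α := by
  simp only [covectorNormSq, dotProduct, Matrix.mulVec, Finset.mul_sum]
  exact Finset.sum_congr rfl fun i _ => Finset.sum_congr rfl fun j _ => by ring

theorem covectorNormSq_congruence (hJ : IsUnit J.det) (h : Matrix ι ι ℝ) (α : ι → ℝ) :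
    covectorNormSq (J.transpose * h * J) (J.transpose.mulVec α) = covectorNormSq h α := by
  have h1 : J⁻¹.transpose * J.transpose = 1 := by
    rw [← Matrix.transpose_mul, Matrix.mul_nonsing_inv _ hJ, Matrix.transpose_one]
  rw [covectorNormSq_eq, covectorNormSq_eq, inv_congruence, Matrix.mulVec_mulVec,
    Matrix.mul_assoc, h1, Matrix.mul_one, Matrix.mulVec_transpose, ← Matrix.dotProduct_mulVec,
    Matrix.mulVec_mulVec, ← Matrix.mul_assoc, Matrix.mul_nonsing_inv _ hJ, Matrix.one_mul]

end Invariants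

/-! ### Curvature invariants of a pulled back metric. -/

section InvariantsOfPullback

variable {ι : Type} [Fintype ι] [DecidableEq ι] {Φ : (ι → ℝ) → (ι → ℝ)}
  {g : (ι → ℝ) → Matrix ι ι ℝ} {y : ι → ℝ}

theorem scalarCurvature_pullback (hΦ : ∀ᶠ z in 𝓝 y, ContDiffAt ℝ ∞ Φ z)
    (hg : ∀ z, SmoothMatrixAt g z) (hs : ∀ z, (g z).IsSymm) (h0 : ∀ z, (g z).det ≠ 0)
    (hJ0 : ∀ᶠ z in 𝓝 y, (jacobian Φ z).det ≠ 0) :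
    scalarCurvature (pullback Φ g) y = scalarCurvature g (Φ y) := by
  rw [scalarCurvature, scalarCurvature, sum_inv_mul_eq_trace, sum_inv_mul_eq_trace,
    ricci_pullback hΦ hg hs h0 hJ0, pullback_eq,
    trace_congruence (isUnit_iff_ne_zero.2 hJ0.self_of_nhds)]

theorem tensorNorm_ricci_pullback (hΦ : ∀ᶠ z in 𝓝 y, ContDiffAt ℝ ∞ Φ z)
    (hg : ∀ z, SmoothMatrixAt g z) (hs : ∀ z, (g z).IsSymm) (h0 : ∀ z, (g z).det ≠ 0)
    (hJ0 : ∀ᶠ z in 𝓝 y, (jacobian Φ z).det ≠ 0) (c : ℝ) :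
    tensorNorm (pullback Φ g y) (ricci (pullback Φ g) y + c • pullback Φ g y) =
      tensorNorm (g (Φ y)) (ricci g (Φ y) + c • g (Φ y)) := by
  rw [← tensorNorm_congruence (isUnit_iff_ne_zero.2 hJ0.self_of_nhds) (g (Φ y)),
    ricci_pullback hΦ hg hs h0 hJ0, pullback_eq, Matrix.mul_add, Matrix.add_mul,
    Matrix.mul_smul, Matrix.smul_mul]

theorem ricci_translate (g : (ι → ℝ) → Matrix ι ι ℝ) (e y : ι → ℝ) (hg : ∀ z, g (z + e) = g z) :
    ricci g (y + e) = ricci g y := by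
  have hΓ : ∀ k i j z, christoffel g k i j (z + e) = christoffel g k i j z := by
    intro k i j z
    simp only [christoffel, pd_translate, hg]
  ext i j
  simp only [ricci, Matrix.of_apply, pd_translate, hΓ]

end InvariantsOfPullback

/-! ### Symbol classes at the end r → ∞. -/

section Symbols

variable {ι : Type} [Fintype ι] [DecidableEq ι]

/-- The filter of neighbourhoods `{y | ρ < yᵒ}` of the end `yᵒ → ∞`. -/
def atEnd (o : ι) : Filter (ι → ℝ) := comap (fun y => y o) atTop

/-- The end `yᵒ → ∞` with all other coordinates bounded by `B`. -/
def endBox (o : ι) (B : ℝ) : Filter (ι → ℝ) := atEnd o ⊓ 𝓟 {y | ∀ i, i ≠ o → |y i| ≤ B}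

/-- Symbols of order `-p` in `yᵒ`, controlled together with `k` derivatives for bounded values of
the other coordinates: a derivative in the direction `o` improves the decay by one power. -/
def IsSymbol (o : ι) (B : ℝ) : ℕ → ℤ → ((ι → ℝ) → ℝ) → Prop
  | 0, p, f => (∀ᶠ y in atEnd o, ContDiffAt ℝ ∞ f y) ∧ f =O[endBox o B] fun y => y o ^ (-p)
  | k + 1, p, f => ((∀ᶠ y in atEnd o, ContDiffAt ℝ ∞ f y) ∧
      f =O[endBox o B] fun y => y o ^ (-p)) ∧
      ∀ i, IsSymbol o B k (p + if i = o then 1 else 0) (pd i f)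

variable {o : ι} {B : ℝ} {k : ℕ} {p q : ℤ} {f g : (ι → ℝ) → ℝ}

theorem eventually_atEnd {P : (ι → ℝ) → Prop} :
    (∀ᶠ y in atEnd o, P y) ↔ ∃ ρ : ℝ, ∀ y, ρ < y o → P y := by
  simp only [atEnd, ((atTop_basis_Ioi (α := ℝ)).comap _).eventually_iff, true_and]; rfl

/-- The sets {ρ < yᵒ} are open; this is what allows identities valid near the end to be
differentiated. -/
theorem eventually_atEnd_nhds {P : (ι → ℝ) → Prop} (h : ∀ᶠ y in atEnd o, P y) :
    ∀ᶠ y in atEnd o, ∀ᶠ z in 𝓝 y, P z := by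
  obtain ⟨ρ, hρ⟩ := eventually_atEnd.1 h
  refine eventually_atEnd.2 ⟨ρ, fun y hy => ?_⟩
  have : IsOpen {z : ι → ℝ | ρ < z o} := isOpen_lt continuous_const (continuous_apply o)
  exact Filter.mem_of_superset (this.mem_nhds hy) hρ

theorem endBox_le : endBox o B ≤ atEnd o := inf_le_left

theorem tendsto_atEnd : Tendsto (fun y : ι → ℝ => y o) (atEnd o) atTop := tendsto_comap

theorem eventually_gt_atEnd (c : ℝ) : ∀ᶠ y in atEnd o, c < y o :=
  tendsto_atEnd.eventually_gt_atTop c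

theorem eventually_pd_congr (i : ι) (h : f =ᶠ[atEnd o] g) : pd i f =ᶠ[atEnd o] pd i g :=
  (eventually_atEnd_nhds h).mono fun _ hy => pd_congr i hy

theorem IsSymbol.base (h : IsSymbol o B k p f) : (∀ᶠ y in atEnd o, ContDiffAt ℝ ∞ f y) ∧
    f =O[endBox o B] fun y => y o ^ (-p) := by
  cases k with
  | zero => exact h
  | succ k => exact h.1

theorem IsSymbol.smooth (h : IsSymbol o B k p f) : ∀ᶠ y in atEnd o, ContDiffAt ℝ ∞ f y := h.base.1

theorem IsSymbol.isBigO (h : IsSymbol o B k p f) : f =O[endBox o B] fun y => y o ^ (-p) := h.base.2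

theorem IsSymbol.pd (h : IsSymbol o B (k + 1) p f) (i : ι) :
    IsSymbol o B k (p + if i = o then 1 else 0) (pd i f) := h.2 i

theorem IsSymbol.pd_self (h : IsSymbol o B (k + 1) p f) : IsSymbol o B k (p + 1) (AHM.pd o f) := by
  simpa using h.pd o

theorem IsSymbol.pd_ne (h : IsSymbol o B (k + 1) p f) {i : ι} (hi : i ≠ o) :
    IsSymbol o B k p (AHM.pd i f) := by
  simpa [hi] using h.pd i

theorem IsSymbol.lower (h : IsSymbol o B (k + 1) p f) : IsSymbol o B k p f := by
  induction k generalizing p f with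
  | zero => exact h.base
  | succ k ih => exact ⟨h.base, fun i => ih (h.pd i)⟩

theorem IsSymbol.zero (h : IsSymbol o B k p f) : IsSymbol o B 0 p f := h.base

theorem IsSymbol.congr (hf : IsSymbol o B k p f) (h : f =ᶠ[atEnd o] g) : IsSymbol o B k p g := by
  induction k generalizing p f g with
  | zero =>
    refine ⟨?_, hf.2.congr' (h.filter_mono endBox_le) EventuallyEq.rfl⟩
    filter_upwards [hf.1, eventually_atEnd_nhds h] with y hy hy' using hy.congr_of_eventuallyEq
      (hy'.mono fun _ hz => hz.symm)
  | succ k ih =>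
    refine ⟨⟨?_, hf.isBigO.congr' (h.filter_mono endBox_le) EventuallyEq.rfl⟩, fun i =>
      ih (hf.pd i) (eventually_pd_congr i h)⟩
    filter_upwards [hf.smooth, eventually_atEnd_nhds h] with y hy hy' using
      hy.congr_of_eventuallyEq (hy'.mono fun _ hz => hz.symm)

theorem isBigO_zpow_of_le (h : q ≤ p) :
    (fun y : ι → ℝ => y o ^ (-p)) =O[atEnd o] fun y => y o ^ (-q) := by
  refine IsBigO.of_bound 1 ?_
  filter_upwards [eventually_gt_atEnd 1] with y hy
  rw [one_mul, norm_zpow, norm_zpow, Real.norm_of_nonneg (by linarith)]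
  exact zpow_le_zpow_right₀ hy.le (by omega)

theorem IsSymbol.mono (hf : IsSymbol o B k p f) (h : q ≤ p) : IsSymbol o B k q f := by
  induction k generalizing p q f with
  | zero => exact ⟨hf.1, hf.2.trans ((isBigO_zpow_of_le h).mono endBox_le)⟩
  | succ k ih =>
    exact ⟨⟨hf.smooth, hf.isBigO.trans ((isBigO_zpow_of_le h).mono endBox_le)⟩, fun i =>
      ih (hf.pd i) (by omega)⟩

theorem IsSymbol.add (hf : IsSymbol o B k p f) (hg : IsSymbol o B k p g) :
    IsSymbol o B k p fun y => f y + g y := by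
  have h0 : (∀ᶠ y in atEnd o, ContDiffAt ℝ ∞ (fun y => f y + g y) y) ∧
      (fun y => f y + g y) =O[endBox o B] fun y => y o ^ (-p) :=
    ⟨by filter_upwards [hf.smooth, hg.smooth] with y h1 h2 using h1.add h2,
      hf.isBigO.add hg.isBigO⟩
  induction k generalizing p f g with
  | zero => exact h0
  | succ k ih =>
    refine ⟨h0, fun i => ?_⟩
    have hi : AHM.pd i (fun y => f y + g y) =ᶠ[atEnd o] fun y => AHM.pd i f y + AHM.pd i g y := by
      filter_upwards [hf.smooth, hg.smooth] with y h1 h2 using pd_add i h1 h2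
    refine IsSymbol.congr (ih (hf.pd i) (hg.pd i) ?_) hi.symm
    refine ⟨?_, (hf.pd i).isBigO.add (hg.pd i).isBigO⟩
    filter_upwards [(hf.pd i).smooth, (hg.pd i).smooth] with y h1 h2 using h1.add h2

theorem IsSymbol.mul (hf : IsSymbol o B k p f) (hg : IsSymbol o B k q g) :
    IsSymbol o B k (p + q) fun y => f y * g y := by
  have h0 : ∀ {k p q f g}, IsSymbol o B k p f → IsSymbol o B k q g →
      (∀ᶠ y in atEnd o, ContDiffAt ℝ ∞ (fun y => f y * g y) y) ∧
      (fun y => f y * g y) =O[endBox o B] fun y => y o ^ (-(p + q)) := by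
    intro k p q f g hf hg
    refine ⟨by filter_upwards [hf.smooth, hg.smooth] with y h1 h2 using h1.mul h2, ?_⟩
    refine (hf.isBigO.mul hg.isBigO).congr' EventuallyEq.rfl ?_
    filter_upwards [(eventually_gt_atEnd (0 : ℝ)).filter_mono endBox_le] with y hy
    rw [← zpow_add₀ hy.ne']; congr 1; ring
  induction k generalizing p q f g with
  | zero => exact h0 hf hg
  | succ k ih =>
    refine ⟨h0 hf hg, fun i => ?_⟩
    have hi : AHM.pd i (fun y => f y * g y) =ᶠ[atEnd o]
        fun y => AHM.pd i f y * g y + f y * AHM.pd i g y := by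
      filter_upwards [hf.smooth, hg.smooth] with y h1 h2 using pd_mul i h1 h2
    refine IsSymbol.congr (IsSymbol.add ?_ ?_) hi.symm
    · exact (ih (hf.pd i) hg.lower).mono (by omega)
    · exact (ih hf.lower (hg.pd i)).mono (by omega)

theorem isBigO_one_zpow (hp : p ≤ 0) (c : ℝ) :
    (fun _ : ι → ℝ => c) =O[endBox o B] fun y => y o ^ (-p) := by
  have := ((isBigO_zpow_of_le (o := o) hp).mono (endBox_le (B := B)))
  simp only [neg_zero, zpow_zero] at this
  exact (isBigO_const_const c one_ne_zero _).trans this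

theorem isSymbol_zero : IsSymbol o B k p fun _ => 0 := by
  induction k generalizing p with
  | zero => exact ⟨Eventually.of_forall fun _ => contDiffAt_const, isBigO_zero _ _⟩
  | succ k ih =>
    refine ⟨⟨Eventually.of_forall fun _ => contDiffAt_const, isBigO_zero _ _⟩, fun i => ?_⟩
    exact ih.congr (Eventually.of_forall fun y => (pd_const i 0 y).symm)

theorem isSymbol_const (c : ℝ) : IsSymbol o B k 0 fun _ => c := by
  have h0 : (∀ᶠ y : ι → ℝ in atEnd o, ContDiffAt ℝ ∞ (fun _ => c) y) ∧
      (fun _ : ι → ℝ => c) =O[endBox o B] fun y => y o ^ (-0 : ℤ) :=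
    ⟨Eventually.of_forall fun _ => contDiffAt_const, isBigO_one_zpow le_rfl c⟩
  cases k with
  | zero => exact h0
  | succ k =>
    refine ⟨h0, fun i => ?_⟩
    exact isSymbol_zero.congr (Eventually.of_forall fun y => (pd_const i c y).symm)

theorem IsSymbol.const_mul (hf : IsSymbol o B k p f) (c : ℝ) :
    IsSymbol o B k p fun y => c * f y := by
  simpa using (isSymbol_const c).mul hf

theorem IsSymbol.neg (hf : IsSymbol o B k p f) : IsSymbol o B k p fun y => -f y := by
  simpa using hf.const_mul (-1)

theorem IsSymbol.sub (hf : IsSymbol o B k p f) (hg : IsSymbol o B k p g) :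
    IsSymbol o B k p fun y => f y - g y := by
  simpa [sub_eq_add_neg] using hf.add hg.neg

theorem IsSymbol.sum {κ : Type} {s : Finset κ} {F : κ → (ι → ℝ) → ℝ}
    (hF : ∀ a ∈ s, IsSymbol o B k p (F a)) : IsSymbol o B k p fun y => ∑ a ∈ s, F a y := by
  classical
  induction s using Finset.induction_on with
  | empty => simpa using isSymbol_zero
  | insert a s ha ih =>
    simp only [Finset.sum_insert ha]
    exact (hF a (Finset.mem_insert_self a s)).add
      (ih fun b hb => hF b (Finset.mem_insert_of_mem hb))

theorem IsSymbol.prod {κ : Type} {s : Finset κ} {F : κ → (ι → ℝ) → ℝ}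
    (hF : ∀ a ∈ s, IsSymbol o B k 0 (F a)) : IsSymbol o B k 0 fun y => ∏ a ∈ s, F a y := by
  classical
  induction s using Finset.induction_on with
  | empty => simpa using isSymbol_const 1
  | insert a s ha ih =>
    simp only [Finset.prod_insert ha]
    simpa using (hF a (Finset.mem_insert_self a s)).mul
      (ih fun b hb => hF b (Finset.mem_insert_of_mem hb))

theorem contDiffAt_coord (i : ι) (y : ι → ℝ) : ContDiffAt ℝ ∞ (fun z : ι → ℝ => z i) y :=
  (contDiff_apply ℝ ℝ i).contDiffAt

theorem contDiffAt_coord_zpow {y : ι → ℝ} (hy : y o ≠ 0) (p : ℤ) :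
    ContDiffAt ℝ ∞ (fun z : ι → ℝ => z o ^ p) y := by
  cases p with
  | ofNat n => simpa using (contDiffAt_coord o y).pow n
  | negSucc n =>
    simp only [zpow_negSucc]
    exact ((contDiffAt_coord o y).pow (n + 1)).inv (pow_ne_zero _ hy)

theorem pd_coord (i j : ι) (y : ι → ℝ) :
    pd i (fun z : ι → ℝ => z j) y = if i = j then 1 else 0 := by
  have : fderiv ℝ (fun z : ι → ℝ => z j) y = ContinuousLinearMap.proj j :=
    (ContinuousLinearMap.proj (R := ℝ) (φ := fun _ : ι => ℝ) j).fderiv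
  rw [pd, this]
  simp [Pi.single_apply, eq_comm]

/-- The chain rule for a function of the single coordinate `yᵒ`. -/
theorem pd_comp_coord {φ : ℝ → ℝ} {φ' : ℝ} {y : ι → ℝ} (h : HasDerivAt φ φ' (y o)) (i : ι) :
    pd i (fun z => φ (z o)) y = if i = o then φ' else 0 := by
  have h2 : HasFDerivAt (fun z : ι → ℝ => z o) (ContinuousLinearMap.proj (R := ℝ)
    (φ := fun _ : ι => ℝ) o) y :=
    (ContinuousLinearMap.proj (R := ℝ) (φ := fun _ : ι => ℝ) o).hasFDerivAt
  have := (h.comp_hasFDerivAt y h2).fderiv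
  change fderiv ℝ (fun z => φ (z o)) y = _ at this
  rw [pd, this]
  simp [Pi.single_apply, eq_comm]

theorem pd_coord_zpow {y : ι → ℝ} (hy : y o ≠ 0) (p : ℤ) (i : ι) :
    pd i (fun z : ι → ℝ => z o ^ p) y = if i = o then (p : ℝ) * y o ^ (p - 1) else 0 :=
  pd_comp_coord (φ := fun t => t ^ p) (hasDerivAt_zpow p _ (Or.inl hy)) i

theorem isSymbol_zpow (p : ℤ) : IsSymbol o B k p fun y => y o ^ (-p) := by
  have h0 : ∀ p : ℤ, (∀ᶠ y : ι → ℝ in atEnd o, ContDiffAt ℝ ∞ (fun y => y o ^ (-p)) y) ∧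
      (fun y : ι → ℝ => y o ^ (-p)) =O[endBox o B] fun y => y o ^ (-p) := fun p =>
    ⟨(eventually_gt_atEnd 0).mono fun y hy => contDiffAt_coord_zpow hy.ne' _, isBigO_refl _ _⟩
  induction k generalizing p with
  | zero => exact h0 p
  | succ k ih =>
    refine ⟨h0 p, fun i => ?_⟩
    by_cases hi : i = o
    · subst hi
      simp only [if_true]
      refine ((ih (p + 1)).const_mul (-p : ℝ)).congr ?_
      filter_upwards [eventually_gt_atEnd 0] with y hy
      rw [pd_coord_zpow hy.ne', if_pos rfl]; push_cast
      congr 2; ring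
    · simp only [if_neg hi, add_zero]
      refine isSymbol_zero.congr ?_
      filter_upwards [eventually_gt_atEnd 0] with y hy
      rw [pd_coord_zpow hy.ne', if_neg hi]

theorem isSymbol_zpow' (p : ℤ) : IsSymbol o B k (-p) fun y => y o ^ p := by
  simpa using isSymbol_zpow (o := o) (B := B) (k := k) (-p)

theorem isSymbol_pow (n : ℕ) : IsSymbol o B k (-n) fun y => y o ^ n := by
  simpa using isSymbol_zpow' (o := o) (B := B) (k := k) (n : ℤ)

theorem isSymbol_coord : IsSymbol o B k (-1) fun y => y o := by
  simpa using isSymbol_zpow' (o := o) (B := B) (k := k) 1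

theorem isSymbol_inv_pow (n : ℕ) : IsSymbol o B k n fun y => (y o ^ n)⁻¹ := by
  simpa using isSymbol_zpow (o := o) (B := B) (k := k) (n : ℤ)

/-- The derivative -∂f · f⁻¹ · f⁻¹ contains f⁻¹ undifferentiated, so induction on the number of
derivatives needs a bound on f⁻¹ at order zero only. -/
theorem IsSymbol.inv (hf : IsSymbol o B k 0 f) (h0 : ∀ᶠ y in atEnd o, f y ≠ 0)
    (hb : (fun y => (f y)⁻¹) =O[endBox o B] fun _ => (1 : ℝ)) :
    IsSymbol o B k 0 fun y => (f y)⁻¹ := by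
  have hb0 : ∀ {k}, IsSymbol o B k 0 f → (∀ᶠ y in atEnd o, ContDiffAt ℝ ∞ (fun y => (f y)⁻¹) y) ∧
      (fun y => (f y)⁻¹) =O[endBox o B] fun y => y o ^ (-0 : ℤ) := fun hf =>
    ⟨by filter_upwards [hf.smooth, h0] with y h1 h2 using h1.inv h2, by simpa using hb⟩
  induction k with
  | zero => exact hb0 hf
  | succ k ih =>
    refine ⟨hb0 hf, fun i => ?_⟩
    have hi : AHM.pd i (fun y => (f y)⁻¹) =ᶠ[atEnd o]
        fun y => -(AHM.pd i f y * (f y)⁻¹ * (f y)⁻¹) := by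
      filter_upwards [hf.smooth, h0] with y h1 h2 using pd_inv i h1 h2
    refine IsSymbol.congr ?_ hi.symm
    simpa using (((hf.pd i).mul (ih hf.lower)).mul (ih hf.lower)).neg

/-- Smooth functions of the coordinates other than `yᵒ`. -/
def IsAngular (o : ι) (c : (ι → ℝ) → ℝ) : Prop :=
  ContDiff ℝ ∞ c ∧ ∀ y t, c (Function.update y o t) = c y

theorem IsAngular.pd_self {c : (ι → ℝ) → ℝ} (hc : IsAngular o c) (y : ι → ℝ) : pd o c y = 0 := by
  have h1 : HasDerivAt (fun t => c (Function.update y o t)) (fderiv ℝ c y (Pi.single o 1)) (y o) := by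
    have hc1 : HasFDerivAt c (fderiv ℝ c y) (Function.update y o (y o)) := by
      rw [Function.update_eq_self]
      exact (hc.1.differentiable (by simp) y).hasFDerivAt
    exact hc1.comp_hasDerivAt _ (hasDerivAt_update y o (y o))
  simp only [hc.2] at h1
  exact h1.unique (hasDerivAt_const _ _)

theorem IsAngular.pd {c : (ι → ℝ) → ℝ} (hc : IsAngular o c) (i : ι) : IsAngular o (pd i c) := by
  refine ⟨contDiff_iff_contDiffAt.2 fun y => ContDiffAt.pd hc.1.contDiffAt i, fun y t => ?_⟩
  have e : Function.update y o t = y + Pi.single o (t - y o) := by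
    funext j
    by_cases hj : j = o
    · subst hj; simp
    · simp [hj]
  have hc2 : ∀ z : ι → ℝ, ∀ s, c (z + Pi.single o s) = c z := by
    intro z s
    rw [← hc.2 z (z o + s)]
    congr 1
    funext j
    by_cases hj : j = o
    · subst hj; simp
    · simp [hj]
  rw [e, pd_translate]
  simp only [hc2]

/-- Resetting the radial coordinate to 0 leaves `c` unchanged and brings the whole box into a
compact ball. -/
theorem IsAngular.isSymbol {c : (ι → ℝ) → ℝ} (hc : IsAngular o c) : IsSymbol o B k 0 c := by
  have h0 : ∀ {c}, IsAngular o c → (∀ᶠ y in atEnd o, ContDiffAt ℝ ∞ c y) ∧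
      c =O[endBox o B] fun y => y o ^ (-0 : ℤ) := by
    intro c hc
    refine ⟨Eventually.of_forall fun _ => hc.1.contDiffAt, ?_⟩
    simp only [neg_zero, zpow_zero]
    obtain ⟨C, hC⟩ := (isCompact_closedBall (0 : ι → ℝ) |B|).exists_bound_of_continuousOn
      hc.1.continuous.continuousOn
    refine IsBigO.of_bound C ?_
    have : ∀ᶠ y in endBox o B, ∀ i, i ≠ o → |y i| ≤ B := mem_inf_of_right (mem_principal_self _)
    filter_upwards [this] with y hy
    rw [norm_one, mul_one, ← hc.2 y 0]
    refine hC _ ?_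
    rw [mem_closedBall_zero_iff, pi_norm_le_iff_of_nonneg (abs_nonneg B)]
    intro i
    by_cases hi : i = o
    · subst hi; simp
    · simpa [hi] using (hy i hi).trans (le_abs_self B)
  induction k generalizing c with
  | zero => exact h0 hc
  | succ k ih =>
    refine ⟨h0 hc, fun i => ?_⟩
    by_cases hi : i = o
    · subst hi
      exact isSymbol_zero.congr (Eventually.of_forall fun y => (hc.pd_self y).symm)
    · simpa [hi] using ih (hc.pd i)

/-- The Euler operator `r ∂ᵣ`, where `r = yᵒ`. -/
def euler (o : ι) (f : (ι → ℝ) → ℝ) (y : ι → ℝ) : ℝ := y o * pd o f y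

theorem IsSymbol.euler (hf : IsSymbol o B (k + 1) p f) : IsSymbol o B k p (euler o f) := by
  have := (isSymbol_coord (o := o) (B := B) (k := k)).mul hf.pd_self
  exact this.mono (by omega)

theorem euler_congr (h : f =ᶠ[atEnd o] g) : euler o f =ᶠ[atEnd o] euler o g := by
  filter_upwards [eventually_pd_congr o h] with y hy
  simp only [AHM.euler, hy]

/-- Powers of r are eigenfunctions of r∂ᵣ, so the Euler operator acts on the coefficients of an
expansion by scalars. -/
theorem euler_angular_zpow {c : (ι → ℝ) → ℝ} (hc : IsAngular o c) (p : ℤ) :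
    euler o (fun y => c y * y o ^ (-p)) =ᶠ[atEnd o] fun y => -(p : ℝ) * (c y * y o ^ (-p)) := by
  filter_upwards [eventually_gt_atEnd 0] with y hy
  rw [euler, pd_mul o hc.1.contDiffAt (contDiffAt_coord_zpow hy.ne' _), hc.pd_self,
    pd_coord_zpow hy.ne', if_pos rfl, zpow_sub_one₀ hy.ne']
  push_cast
  field_simp
  ring

end Symbols

/-! ### Ricci curvature from the asymptotics of the Christoffel symbols. -/

section RicciAsymptotics

variable {ι : Type} [Fintype ι] [DecidableEq ι]

theorem sum_eq_add_sum_erase (o : ι) (f : ι → ℝ) :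
    ∑ i, f i = f o + ∑ i ∈ Finset.univ.erase o, f i :=
  (Finset.add_sum_erase _ _ (Finset.mem_univ o)).symm

/-- Splits a product of connection coefficients into its part linear in the perturbation and a
quadratic remainder. -/
theorem sum_delta_mul_delta (A : Finset ι) (a b : ι) (ha : a ∈ A) (hb : b ∈ A) (S P : ι → ι → ℝ) :
    ∑ c ∈ A, ((1 : Matrix ι ι ℝ) b c + S b c) * ((1 : Matrix ι ι ℝ) c a + P c a) =
      (1 : Matrix ι ι ℝ) a b + P b a + S b a + ∑ c ∈ A, S b c * P c a := by
  simp only [add_mul, mul_add, Finset.sum_add_distrib, Matrix.one_apply, mul_ite, ite_mul, mul_one,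
    one_mul, mul_zero, zero_mul, Finset.sum_ite_eq, Finset.sum_ite_eq', ha, hb, if_true]
  simp only [eq_comm (a := b) (b := a)]
  ring

/-- The Christoffel symbols of a metric asymptotic to `dr² / r² + r² ∑ (dyᵃ)²`, where `r = yᵒ`. -/
structure HasConnectionAsymptotics (o : ι) (B : ℝ) (m : ℕ) (g : (ι → ℝ) → Matrix ι ι ℝ)
    (Q : (ι → ℝ) → ℝ) (P S : ι → ι → (ι → ℝ) → ℝ) : Prop where
  ooo : ∀ᶠ y in atEnd o, christoffel g o o o y = (y o)⁻¹ * (-1 + Q y)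
  ooa : ∀ᶠ y in atEnd o, ∀ a, a ≠ o → christoffel g o o a y = 0
  oao : ∀ᶠ y in atEnd o, ∀ a, a ≠ o → christoffel g o a o y = 0
  aoo : ∀ᶠ y in atEnd o, ∀ a, a ≠ o → christoffel g a o o y = 0
  oab : ∀ᶠ y in atEnd o, ∀ a b, a ≠ o → b ≠ o →
    christoffel g o a b y = -(y o ^ 3 * ((1 : Matrix ι ι ℝ) a b + S a b y))
  aob : ∀ᶠ y in atEnd o, ∀ a b, a ≠ o → b ≠ o →
    christoffel g a o b y = (y o)⁻¹ * ((1 : Matrix ι ι ℝ) a b + P a b y)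
  abo : ∀ᶠ y in atEnd o, ∀ a b, a ≠ o → b ≠ o →
    christoffel g a b o y = (y o)⁻¹ * ((1 : Matrix ι ι ℝ) a b + P a b y)
  abc : ∀ a b c, a ≠ o → b ≠ o → c ≠ o → IsSymbol o B 1 m (christoffel g a b c)
  symbolQ : IsSymbol o B 1 m Q
  symbolP : ∀ a b, a ≠ o → b ≠ o → IsSymbol o B 1 m (P a b)
  symbolS : ∀ a b, a ≠ o → b ≠ o → IsSymbol o B 1 m (S a b)

namespace HasConnectionAsymptotics

variable {o : ι} {B : ℝ} {m : ℕ} {g : (ι → ℝ) → Matrix ι ι ℝ}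
  {Q : (ι → ℝ) → ℝ} {P S : ι → ι → (ι → ℝ) → ℝ}

theorem pd_eq_zero (i : ι) {f : (ι → ℝ) → ℝ} (h : ∀ᶠ y in atEnd o, f y = 0) :
    ∀ᶠ y in atEnd o, pd i f y = 0 := by
  filter_upwards [eventually_pd_congr (g := fun _ => 0) i h] with y hy
  rw [hy, pd_const]

theorem pd_inv_mul_one_add (i : ι) {f P : (ι → ℝ) → ℝ} {c : ℝ} (hP : IsSymbol o B 1 m P)
    (h : ∀ᶠ y in atEnd o, f y = (y o)⁻¹ * (c + P y)) :
    ∀ᶠ y in atEnd o, pd i f y =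
      (if i = o then -((y o)⁻¹ * (y o)⁻¹ * (c + P y)) else 0) + (y o)⁻¹ * pd i P y := by
  filter_upwards [eventually_pd_congr (g := fun y => (y o)⁻¹ * (c + P y)) i h, hP.smooth,
    eventually_gt_atEnd 0] with y hy hs h0
  have hr := contDiffAt_coord o y
  have hri : ContDiffAt ℝ ∞ (fun z : ι → ℝ => (z o)⁻¹) y := hr.inv h0.ne'
  rw [hy, pd_mul i hri (contDiffAt_const.add hs), pd_inv i hr h0.ne', pd_coord,
    pd_add i contDiffAt_const hs, pd_const]
  split_ifs <;> simp

theorem pd_neg_pow_mul_one_add {f S : (ι → ℝ) → ℝ} {c : ℝ} (hS : IsSymbol o B 1 m S)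
    (h : ∀ᶠ y in atEnd o, f y = -(y o ^ 3 * (c + S y))) :
    ∀ᶠ y in atEnd o, pd o f y = -(3 * y o ^ 2 * (c + S y) + y o ^ 3 * pd o S y) := by
  filter_upwards [eventually_pd_congr (g := fun y => -(y o ^ 3 * (c + S y))) o h, hS.smooth,
    eventually_gt_atEnd 0] with y hy hs h0
  have hr := contDiffAt_coord o y
  have h3 : pd o (fun z : ι → ℝ => z o ^ 3) y = 3 * y o ^ 2 := by
    have := pd_coord_zpow h0.ne' 3 o
    simpa [zpow_ofNat] using! this
  rw [hy, pd_neg, pd_mul o (hr.pow 3) (contDiffAt_const.add hs), h3,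
    pd_add o contDiffAt_const hs, pd_const]
  simp

/-- The radial Ricci curvature. -/
theorem ricci_oo (H : HasConnectionAsymptotics o B m g Q P S)
    (hm : (Finset.univ.erase o).card = m) (hm2 : 2 ≤ m) :
    IsSymbol o B 0 (m + 2) fun y => y o ^ 2 * ricci g y o o + m +
      ∑ a ∈ Finset.univ.erase o, euler o (P a a) y - m * Q y +
      2 * ∑ a ∈ Finset.univ.erase o, P a a y := by
  have hA : ∀ {a}, a ∈ Finset.univ.erase o → a ≠ o := fun h => (Finset.mem_erase.1 h).1
  have hd : ∀ᶠ y in atEnd o, ∀ a, a ≠ o → pd o (christoffel g a o a) y =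
      -((y o)⁻¹ * (y o)⁻¹ * (1 + P a a y)) + (y o)⁻¹ * pd o (P a a) y := by
    refine eventually_all.2 fun a => ?_
    by_cases ha : a = o
    · exact Eventually.of_forall fun y h => absurd ha h
    · filter_upwards [pd_inv_mul_one_add (c := 1) o (H.symbolP a a ha ha)
        (H.aob.mono fun y hy => by simpa using hy a a ha ha)] with y hy _
      simpa using hy
  have hz : ∀ᶠ y in atEnd o, ∀ a, a ≠ o → pd a (christoffel g a o o) y = 0 := by
    refine eventually_all.2 fun a => ?_
    by_cases ha : a = o
    · exact Eventually.of_forall fun y h => absurd ha h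
    · filter_upwards [pd_eq_zero a (H.aoo.mono fun y hy => hy a ha)] with y hy _ using hy
  -- The quadratic remainder that is discarded: order 2m, and 2m ≥ m + 2.
  have key : IsSymbol o B 0 (m + m) fun y =>
      (∑ a ∈ Finset.univ.erase o, P a a y) * Q y -
      ∑ a ∈ Finset.univ.erase o, ∑ b ∈ Finset.univ.erase o, P a b y * P b a y := by
    refine IsSymbol.sub ?_ ?_
    · exact IsSymbol.mul (IsSymbol.sum fun a ha => (H.symbolP a a (hA ha) (hA ha)).zero)
        H.symbolQ.zero
    · exact IsSymbol.sum fun a ha => IsSymbol.sum fun b hb =>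
        (H.symbolP a b (hA ha) (hA hb)).zero.mul (H.symbolP b a (hA hb) (hA ha)).zero
  refine (key.mono (by omega)).congr ?_
  filter_upwards [hd, hz, H.ooo, H.ooa, H.aoo, H.aob, H.abo, eventually_gt_atEnd 0]
    with y hd hz ooo ooa aoo aob abo h0
  have hr : y o ≠ 0 := h0.ne'
  simp only [ricci, Matrix.of_apply]
  rw [sum_eq_add_sum_erase o]
  rw [sum_eq_add_sum_erase o (fun k => ∑ l, (christoffel g k k l y * christoffel g l o o y -
      christoffel g k o l y * christoffel g l o k y))]
  have s1 : ∑ a ∈ Finset.univ.erase o, (pd a (christoffel g a o o) y - pd o (christoffel g a o a) y)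
      = (y o)⁻¹ ^ 2 * (m + ∑ a ∈ Finset.univ.erase o, P a a y -
        ∑ a ∈ Finset.univ.erase o, euler o (P a a) y) := by
    rw [Finset.sum_congr rfl fun a ha => by rw [hz a (hA ha), hd a (hA ha)]]
    rw [← hm, Finset.cast_card, ← Finset.sum_add_distrib, ← Finset.sum_sub_distrib, Finset.mul_sum]
    refine Finset.sum_congr rfl fun a _ => ?_
    rw [euler]; field_simp; ring
  have s2 : ∑ l, (christoffel g o o l y * christoffel g l o o y -
      christoffel g o o l y * christoffel g l o o y) = 0 := by simp
  have s3 : ∀ a ∈ Finset.univ.erase o, ∑ l, (christoffel g a a l y * christoffel g l o o y -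
      christoffel g a o l y * christoffel g l o a y) =
      (y o)⁻¹ ^ 2 * ((1 + P a a y) * (-1 + Q y) - (1 + P a a y + P a a y +
        ∑ b ∈ Finset.univ.erase o, P a b y * P b a y)) := by
    intro a ha
    have ha' := hA ha
    rw [sum_eq_add_sum_erase o, abo a a ha' ha', ooo, aoo a ha', ooa a ha']
    have := sum_delta_mul_delta (Finset.univ.erase o) a a ha ha (fun a b => P a b y)
      (fun a b => P a b y)
    simp only [Matrix.one_apply_eq] at this
    rw [← this, Finset.sum_congr rfl fun b hb => by
      rw [aoo b (hA hb), aob a b ha' (hA hb), aob b a (hA hb) ha'], mul_sub, Finset.mul_sum,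
      Finset.sum_congr rfl fun b hb => show _ = -((y o)⁻¹ ^ 2 * (((1 : Matrix ι ι ℝ) a b + P a b y) *
        ((1 : Matrix ι ι ℝ) b a + P b a y))) by ring, Finset.sum_neg_distrib]
    simp only [Matrix.one_apply_eq]
    ring
  rw [s1, s2, Finset.sum_congr rfl s3, ← Finset.mul_sum]
  have s4 : ∑ a ∈ Finset.univ.erase o, ((1 + P a a y) * (-1 + Q y) - (1 + P a a y + P a a y +
        ∑ b ∈ Finset.univ.erase o, P a b y * P b a y)) =
      (m + ∑ a ∈ Finset.univ.erase o, P a a y) * (-1 + Q y) - (m +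
      2 * ∑ a ∈ Finset.univ.erase o, P a a y +
      ∑ a ∈ Finset.univ.erase o, ∑ b ∈ Finset.univ.erase o, P a b y * P b a y) := by
    rw [Finset.sum_sub_distrib, ← Finset.sum_mul]
    simp only [Finset.sum_add_distrib]
    rw [← Finset.cast_card, hm]
    ring
  rw [s4]
  field_simp
  ring

theorem ricci_ab (H : HasConnectionAsymptotics o B m g Q P S)
    (hm : (Finset.univ.erase o).card = m) (hm2 : 2 ≤ m) {a b : ι} (ha : a ≠ o) (hb : b ≠ o) :
    IsSymbol o B 0 (m + 2) fun y => (y o ^ 2)⁻¹ * ricci g y a b + m * (1 : Matrix ι ι ℝ) a b +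
      (m + 1) * S a b y - S b a y + euler o (S a b) y +
      (Q y + ∑ c ∈ Finset.univ.erase o, P c c y) * (1 : Matrix ι ι ℝ) a b - P a b y - P b a y := by
  have hA : ∀ {a}, a ∈ Finset.univ.erase o → a ≠ o := fun h => (Finset.mem_erase.1 h).1
  have haA : a ∈ Finset.univ.erase o := Finset.mem_erase.2 ⟨ha, Finset.mem_univ _⟩
  have hbA : b ∈ Finset.univ.erase o := Finset.mem_erase.2 ⟨hb, Finset.mem_univ _⟩
  -- The purely tangential terms: the symbols and their angular derivatives have order m, and the
  -- factor r⁻² supplies the two missing orders.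
  have key : IsSymbol o B 0 (m + 2) fun y => (y o ^ 2)⁻¹ *
      (∑ c ∈ Finset.univ.erase o, (pd c (christoffel g c a b) y - pd b (christoffel g c a c) y) +
      ∑ c ∈ Finset.univ.erase o, ∑ d ∈ Finset.univ.erase o,
        (christoffel g c c d y * christoffel g d a b y -
          christoffel g c b d y * christoffel g d a c y)) := by
    have h2 : IsSymbol o B 0 ((2 : ℕ) + m) _ := (isSymbol_inv_pow 2).mul (IsSymbol.add
      (IsSymbol.sum fun c hc => ((H.abc c a b (hA hc) ha hb).pd_ne (hA hc)).sub
        ((H.abc c a c (hA hc) ha (hA hc)).pd_ne hb))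
      (IsSymbol.sum fun c hc => IsSymbol.sum fun d hd => IsSymbol.sub
        (((H.abc c c d (hA hc) (hA hc) (hA hd)).zero.mul
          (H.abc d a b (hA hd) ha hb).zero).mono (by omega))
        (((H.abc c b d (hA hc) hb (hA hd)).zero.mul
          (H.abc d a c (hA hd) ha (hA hc)).zero).mono (by omega))))
    exact h2.mono (by push_cast; omega)
  -- The quadratic terms in Q, P and S.
  have key2 : IsSymbol o B 0 (m + m) fun y =>
      -((Q y + ∑ c ∈ Finset.univ.erase o, P c c y) * S a b y) +
      ∑ c ∈ Finset.univ.erase o, S b c y * P c a y +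
      ∑ c ∈ Finset.univ.erase o, S a c y * P c b y := by
    refine IsSymbol.add (IsSymbol.add (IsSymbol.neg (IsSymbol.mul ?_ (H.symbolS a b ha hb).zero))
      (IsSymbol.sum fun c hc => (H.symbolS b c hb (hA hc)).zero.mul (H.symbolP c a (hA hc) ha).zero))
      (IsSymbol.sum fun c hc => (H.symbolS a c ha (hA hc)).zero.mul (H.symbolP c b (hA hc) hb).zero)
    exact H.symbolQ.zero.add (IsSymbol.sum fun c hc => (H.symbolP c c (hA hc) (hA hc)).zero)
  refine (key.add (key2.mono (by omega))).congr ?_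
  filter_upwards [pd_neg_pow_mul_one_add (H.symbolS a b ha hb)
    (H.oab.mono fun y hy => hy a b ha hb), pd_eq_zero b (H.oao.mono fun y hy => hy a ha),
    H.ooo, H.ooa, H.oao, H.oab, H.abo, eventually_gt_atEnd 0]
    with y hd hz ooo ooa oao oab abo h0
  have hr : y o ≠ 0 := h0.ne'
  simp only [ricci, Matrix.of_apply]
  rw [sum_eq_add_sum_erase o (fun k => pd k (christoffel g k a b) y - pd b (christoffel g k a k) y)]
  rw [sum_eq_add_sum_erase o (fun k => ∑ l, (christoffel g k k l y * christoffel g l a b y -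
      christoffel g k b l y * christoffel g l a k y))]
  have s1 : ∑ l, (christoffel g o o l y * christoffel g l a b y -
      christoffel g o b l y * christoffel g l a o y) = y o ^ 2 * ((1 - Q y) *
      ((1 : Matrix ι ι ℝ) a b + S a b y) + ((1 : Matrix ι ι ℝ) a b + P b a y + S b a y +
        ∑ c ∈ Finset.univ.erase o, S b c y * P c a y)) := by
    rw [sum_eq_add_sum_erase o, ooo, oab a b ha hb, oao b hb, oao a ha]
    rw [← sum_delta_mul_delta _ a b haA hbA (fun a b => S a b y) (fun a b => P a b y),
      Finset.sum_congr rfl fun d hd => by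
        rw [ooa d (hA hd), oab b d hb (hA hd), abo d a (hA hd) ha], mul_add (y o ^ 2),
      Finset.mul_sum]
    congr 1
    · field_simp; ring
    · exact Finset.sum_congr rfl fun c _ => by field_simp; ring
  have s2 : ∀ c ∈ Finset.univ.erase o, ∑ l, (christoffel g c c l y * christoffel g l a b y -
      christoffel g c b l y * christoffel g l a c y) =
      y o ^ 2 * (-(1 + P c c y) * ((1 : Matrix ι ι ℝ) a b + S a b y) +
        ((1 : Matrix ι ι ℝ) a c + S a c y) * ((1 : Matrix ι ι ℝ) c b + P c b y)) +
      ∑ d ∈ Finset.univ.erase o, (christoffel g c c d y * christoffel g d a b y -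
          christoffel g c b d y * christoffel g d a c y) := by
    intro c hc
    have hc' := hA hc
    rw [sum_eq_add_sum_erase o, abo c c hc' hc', oab a b ha hb, abo c b hc' hb, oab a c ha hc']
    simp only [Matrix.one_apply_eq]
    congr 1
    field_simp; ring
  rw [s1, Finset.sum_congr rfl s2, Finset.sum_add_distrib, ← Finset.mul_sum,
    Finset.sum_add_distrib, ← Finset.sum_mul, Finset.sum_neg_distrib,
    sum_delta_mul_delta _ b a hbA haA (fun a b => S a b y) (fun a b => P a b y), hd, hz,
    Finset.sum_add_distrib]
  have hcard : ∑ c ∈ Finset.univ.erase o, (1 : ℝ) = m := by rw [← hm, Finset.cast_card]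
  rw [hcard, euler]
  have hsym : (1 : Matrix ι ι ℝ) b a = (1 : Matrix ι ι ℝ) a b := by
    simp [Matrix.one_apply, eq_comm]
  rw [hsym]
  field_simp
  ring

/-- Each term is r⁻¹ times an angular derivative of P or Q, or times a tangential symbol, all of
order m. Gaining a single order is enough, since mixed components do not enter the trace against the
identity. -/
theorem ricci_oa (H : HasConnectionAsymptotics o B m g Q P S) (hm2 : 2 ≤ m)
    {a : ι} (ha : a ≠ o) :
    IsSymbol o B 0 (m + 1) fun y => ricci g y o a := by
  have hA : ∀ {a}, a ∈ Finset.univ.erase o → a ≠ o := fun h => (Finset.mem_erase.1 h).1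
  have hP0 : ∀ c d, c ≠ o → d ≠ o → IsSymbol o B 0 1 fun y =>
      (y o)⁻¹ * ((1 : Matrix ι ι ℝ) c d + P c d y) := fun c d hc hd => by
    have := (isSymbol_inv_pow (o := o) (B := B) (k := 0) 1).mul ((isSymbol_const
      ((1 : Matrix ι ι ℝ) c d)).add ((H.symbolP c d hc hd).zero.mono (q := 0) (by omega)))
    simpa using this
  have key : IsSymbol o B 0 (1 + m) fun y =>
      ∑ c ∈ Finset.univ.erase o, ((y o)⁻¹ * pd c (P c a) y - (y o)⁻¹ * pd a (P c c) y) +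
      ∑ c ∈ Finset.univ.erase o, ∑ d ∈ Finset.univ.erase o,
        (christoffel g c c d y * ((y o)⁻¹ * ((1 : Matrix ι ι ℝ) d a + P d a y)) -
          christoffel g c a d y * ((y o)⁻¹ * ((1 : Matrix ι ι ℝ) d c + P d c y))) -
      (y o)⁻¹ * pd a Q y := by
    have hr : IsSymbol o B 0 1 fun y => (y o)⁻¹ := by simpa using isSymbol_inv_pow (o := o) 1
    refine IsSymbol.sub (IsSymbol.add ?_ ?_) (hr.mul (H.symbolQ.pd_ne ha))
    · exact IsSymbol.sum fun c hc => (hr.mul ((H.symbolP c a (hA hc) ha).pd_ne (hA hc))).sub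
        (hr.mul ((H.symbolP c c (hA hc) (hA hc)).pd_ne ha))
    · refine IsSymbol.sum fun c hc => IsSymbol.sum fun d hd => IsSymbol.sub ?_ ?_
      · exact ((H.abc c c d (hA hc) (hA hc) (hA hd)).zero.mul (hP0 d a (hA hd) ha)).mono (by omega)
      · exact ((H.abc c a d (hA hc) ha (hA hd)).zero.mul (hP0 d c (hA hd) (hA hc))).mono (by omega)
  refine (key.mono (by omega)).congr ?_
  have hd1 : ∀ᶠ y in atEnd o, ∀ c, c ≠ o → pd c (christoffel g c o a) y =
      (y o)⁻¹ * pd c (P c a) y := by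
    refine eventually_all.2 fun c => ?_
    by_cases hc : c = o
    · exact Eventually.of_forall fun y h => absurd hc h
    · filter_upwards [pd_inv_mul_one_add c (H.symbolP c a hc ha)
        (H.aob.mono fun y hy => hy c a hc ha)] with y hy _
      simpa [hc] using hy
  have hd2 : ∀ᶠ y in atEnd o, ∀ c, c ≠ o → pd a (christoffel g c o c) y =
      (y o)⁻¹ * pd a (P c c) y := by
    refine eventually_all.2 fun c => ?_
    by_cases hc : c = o
    · exact Eventually.of_forall fun y h => absurd hc h
    · filter_upwards [pd_inv_mul_one_add a (H.symbolP c c hc hc)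
        (H.aob.mono fun y hy => hy c c hc hc)] with y hy _
      simpa [ha] using hy
  filter_upwards [hd1, hd2, pd_eq_zero o (H.ooa.mono fun y hy => hy a ha),
    pd_inv_mul_one_add a H.symbolQ H.ooo, H.ooa, H.oao, H.aoo, H.aob] with y hd1 hd2 hz hq ooa oao aoo aob
  simp only [ricci, Matrix.of_apply]
  rw [sum_eq_add_sum_erase o (fun k => pd k (christoffel g k o a) y - pd a (christoffel g k o k) y)]
  rw [sum_eq_add_sum_erase o (fun k => ∑ l, (christoffel g k k l y * christoffel g l o a y -
      christoffel g k a l y * christoffel g l o k y))]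
  have s1 : ∑ l, (christoffel g o o l y * christoffel g l o a y -
      christoffel g o a l y * christoffel g l o o y) = 0 := by
    rw [sum_eq_add_sum_erase o, Finset.sum_congr rfl fun d hd => by rw [ooa d (hA hd), aoo d (hA hd)]]
    simp [ooa a ha, oao a ha]
  have s2 : ∀ c ∈ Finset.univ.erase o, ∑ l, (christoffel g c c l y * christoffel g l o a y -
      christoffel g c a l y * christoffel g l o c y) = ∑ d ∈ Finset.univ.erase o,
        (christoffel g c c d y * ((y o)⁻¹ * ((1 : Matrix ι ι ℝ) d a + P d a y)) -
          christoffel g c a d y * ((y o)⁻¹ * ((1 : Matrix ι ι ℝ) d c + P d c y))) := by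
    intro c hc
    rw [sum_eq_add_sum_erase o, ooa a ha, ooa c (hA hc)]
    simp only [mul_zero, sub_zero, zero_add]
    exact Finset.sum_congr rfl fun d hd => by
      rw [aob d a (hA hd) ha, aob d c (hA hd) (hA hc)]
  have s3 : ∑ c ∈ Finset.univ.erase o, (pd c (christoffel g c o a) y -
      pd a (christoffel g c o c) y) = ∑ c ∈ Finset.univ.erase o,
        ((y o)⁻¹ * pd c (P c a) y - (y o)⁻¹ * pd a (P c c) y) :=
    Finset.sum_congr rfl fun c hc => by rw [hd1 c (hA hc), hd2 c (hA hc)]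
  rw [s1, Finset.sum_congr rfl s2, hz, hq, s3, if_neg ha]
  ring

/-- The coordinate formula is not visibly symmetric, so this component is estimated on its own. Here
part of the gain comes from the radial derivative of Γᶜₐᶜ. -/
theorem ricci_ao (H : HasConnectionAsymptotics o B m g Q P S) (hm2 : 2 ≤ m)
    {a : ι} (ha : a ≠ o) :
    IsSymbol o B 0 (m + 1) fun y => ricci g y a o := by
  have hA : ∀ {a}, a ∈ Finset.univ.erase o → a ≠ o := fun h => (Finset.mem_erase.1 h).1
  have hP0 : ∀ c d, c ≠ o → d ≠ o → IsSymbol o B 0 1 fun y =>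
      (y o)⁻¹ * ((1 : Matrix ι ι ℝ) c d + P c d y) := fun c d hc hd => by
    have := (isSymbol_inv_pow (o := o) (B := B) (k := 0) 1).mul ((isSymbol_const
      ((1 : Matrix ι ι ℝ) c d)).add ((H.symbolP c d hc hd).zero.mono (q := 0) (by omega)))
    simpa using this
  have key : IsSymbol o B 0 (1 + m) fun y =>
      ∑ c ∈ Finset.univ.erase o, ((y o)⁻¹ * pd c (P c a) y - pd o (christoffel g c a c) y) +
      ∑ c ∈ Finset.univ.erase o, ∑ d ∈ Finset.univ.erase o,
        (christoffel g c c d y * ((y o)⁻¹ * ((1 : Matrix ι ι ℝ) d a + P d a y)) -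
          ((y o)⁻¹ * ((1 : Matrix ι ι ℝ) c d + P c d y)) * christoffel g d a c y) := by
    have hr : IsSymbol o B 0 1 fun y => (y o)⁻¹ := by simpa using isSymbol_inv_pow (o := o) 1
    refine IsSymbol.add ?_ ?_
    · exact IsSymbol.sum fun c hc => (hr.mul ((H.symbolP c a (hA hc) ha).pd_ne (hA hc))).sub
        ((H.abc c a c (hA hc) ha (hA hc)).pd_self.mono (by omega))
    · refine IsSymbol.sum fun c hc => IsSymbol.sum fun d hd => IsSymbol.sub ?_ ?_
      · exact ((H.abc c c d (hA hc) (hA hc) (hA hd)).zero.mul (hP0 d a (hA hd) ha)).mono (by omega)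
      · exact (hP0 c d (hA hc) (hA hd)).mul (H.abc d a c (hA hd) ha (hA hc)).zero
  refine (key.mono (by omega)).congr ?_
  have hd1 : ∀ᶠ y in atEnd o, ∀ c, c ≠ o → pd c (christoffel g c a o) y =
      (y o)⁻¹ * pd c (P c a) y := by
    refine eventually_all.2 fun c => ?_
    by_cases hc : c = o
    · exact Eventually.of_forall fun y h => absurd hc h
    · filter_upwards [pd_inv_mul_one_add c (H.symbolP c a hc ha)
        (H.abo.mono fun y hy => hy c a hc ha)] with y hy _
      simpa [hc] using hy
  filter_upwards [hd1, pd_eq_zero o (H.oao.mono fun y hy => hy a ha),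
    H.ooa, H.oao, H.aoo, H.aob, H.abo] with y hd1 hz ooa oao aoo aob abo
  simp only [ricci, Matrix.of_apply]
  rw [sum_eq_add_sum_erase o (fun k => pd k (christoffel g k a o) y - pd o (christoffel g k a k) y)]
  rw [sum_eq_add_sum_erase o (fun k => ∑ l, (christoffel g k k l y * christoffel g l a o y -
      christoffel g k o l y * christoffel g l a k y))]
  have s1 : ∑ l, (christoffel g o o l y * christoffel g l a o y -
      christoffel g o o l y * christoffel g l a o y) = 0 := by simp
  have s2 : ∀ c ∈ Finset.univ.erase o, ∑ l, (christoffel g c c l y * christoffel g l a o y -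
      christoffel g c o l y * christoffel g l a c y) = ∑ d ∈ Finset.univ.erase o,
        (christoffel g c c d y * ((y o)⁻¹ * ((1 : Matrix ι ι ℝ) d a + P d a y)) -
          ((y o)⁻¹ * ((1 : Matrix ι ι ℝ) c d + P c d y)) * christoffel g d a c y) := by
    intro c hc
    rw [sum_eq_add_sum_erase o, oao a ha, aoo c (hA hc)]
    simp only [mul_zero, zero_mul, sub_zero, zero_add]
    exact Finset.sum_congr rfl fun d hd => by
      rw [abo d a (hA hd) ha, aob c d (hA hc) (hA hd)]
  have s3 : ∑ c ∈ Finset.univ.erase o, (pd c (christoffel g c a o) y -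
      pd o (christoffel g c a c) y) = ∑ c ∈ Finset.univ.erase o,
        ((y o)⁻¹ * pd c (P c a) y - pd o (christoffel g c a c) y) :=
    Finset.sum_congr rfl fun c hc => by rw [hd1 c (hA hc)]
  rw [s1, Finset.sum_congr rfl s2, hz, s3]
  ring

end HasConnectionAsymptotics

end RicciAsymptotics

/-! ### Connection coefficients of an asymptotically hyperbolic metric. -/

section MetricAsymptotics

variable {ι : Type} [Fintype ι] [DecidableEq ι]

theorem IsSymbol.det {o : ι} {B : ℝ} {k : ℕ} {A : (ι → ℝ) → Matrix ι ι ℝ}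
    (hA : ∀ i j, IsSymbol o B k 0 fun y => A y i j) : IsSymbol o B k 0 fun y => (A y).det := by
  simp only [Matrix.det_apply']
  exact IsSymbol.sum fun σ _ => (IsSymbol.prod fun i _ => hA _ _).const_mul _

theorem IsSymbol.tendsto_zero {o : ι} {B : ℝ} {k : ℕ} {p : ℤ} {f : (ι → ℝ) → ℝ}
    (hf : IsSymbol o B k p f) (hp : 0 < p) : Tendsto f (endBox o B) (𝓝 0) := by
  refine hf.isBigO.trans_tendsto ?_
  have h1 : Tendsto (fun y : ι → ℝ => y o) (endBox o B) atTop := tendsto_atEnd.mono_left endBox_le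
  exact (tendsto_zpow_atTop_zero (by omega)).comp h1

theorem tendsto_det_one {α : Type} {l : Filter α} {A : α → Matrix ι ι ℝ}
    (hA : ∀ i j, Tendsto (fun y => A y i j) l (𝓝 ((1 : Matrix ι ι ℝ) i j))) :
    Tendsto (fun y => (A y).det) l (𝓝 1) := by
  have h1 : Tendsto A l (𝓝 1) := tendsto_pi_nhds.2 fun i => tendsto_pi_nhds.2 fun j => hA i j
  have h2 : Continuous fun M : Matrix ι ι ℝ => M.det := continuous_id.matrix_det
  have h3 := (h2.tendsto 1).comp h1
  rw [Matrix.det_one] at h3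
  exact h3

/-- Cramer's rule again. As p > 0, the matrix tends to the identity on the box, so the reciprocal of
its determinant is bounded there. -/
theorem IsSymbol.matrix_inv {o : ι} {B : ℝ} {k : ℕ} {p : ℤ} (hp : 0 < p)
    {A : (ι → ℝ) → Matrix ι ι ℝ}
    (hA : ∀ i j, IsSymbol o B k p fun y => A y i j - (1 : Matrix ι ι ℝ) i j)
    (h0 : ∀ᶠ y in atEnd o, (A y).det ≠ 0) (i j : ι) :
    IsSymbol o B k 0 fun y => (A y)⁻¹ i j := by
  have hA0 : ∀ i j, IsSymbol o B k 0 fun y => A y i j := fun i j => by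
    simpa using ((hA i j).mono hp.le).add (isSymbol_const ((1 : Matrix ι ι ℝ) i j))
  have hlim : ∀ i j, Tendsto (fun y => A y i j) (endBox o B) (𝓝 ((1 : Matrix ι ι ℝ) i j)) :=
    fun i j => by simpa using ((hA i j).tendsto_zero hp).add_const ((1 : Matrix ι ι ℝ) i j)
  have hdet := IsSymbol.det hA0
  have hinv : IsSymbol o B k 0 fun y => (A y).det⁻¹ :=
    hdet.inv h0 (((tendsto_det_one hlim).inv₀ one_ne_zero).isBigO_one ℝ)
  have : ∀ z, (A z)⁻¹ i j = (A z).det⁻¹ * ((A z).updateRow j (Pi.single i 1)).det := by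
    intro z
    rw [Matrix.inv_def, Matrix.smul_apply, Matrix.adjugate_apply, Ring.inverse_eq_inv', smul_eq_mul]
  simp only [this]
  simpa using hinv.mul (IsSymbol.det fun k l => by
    by_cases h : k = j
    · subst h; simp only [Matrix.updateRow_self]; exact isSymbol_const _
    · simp only [Matrix.updateRow_ne h]; exact hA0 k l)

/-- The length of the coordinate covectors in the model metric `dr² / r² + r² ∑ (dyᵃ)²`. -/
def frameWeight (o i : ι) (r : ℝ) : ℝ := if i = o then r else r⁻¹

/-- The components of `g` in a frame which is orthonormal for `dr² / r² + r² ∑ (dyᵃ)²`. -/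
def frameMatrix (o : ι) (T : (ι → ℝ) → Matrix ι ι ℝ) (y : ι → ℝ) : Matrix ι ι ℝ :=
  Matrix.of fun i j => frameWeight o i (y o) * frameWeight o j (y o) * T y i j

/-- A metric `N(r)² dr² + h(r)` asymptotic to `dr² / r² + r² ∑ (dyᵃ)²` up to terms of order
`r⁻ᵐ`, where `r = yᵒ`. -/
structure IsAsymptoticallyHyperbolic (o : ι) (B : ℝ) (m : ℕ) (g : (ι → ℝ) → Matrix ι ι ℝ) :
    Prop where
  symm : ∀ᶠ y in atEnd o, (g y).IsSymm
  det_ne : ∀ᶠ y in atEnd o, (g y).det ≠ 0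
  cross : ∀ᶠ y in atEnd o, ∀ a, a ≠ o → g y o a = 0
  lapse : ∀ᶠ y in atEnd o, ∀ a, a ≠ o → pd a (fun z => g z o o) y = 0
  symbol : ∀ i j, IsSymbol o B 2 m fun y => frameMatrix o g y i j - (1 : Matrix ι ι ℝ) i j

theorem frameWeight_ne {o i : ι} {r : ℝ} (hr : r ≠ 0) : frameWeight o i r ≠ 0 := by
  unfold frameWeight; split_ifs <;> simp [hr]

theorem frameMatrix_eq (o : ι) (T : (ι → ℝ) → Matrix ι ι ℝ) (y : ι → ℝ) :
    frameMatrix o T y = Matrix.diagonal (fun i => frameWeight o i (y o)) * T y *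
      Matrix.diagonal (fun i => frameWeight o i (y o)) := by
  ext i j
  simp only [frameMatrix, Matrix.of_apply, Matrix.mul_diagonal, Matrix.diagonal_mul]
  ring

theorem frameMatrix_inv {o : ι} {T : (ι → ℝ) → Matrix ι ι ℝ} {y : ι → ℝ} (hr : y o ≠ 0)
    (i j : ι) : (T y)⁻¹ i j =
      frameWeight o i (y o) * frameWeight o j (y o) * (frameMatrix o T y)⁻¹ i j := by
  have hW : IsUnit (Matrix.diagonal fun i => frameWeight o i (y o)) := by
    rw [Matrix.isUnit_iff_isUnit_det, Matrix.det_diagonal, isUnit_iff_ne_zero]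
    exact Finset.prod_ne_zero_iff.2 fun i _ => frameWeight_ne hr
  have hWd := (Matrix.isUnit_iff_isUnit_det _).1 hW
  have : (T y)⁻¹ = Matrix.diagonal (fun i => frameWeight o i (y o)) * (frameMatrix o T y)⁻¹ *
      Matrix.diagonal (fun i => frameWeight o i (y o)) := by
    rw [frameMatrix_eq, Matrix.mul_inv_rev, Matrix.mul_inv_rev, ← Matrix.mul_assoc,
      Matrix.mul_nonsing_inv _ hWd, Matrix.one_mul, Matrix.mul_assoc, Matrix.nonsing_inv_mul _ hWd,
      Matrix.mul_one]
  rw [this, Matrix.mul_diagonal, Matrix.diagonal_mul]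
  ring

namespace IsAsymptoticallyHyperbolic

variable {o : ι} {B : ℝ} {m : ℕ} {g : (ι → ℝ) → Matrix ι ι ℝ}

/-- The deviation of `g` from the hyperbolic metric, in an orthonormal frame. -/
def deviation (o : ι) (g : (ι → ℝ) → Matrix ι ι ℝ) (i j : ι) (y : ι → ℝ) : ℝ :=
  frameMatrix o g y i j - (1 : Matrix ι ι ℝ) i j

theorem frame_det_ne (H : IsAsymptoticallyHyperbolic o B m g) :
    ∀ᶠ y in atEnd o, (frameMatrix o g y).det ≠ 0 := by
  filter_upwards [H.det_ne, eventually_gt_atEnd 0] with y hy h0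
  rw [frameMatrix_eq, Matrix.det_mul, Matrix.det_mul, Matrix.det_diagonal]
  have : ∏ i, frameWeight o i (y o) ≠ 0 :=
    Finset.prod_ne_zero_iff.2 fun i _ => frameWeight_ne h0.ne'
  exact mul_ne_zero (mul_ne_zero this hy) this

theorem symbol_inv (H : IsAsymptoticallyHyperbolic o B m g) (hm : 0 < m) (i j : ι) :
    IsSymbol o B 2 0 fun y => (frameMatrix o g y)⁻¹ i j :=
  IsSymbol.matrix_inv (p := m) (by exact_mod_cast hm) H.symbol H.frame_det_ne i j

/-- With A = 1 + D this is A⁻¹ (A - 1) = 1 - A⁻¹. Used once it gives A⁻¹ = 1 + O(r⁻ᵐ); substituted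
into itself it gives A⁻¹ = 1 - D + O(r⁻²ᵐ). -/
theorem inv_sub_one (H : IsAsymptoticallyHyperbolic o B m g) : ∀ᶠ y in atEnd o, ∀ i j,
    (frameMatrix o g y)⁻¹ i j - (1 : Matrix ι ι ℝ) i j =
      -∑ k, (frameMatrix o g y)⁻¹ i k * deviation o g k j y := by
  filter_upwards [H.frame_det_ne] with y hy i j
  have h1 := Matrix.nonsing_inv_mul _ (isUnit_iff_ne_zero.2 hy)
  have h2 : (frameMatrix o g y)⁻¹ * (frameMatrix o g y - 1) = 1 - (frameMatrix o g y)⁻¹ := by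
    rw [mul_sub, h1, mul_one]
  have h3 := congrFun (congrFun h2 i) j
  simp only [Matrix.mul_apply, Matrix.sub_apply] at h3
  simp only [deviation]
  rw [h3]; ring

theorem symbol_inv_sub (H : IsAsymptoticallyHyperbolic o B m g) (hm : 0 < m) (i j : ι) :
    IsSymbol o B 2 m fun y => (frameMatrix o g y)⁻¹ i j - (1 : Matrix ι ι ℝ) i j := by
  have : IsSymbol o B 2 (0 + m) _ :=
    (IsSymbol.sum (s := Finset.univ) fun k _ => (H.symbol_inv hm i k).mul (H.symbol k j)).neg
  refine (this.mono (by omega)).congr ?_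
  filter_upwards [H.inv_sub_one] with y hy
  rw [hy i j]; rfl

theorem symbol_inv_sub_add (H : IsAsymptoticallyHyperbolic o B m g) (hm : 0 < m) (i j : ι) :
    IsSymbol o B 2 (m + m) fun y => (frameMatrix o g y)⁻¹ i j - (1 : Matrix ι ι ℝ) i j +
      deviation o g i j y := by
  have : IsSymbol o B 2 (m + m) _ :=
    (IsSymbol.sum (s := Finset.univ) fun k _ => (H.symbol_inv_sub hm i k).mul (H.symbol k j)).neg
  refine this.congr ?_
  filter_upwards [H.inv_sub_one] with y hy
  rw [hy i j]
  have h2 : ∑ k, (1 : Matrix ι ι ℝ) i k * deviation o g k j y = deviation o g i j y := by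
    simp [Matrix.one_apply]
  simp only [sub_mul, Finset.sum_sub_distrib]
  change -(∑ k, (frameMatrix o g y)⁻¹ i k * deviation o g k j y -
    ∑ k, (1 : Matrix ι ι ℝ) i k * deviation o g k j y) = _
  rw [h2]; ring

theorem inv_cross (H : IsAsymptoticallyHyperbolic o B m g) : ∀ᶠ y in atEnd o,
    g y o o * (g y)⁻¹ o o = 1 ∧ ∀ a, a ≠ o → (g y)⁻¹ o a = 0 ∧ (g y)⁻¹ a o = 0 := by
  filter_upwards [H.det_ne, H.cross, H.symm] with y hdet hc hs
  have hA : ∀ {a}, a ∈ Finset.univ.erase o → a ≠ o := fun h => (Finset.mem_erase.1 h).1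
  have h1 := Matrix.mul_nonsing_inv _ (isUnit_iff_ne_zero.2 hdet)
  have h2 := Matrix.nonsing_inv_mul _ (isUnit_iff_ne_zero.2 hdet)
  have e1 : ∀ j, g y o o * (g y)⁻¹ o j = (1 : Matrix ι ι ℝ) o j := by
    intro j
    rw [← h1, Matrix.mul_apply, sum_eq_add_sum_erase o, Finset.sum_eq_zero, add_zero]
    intro a ha
    rw [hc a (hA ha), zero_mul]
  have e2 : ∀ i, (g y)⁻¹ i o * g y o o = (1 : Matrix ι ι ℝ) i o := by
    intro i
    rw [← h2, Matrix.mul_apply, sum_eq_add_sum_erase o, Finset.sum_eq_zero, add_zero]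
    intro a ha
    rw [hs.apply, hc a (hA ha), mul_zero]
  have hoo : g y o o * (g y)⁻¹ o o = 1 := by simpa using e1 o
  have hne : g y o o ≠ 0 := left_ne_zero_of_mul_eq_one hoo
  refine ⟨hoo, fun a ha => ⟨?_, ?_⟩⟩
  · have := e1 a
    rw [Matrix.one_apply_ne (Ne.symm ha)] at this
    exact (mul_eq_zero.1 this).resolve_left hne
  · have := e2 a
    rw [Matrix.one_apply_ne ha] at this
    exact (mul_eq_zero.1 this).resolve_right hne

theorem smooth_deviation (H : IsAsymptoticallyHyperbolic o B m g) : ∀ᶠ y in atEnd o, ∀ i j,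
    ContDiffAt ℝ ∞ (deviation o g i j) y :=
  eventually_all.2 fun i => eventually_all.2 fun j => (H.symbol i j).smooth

theorem metric_oo : ∀ᶠ y in atEnd o, g y o o = (y o ^ 2)⁻¹ * (1 + deviation o g o o y) := by
  filter_upwards [eventually_gt_atEnd 0] with y h0
  have := h0.ne'
  simp [deviation, frameMatrix, frameWeight]
  field_simp

theorem metric_ab {a b : ι} (ha : a ≠ o) (hb : b ≠ o) : ∀ᶠ y in atEnd o,
    g y a b = y o ^ 2 * ((1 : Matrix ι ι ℝ) a b + deviation o g a b y) := by
  filter_upwards [eventually_gt_atEnd 0] with y h0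
  have := h0.ne'
  simp [deviation, frameMatrix, frameWeight, ha, hb]
  field_simp

theorem pd_metric_oo (H : IsAsymptoticallyHyperbolic o B m g) : ∀ᶠ y in atEnd o,
    pd o (fun z => g z o o) y = (y o ^ 2)⁻¹ * (y o)⁻¹ *
      (-2 * (1 + deviation o g o o y) + euler o (deviation o g o o) y) := by
  filter_upwards [eventually_pd_congr o (metric_oo (o := o) (g := g)), H.smooth_deviation,
    eventually_gt_atEnd 0] with y hy hs h0
  have hr := h0.ne'
  have h2 : ContDiffAt ℝ ∞ (fun z : ι → ℝ => (z o ^ 2)⁻¹) y :=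
    ((contDiffAt_coord o y).pow 2).inv (pow_ne_zero 2 hr)
  have h3 : pd o (fun z : ι → ℝ => (z o ^ 2)⁻¹) y = -2 * ((y o ^ 2)⁻¹ * (y o)⁻¹) := by
    have := pd_coord_zpow hr (-2) o
    have e : (fun z : ι → ℝ => z o ^ (-2 : ℤ)) = fun z => (z o ^ 2)⁻¹ := by
      funext z; rw [zpow_neg]; rfl
    rw [e] at this
    rw [this, if_pos rfl, zpow_sub_one₀ hr, zpow_neg]
    push_cast; rfl
  have h4 : ContDiffAt ℝ ∞ (fun z => 1 + deviation o g o o z) y := contDiffAt_const.add (hs o o)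
  rw [hy, pd_mul o h2 h4, h3, pd_add o contDiffAt_const (hs o o), pd_const, euler]
  field_simp
  ring

theorem pd_metric_ab (H : IsAsymptoticallyHyperbolic o B m g) : ∀ᶠ y in atEnd o,
    ∀ i a b, a ≠ o → b ≠ o → pd i (fun z => g z a b) y =
      if i = o then y o * (2 * ((1 : Matrix ι ι ℝ) a b + deviation o g a b y) +
        euler o (deviation o g a b) y) else y o ^ 2 * pd i (deviation o g a b) y := by
  refine eventually_all.2 fun i => eventually_all.2 fun a => eventually_all.2 fun b => ?_
  by_cases ha : a = o
  · exact Eventually.of_forall fun y h => absurd ha h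
  by_cases hb : b = o
  · exact Eventually.of_forall fun y _ h => absurd hb h
  filter_upwards [eventually_pd_congr i (metric_ab (g := g) ha hb), H.smooth_deviation,
    eventually_gt_atEnd 0] with y hy hs h0 _ _
  have hr := h0.ne'
  have h2 : ContDiffAt ℝ ∞ (fun z : ι → ℝ => z o ^ 2) y := (contDiffAt_coord o y).pow 2
  have h3 : pd i (fun z : ι → ℝ => z o ^ 2) y = if i = o then 2 * y o else 0 := by
    have := pd_coord_zpow hr 2 i
    rw [show (2 : ℤ) - 1 = 1 by norm_num, zpow_one] at this
    exact_mod_cast this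
  have h4 : ContDiffAt ℝ ∞ (fun z => (1 : Matrix ι ι ℝ) a b + deviation o g a b z) y :=
    contDiffAt_const.add (hs a b)
  rw [hy, pd_mul i h2 h4, h3, pd_add i contDiffAt_const (hs a b), pd_const]
  split_ifs with h
  · subst h; rw [euler]; ring
  · ring

theorem pd_metric_cross (H : IsAsymptoticallyHyperbolic o B m g) : ∀ᶠ y in atEnd o,
    ∀ i a, a ≠ o → pd i (fun z => g z o a) y = 0 ∧ pd i (fun z => g z a o) y = 0 := by
  refine eventually_all.2 fun i => eventually_all.2 fun a => ?_
  by_cases ha : a = o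
  · exact Eventually.of_forall fun y h => absurd ha h
  filter_upwards [HasConnectionAsymptotics.pd_eq_zero i (H.cross.mono fun y hy => hy a ha),
    HasConnectionAsymptotics.pd_eq_zero i ((H.cross.and H.symm).mono fun y hy =>
      (hy.2.apply o a).trans (hy.1 a ha))]
    with y h1 h2 _ using ⟨h1, h2⟩

/-- The function `Q` in `Γᵒₒₒ = (-1 + Q) / r`. -/
def radialTerm (o : ι) (g : (ι → ℝ) → Matrix ι ι ℝ) (y : ι → ℝ) : ℝ :=
  1 / 2 * ((frameMatrix o g y)⁻¹ o o * euler o (deviation o g o o) y)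

/-- The functions `P` in `Γᵃₒᵦ = (δᵃᵦ + Pᵃᵦ) / r`. -/
def shapeTerm (o : ι) (g : (ι → ℝ) → Matrix ι ι ℝ) (a b : ι) (y : ι → ℝ) : ℝ :=
  1 / 2 * ∑ c ∈ Finset.univ.erase o, (frameMatrix o g y)⁻¹ a c * euler o (deviation o g b c) y

/-- The functions `S` in `Γᵒₐᵦ = - r³ (δₐᵦ + Sₐᵦ)`. -/
def secondFundTerm (o : ι) (g : (ι → ℝ) → Matrix ι ι ℝ) (a b : ι) (y : ι → ℝ) : ℝ :=
  (frameMatrix o g y)⁻¹ o o * ((1 : Matrix ι ι ℝ) a b + deviation o g a b y +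
    1 / 2 * euler o (deviation o g a b) y) - (1 : Matrix ι ι ℝ) a b

/-- Vanishing cross terms reduce every Christoffel symbol to a sum over one block, and a lapse that
depends on r alone kills the symbols with exactly two radial indices. The functions Q, P and S are
exact; linearisation is postponed. -/
theorem hasConnectionAsymptotics (H : IsAsymptoticallyHyperbolic o B m g) (hm : 0 < m) :
    HasConnectionAsymptotics o B m g (radialTerm o g) (shapeTerm o g) (secondFundTerm o g) := by
  have hA : ∀ {a}, a ∈ Finset.univ.erase o → a ≠ o := fun h => (Finset.mem_erase.1 h).1
  have hinvoo : ∀ᶠ y in atEnd o, (g y)⁻¹ o o = y o ^ 2 * (frameMatrix o g y)⁻¹ o o := by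
    filter_upwards [eventually_gt_atEnd 0] with y h0
    rw [frameMatrix_inv h0.ne']; simp only [frameWeight, if_true]; ring
  have hinvab : ∀ᶠ y in atEnd o, ∀ a b, a ≠ o → b ≠ o →
      (g y)⁻¹ a b = (y o ^ 2)⁻¹ * (frameMatrix o g y)⁻¹ a b := by
    filter_upwards [eventually_gt_atEnd 0] with y h0 a b ha hb
    rw [frameMatrix_inv h0.ne']; simp only [frameWeight, if_neg ha, if_neg hb]; ring
  have hoab : ∀ᶠ y in atEnd o, ∀ i j, christoffel g o i j y = 1 / 2 * ((g y)⁻¹ o o *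
      (pd i (fun z => g z j o) y + pd j (fun z => g z i o) y - pd o (fun z => g z i j) y)) := by
    filter_upwards [H.inv_cross] with y hy i j
    rw [christoffel, sum_eq_add_sum_erase o, Finset.sum_eq_zero, add_zero]
    intro a ha
    rw [(hy.2 a (hA ha)).1, zero_mul]
  have habc : ∀ᶠ y in atEnd o, ∀ a i j, a ≠ o → christoffel g a i j y =
      1 / 2 * ∑ d ∈ Finset.univ.erase o, (g y)⁻¹ a d *
      (pd i (fun z => g z j d) y + pd j (fun z => g z i d) y - pd d (fun z => g z i j) y) := by
    filter_upwards [H.inv_cross] with y hy a i j ha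
    rw [christoffel, sum_eq_add_sum_erase o, (hy.2 a ha).2, zero_mul, zero_add]
  have hsymm : ∀ᶠ y in atEnd o, ∀ a b c, christoffel g a b c y = christoffel g a c b y := by
    filter_upwards [eventually_atEnd_nhds H.symm] with y hy a b c using christoffel_symm hy a b c
  have hmix : ∀ᶠ y in atEnd o, ∀ a b, a ≠ o → b ≠ o →
      christoffel g a o b y = (y o)⁻¹ * ((1 : Matrix ι ι ℝ) a b + shapeTerm o g a b y) := by
    -- The tangential block of A⁻¹ A = 1. It turns the contribution of the derivative of the factor
    -- r² into δ without error.
    have hid : ∀ᶠ y in atEnd o, ∀ a b, a ≠ o → b ≠ o → ∑ d ∈ Finset.univ.erase o,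
        (frameMatrix o g y)⁻¹ a d * ((1 : Matrix ι ι ℝ) b d + deviation o g b d y) =
          (1 : Matrix ι ι ℝ) a b := by
      filter_upwards [H.frame_det_ne, H.cross, H.symm] with y hdet hc hs a b ha hb
      have h1 := congrFun (congrFun (Matrix.nonsing_inv_mul _ (isUnit_iff_ne_zero.2 hdet)) a) b
      rw [Matrix.mul_apply, sum_eq_add_sum_erase o] at h1
      have h2 : frameMatrix o g y o b = 0 := by simp [frameMatrix, hc b hb]
      rw [h2, mul_zero, zero_add] at h1
      rw [← h1]
      refine Finset.sum_congr rfl fun d _ => ?_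
      have h3 : frameMatrix o g y d b = frameMatrix o g y b d := by
        simp only [frameMatrix, Matrix.of_apply, hs.apply]; ring
      rw [h3]; simp [deviation]
    filter_upwards [habc, H.pd_metric_ab, H.pd_metric_cross, hinvab, hid, eventually_gt_atEnd 0]
      with y hy hab hc hinv hid h0 a b ha hb
    have hr := h0.ne'
    rw [hy a o b ha, ← hid a b ha hb, shapeTerm, Finset.mul_sum, Finset.mul_sum,
      ← Finset.sum_add_distrib, Finset.mul_sum]
    refine Finset.sum_congr rfl fun d hd => ?_
    rw [hab o b d hb (hA hd), (hc b d (hA hd)).1, (hc d b hb).1, hinv a d ha (hA hd), if_pos rfl]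
    field_simp
    ring
  refine ⟨?_, ?_, ?_, ?_, ?_, hmix, ?_, ?_, ?_, ?_, ?_⟩
  · filter_upwards [hoab, H.pd_metric_oo, H.inv_cross, hinvoo, metric_oo (o := o) (g := g),
      eventually_gt_atEnd 0] with y hy hoo hinv hinvoo hgoo h0
    have hr := h0.ne'
    have h1 := hinv.1
    rw [hinvoo, hgoo] at h1
    field_simp at h1
    rw [hy, hoo, hinvoo, radialTerm]
    field_simp
    linear_combination (-2) * h1
  · filter_upwards [hoab, H.pd_metric_cross, H.lapse] with y hy hc hl a ha
    rw [hy, (hc o a ha).2, hl a ha, (hc o a ha).1]; simp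
  · filter_upwards [hoab, H.pd_metric_cross, H.lapse] with y hy hc hl a ha
    rw [hy, (hc o a ha).2, hl a ha]; simp
  · filter_upwards [habc, H.pd_metric_cross, H.lapse] with y hy hc hl a ha
    rw [hy a o o ha, Finset.sum_eq_zero, mul_zero]
    intro d hd
    rw [(hc o d (hA hd)).1, hl d (hA hd)]; simp
  · filter_upwards [hoab, H.pd_metric_cross, H.pd_metric_ab, hinvoo] with y hy hc hab hinv a b ha hb
    rw [hy, (hc a b hb).2, (hc b a ha).2, hab o a b ha hb, hinv, if_pos rfl, secondFundTerm]
    ring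
  · filter_upwards [hmix, hsymm] with y hy hs a b ha hb
    rw [hs, hy a b ha hb]
  · intro a b c ha hb hc
    -- The factor r⁻² of the inverse metric cancels the r² of its tangential derivatives.
    have key : IsSymbol o B 1 (0 + m) fun y => 1 / 2 * ∑ d ∈ Finset.univ.erase o,
        (frameMatrix o g y)⁻¹ a d * (pd b (deviation o g c d) y + pd c (deviation o g b d) y -
          pd d (deviation o g b c) y) :=
      (IsSymbol.sum fun d hd => (H.symbol_inv hm a d).lower.mul
        ((((H.symbol c d).pd_ne hb).add ((H.symbol b d).pd_ne hc)).sub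
          ((H.symbol b c).pd_ne (hA hd)))).const_mul _
    refine (key.mono (by omega)).congr ?_
    filter_upwards [habc, H.pd_metric_ab, hinvab, eventually_gt_atEnd 0] with y hy hab hinv h0
    have hr := h0.ne'
    rw [hy a b c ha]
    congr 1
    refine Finset.sum_congr rfl fun d hd => ?_
    rw [hab b c d hc (hA hd), hab c b d hb (hA hd), hab d b c hb hc, hinv a d ha (hA hd), if_neg hb,
      if_neg hc, if_neg (hA hd)]
    field_simp
  · exact (((H.symbol_inv hm o o).lower.mul (H.symbol o o).euler).const_mul _).mono (by omega)
  · intro a b ha hb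
    exact ((IsSymbol.sum fun c hc => (H.symbol_inv hm a c).lower.mul
      (H.symbol b c).euler).const_mul _).mono (by omega)
  · intro a b ha hb
    have h1 : IsSymbol o B 1 m fun y => deviation o g a b y +
        1 / 2 * euler o (deviation o g a b) y :=
      (H.symbol a b).lower.add ((H.symbol a b).euler.const_mul _)
    have h2 : IsSymbol o B 1 (0 + m) _ := (H.symbol_inv hm o o).lower.mul h1
    have h3 : IsSymbol o B 1 (m + 0) _ := (H.symbol_inv_sub hm o o).lower.mul
      (isSymbol_const ((1 : Matrix ι ι ℝ) a b))
    refine ((h2.mono (q := m) (by omega)).add (h3.mono (q := m) (by omega))).congr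
      (Eventually.of_forall fun y => ?_)
    simp only [secondFundTerm, Matrix.one_apply_eq]
    ring

/-- Linearisation: replacing the inverse frame matrix by the identity costs a product of two factors
of order m. -/
theorem radialTerm_approx (H : IsAsymptoticallyHyperbolic o B m g) (hm : 0 < m) :
    IsSymbol o B 1 (m + m) fun y => radialTerm o g y - 1 / 2 * euler o (deviation o g o o) y := by
  have h : IsSymbol o B 1 (m + m) _ :=
    ((H.symbol_inv_sub hm o o).lower.mul (H.symbol o o).euler).const_mul (1 / 2)
  refine h.congr (Eventually.of_forall fun y => ?_)
  change 1 / 2 * (((frameMatrix o g y)⁻¹ o o - (1 : Matrix ι ι ℝ) o o) *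
    euler o (deviation o g o o) y) = _
  simp only [radialTerm, Matrix.one_apply_eq]
  ring

theorem deviation_symm (H : IsAsymptoticallyHyperbolic o B m g) (i j : ι) :
    deviation o g i j =ᶠ[atEnd o] deviation o g j i := by
  filter_upwards [H.symm] with y hs
  have : (1 : Matrix ι ι ℝ) i j = (1 : Matrix ι ι ℝ) j i := by simp [Matrix.one_apply, eq_comm]
  simp only [deviation, frameMatrix, Matrix.of_apply, hs.apply i j, this]
  ring

theorem shapeTerm_approx (H : IsAsymptoticallyHyperbolic o B m g) (hm : 0 < m) {a : ι}
    (ha : a ≠ o) (b : ι) :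
    IsSymbol o B 1 (m + m) fun y => shapeTerm o g a b y -
      1 / 2 * euler o (deviation o g a b) y := by
  have haA : a ∈ Finset.univ.erase o := Finset.mem_erase.2 ⟨ha, Finset.mem_univ _⟩
  have h : IsSymbol o B 1 (m + m) _ := (IsSymbol.sum (s := Finset.univ.erase o) fun c _ =>
    (H.symbol_inv_sub hm a c).lower.mul (H.symbol b c).euler).const_mul (1 / 2)
  refine h.congr ?_
  filter_upwards [euler_congr (H.deviation_symm a b)] with y hy
  have h2 : ∑ c ∈ Finset.univ.erase o, (1 : Matrix ι ι ℝ) a c * euler o (deviation o g b c) y =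
      euler o (deviation o g b a) y := by
    simp only [Matrix.one_apply, ite_mul, one_mul, zero_mul, Finset.sum_ite_eq, haA, if_true]
  change 1 / 2 * (∑ c ∈ Finset.univ.erase o, ((frameMatrix o g y)⁻¹ a c -
    (1 : Matrix ι ι ℝ) a c) * euler o (deviation o g b c) y) = _
  simp only [sub_mul, Finset.sum_sub_distrib]
  rw [h2, hy, shapeTerm]
  ring

/-- The inverse multiplies the unperturbed δ, so it is needed to first order here. That is the
origin of the term -D_oo δ. -/
theorem secondFundTerm_approx (H : IsAsymptoticallyHyperbolic o B m g) (hm : 0 < m) (a b : ι) :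
    IsSymbol o B 1 (m + m) fun y => secondFundTerm o g a b y -
      (deviation o g a b y + 1 / 2 * euler o (deviation o g a b) y -
        deviation o g o o y * (1 : Matrix ι ι ℝ) a b) := by
  have h1 : IsSymbol o B 1 m fun y => deviation o g a b y +
      1 / 2 * euler o (deviation o g a b) y :=
    (H.symbol a b).lower.add ((H.symbol a b).euler.const_mul _)
  have h2 : IsSymbol o B 1 (m + m) _ := (H.symbol_inv_sub hm o o).lower.mul h1
  have h3 : IsSymbol o B 1 (m + m) _ :=
    (H.symbol_inv_sub_add hm o o).lower.const_mul ((1 : Matrix ι ι ℝ) a b)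
  refine (h2.add h3).congr (Eventually.of_forall fun y => ?_)
  simp only [secondFundTerm, Matrix.one_apply_eq]
  ring

end IsAsymptoticallyHyperbolic

end MetricAsymptotics

/-! ### Two-term expansions in powers of 1/r. -/

section Expansions

variable {ι : Type} [Fintype ι] [DecidableEq ι] {o : ι} {B : ℝ} {k m : ℕ}
  {f g c d c' d' : (ι → ℝ) → ℝ}

theorem isAngular_const (x : ℝ) : IsAngular o fun _ => x := ⟨contDiff_const, fun _ _ => rfl⟩

theorem IsAngular.add (hc : IsAngular o c) (hd : IsAngular o d) : IsAngular o fun y => c y + d y :=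
  ⟨hc.1.add hd.1, fun y t => by simp only [hc.2, hd.2]⟩

theorem IsAngular.mul (hc : IsAngular o c) (hd : IsAngular o d) : IsAngular o fun y => c y * d y :=
  ⟨hc.1.mul hd.1, fun y t => by simp only [hc.2, hd.2]⟩

theorem IsAngular.const_mul (hc : IsAngular o c) (x : ℝ) : IsAngular o fun y => x * c y :=
  (isAngular_const x).mul hc

theorem IsAngular.sum {κ : Type} {s : Finset κ} {F : κ → (ι → ℝ) → ℝ}
    (hF : ∀ a ∈ s, IsAngular o (F a)) : IsAngular o fun y => ∑ a ∈ s, F a y :=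
  ⟨ContDiff.sum fun a ha => (hF a ha).1, fun y t => Finset.sum_congr rfl fun a ha => (hF a ha).2 y t⟩

/-- Expansions `f = c r⁻ᵐ + d r⁻ᵐ⁻¹ + O(r⁻ᵐ⁻²)` that can be differentiated `k` times. -/
def HasExpansion (o : ι) (B : ℝ) (k m : ℕ) (f c d : (ι → ℝ) → ℝ) : Prop :=
  (IsAngular o c ∧ IsAngular o d) ∧ IsSymbol o B k (m + 2) fun y =>
    f y - (c y * y o ^ (-(m : ℤ)) + d y * y o ^ (-(m + 1 : ℤ)))

theorem HasExpansion.of_isSymbol (hf : IsSymbol o B k (m + 2) f) :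
    HasExpansion o B k m f (fun _ => 0) (fun _ => 0) :=
  ⟨⟨isAngular_const 0, isAngular_const 0⟩, by simpa using hf⟩

theorem HasExpansion.lower (hf : HasExpansion o B (k + 1) m f c d) : HasExpansion o B k m f c d :=
  ⟨hf.1, hf.2.lower⟩

theorem HasExpansion.congr (hf : HasExpansion o B k m f c d) (h : f =ᶠ[atEnd o] g) :
    HasExpansion o B k m g c d :=
  ⟨hf.1, hf.2.congr (h.mono fun y hy => by simp only [hy])⟩

theorem HasExpansion.congr_coeff (hf : HasExpansion o B k m f c d) (hc : ∀ y, c y = c' y)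
    (hd : ∀ y, d y = d' y) : HasExpansion o B k m f c' d' := by
  rwa [← funext hc, ← funext hd]

theorem HasExpansion.add (hf : HasExpansion o B k m f c d) (hg : HasExpansion o B k m g c' d') :
    HasExpansion o B k m (fun y => f y + g y) (fun y => c y + c' y) (fun y => d y + d' y) :=
  ⟨⟨hf.1.1.add hg.1.1, hf.1.2.add hg.1.2⟩, (hf.2.add hg.2).congr
    (Eventually.of_forall fun y => by ring)⟩

theorem HasExpansion.const_mul (hf : HasExpansion o B k m f c d) (x : ℝ) :
    HasExpansion o B k m (fun y => x * f y) (fun y => x * c y) (fun y => x * d y) :=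
  ⟨⟨hf.1.1.const_mul x, hf.1.2.const_mul x⟩, (hf.2.const_mul x).congr
    (Eventually.of_forall fun y => by ring)⟩

theorem HasExpansion.sum {κ : Type} {s : Finset κ} {F C D : κ → (ι → ℝ) → ℝ}
    (hF : ∀ a ∈ s, HasExpansion o B k m (F a) (C a) (D a)) :
    HasExpansion o B k m (fun y => ∑ a ∈ s, F a y) (fun y => ∑ a ∈ s, C a y)
      (fun y => ∑ a ∈ s, D a y) :=
  ⟨⟨IsAngular.sum fun a ha => (hF a ha).1.1, IsAngular.sum fun a ha => (hF a ha).1.2⟩,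
    (IsSymbol.sum fun a ha => (hF a ha).2).congr (Eventually.of_forall fun y => by
      simp only [Finset.sum_sub_distrib, Finset.sum_add_distrib, Finset.sum_mul])⟩

theorem HasExpansion.isSymbol (hf : HasExpansion o B k m f c d) : IsSymbol o B k m f := by
  have h1 : IsSymbol o B k (0 + m) _ := hf.1.1.isSymbol.mul (isSymbol_zpow m)
  have h2 : IsSymbol o B k (0 + (m + 1)) _ := hf.1.2.isSymbol.mul (isSymbol_zpow (m + 1))
  exact ((hf.2.mono (q := m) (by omega)).add ((h1.mono (q := m) (by omega)).add
    (h2.mono (q := m) (by omega)))).congr (Eventually.of_forall fun y => by ring)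

theorem HasExpansion.isSymbol_succ (hf : HasExpansion o B k m f c d) (h0 : ∀ y, c y = 0) :
    IsSymbol o B k (m + 1) f := by
  have h2 : IsSymbol o B k (0 + (m + 1)) _ := hf.1.2.isSymbol.mul (isSymbol_zpow (m + 1))
  exact ((hf.2.mono (q := m + 1) (by omega)).add (h2.mono (q := m + 1) (by omega))).congr
    (Eventually.of_forall fun y => by simp only [h0]; ring)

theorem euler_add {y : ι → ℝ} (hf : ContDiffAt ℝ ∞ f y) (hg : ContDiffAt ℝ ∞ g y) :
    euler o (fun z => f z + g z) y = euler o f y + euler o g y := by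
  simp only [euler, pd_add o hf hg]; ring

theorem euler_sub {y : ι → ℝ} (hf : ContDiffAt ℝ ∞ f y) (hg : ContDiffAt ℝ ∞ g y) :
    euler o (fun z => f z - g z) y = euler o f y - euler o g y := by
  simp only [euler, pd_sub o hf hg]; ring

theorem euler_const_mul {y : ι → ℝ} (x : ℝ) (hf : ContDiffAt ℝ ∞ f y) :
    euler o (fun z => x * f z) y = x * euler o f y := by
  simp only [euler, pd_const_mul o x hf]; ring

theorem HasExpansion.euler (hf : HasExpansion o B (k + 1) m f c d) :
    HasExpansion o B k m (euler o f) (fun y => -(m : ℝ) * c y) (fun y => -((m : ℝ) + 1) * d y) := by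
  refine ⟨⟨hf.1.1.const_mul _, hf.1.2.const_mul _⟩, hf.2.euler.congr ?_⟩
  have h1 := euler_angular_zpow hf.1.1 m
  have h2 := euler_angular_zpow hf.1.2 (m + 1)
  filter_upwards [hf.isSymbol.smooth, h1, h2, eventually_gt_atEnd 0] with y hs h1 h2 h0
  have e1 : ContDiffAt ℝ ∞ (fun y => c y * y o ^ (-(m : ℤ))) y :=
    hf.1.1.1.contDiffAt.mul (contDiffAt_coord_zpow h0.ne' _)
  have e2 : ContDiffAt ℝ ∞ (fun y => d y * y o ^ (-(m + 1 : ℤ))) y :=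
    hf.1.2.1.contDiffAt.mul (contDiffAt_coord_zpow h0.ne' _)
  rw [euler_sub hs (e1.add e2), euler_add e1 e2, h1, h2]
  push_cast
  ring

end Expansions

/-! ### Expansion of Ric + m g. -/

section EinsteinDefect

variable {ι : Type} [Fintype ι] [DecidableEq ι]

/-- The tensor `Ric(g) + m g`. -/
def einsteinDefect (m : ℕ) (g : (ι → ℝ) → Matrix ι ι ℝ) (y : ι → ℝ) : Matrix ι ι ℝ :=
  ricci g y + (m : ℝ) • g y

namespace IsAsymptoticallyHyperbolic

variable {o : ι} {B : ℝ} {m : ℕ} {g : (ι → ℝ) → Matrix ι ι ℝ}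
  {c d : ι → ι → (ι → ℝ) → ℝ}

/-- The linearised Q and P are inserted into `ricci_oo`; the constant -m of the Ricci curvature
cancels against that of m g. -/
theorem defect_oo (H : IsAsymptoticallyHyperbolic o B m g)
    (hm : (Finset.univ.erase o).card = m) (hm2 : 2 ≤ m) :
    IsSymbol o B 0 (m + 2) fun y => frameMatrix o (einsteinDefect m g) y o o +
      1 / 2 * ∑ a ∈ Finset.univ.erase o, euler o (euler o (deviation o g a a)) y -
      m / 2 * euler o (deviation o g o o) y +
      ∑ a ∈ Finset.univ.erase o, euler o (deviation o g a a) y - m * deviation o g o o y := by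
  have hA : ∀ {a}, a ∈ Finset.univ.erase o → a ≠ o := fun h => (Finset.mem_erase.1 h).1
  have hm0 : 0 < m := by omega
  have HC := H.hasConnectionAsymptotics hm0
  have h1 := HC.ricci_oo hm hm2
  have h2 : IsSymbol o B 0 (m + m) _ := IsSymbol.sum (s := Finset.univ.erase o) fun a ha =>
    (H.shapeTerm_approx hm0 (hA ha) a).euler
  have h3 : IsSymbol o B 0 (m + m) _ := (H.radialTerm_approx hm0).zero.const_mul m
  have h4 : IsSymbol o B 0 (m + m) _ := (IsSymbol.sum (s := Finset.univ.erase o) fun a ha =>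
    (H.shapeTerm_approx hm0 (hA ha) a).zero).const_mul 2
  refine (((h1.sub (h2.mono (q := m + 2) (by omega))).add (h3.mono (q := m + 2) (by omega))).sub
    (h4.mono (q := m + 2) (by omega))).congr ?_
  have hsm : ∀ᶠ y in atEnd o, ∀ a, a ≠ o →
      ContDiffAt ℝ ∞ (shapeTerm o g a a) y ∧ ContDiffAt ℝ ∞ (euler o (deviation o g a a)) y := by
    refine eventually_all.2 fun a => ?_
    by_cases ha : a = o
    · exact Eventually.of_forall fun y h => absurd ha h
    · filter_upwards [(HC.symbolP a a ha ha).smooth, (H.symbol a a).euler.smooth] with y h1 h2 _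
        using ⟨h1, h2⟩
  filter_upwards [metric_oo (o := o) (g := g), eventually_gt_atEnd 0, hsm] with y hg h0 hsm
  have hr := h0.ne'
  have e1 : frameMatrix o (einsteinDefect m g) y o o =
      y o ^ 2 * ricci g y o o + m * (1 + deviation o g o o y) := by
    simp only [frameMatrix, einsteinDefect, Matrix.of_apply, frameWeight, if_true, Matrix.add_apply,
      Matrix.smul_apply, smul_eq_mul, hg]
    field_simp
  have e2 : ∑ a ∈ Finset.univ.erase o, euler o (fun z => shapeTerm o g a a z -
      1 / 2 * euler o (deviation o g a a) z) y =
      ∑ a ∈ Finset.univ.erase o, euler o (shapeTerm o g a a) y -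
      1 / 2 * ∑ a ∈ Finset.univ.erase o, euler o (euler o (deviation o g a a)) y := by
    rw [Finset.mul_sum, ← Finset.sum_sub_distrib]
    refine Finset.sum_congr rfl fun a ha => ?_
    have := hsm a (hA ha)
    rw [euler_sub this.1 (contDiffAt_const.mul this.2), euler_const_mul _ this.2]
  rw [e1, e2, Finset.sum_sub_distrib, ← Finset.mul_sum]
  ring

/-- The linearised Q, P and S are inserted into `ricci_ab`, and transposed terms merge by symmetry
of the deviation. The undifferentiated D_ab disappears: (m + 1) S_ab - S_ba contributes m D_ab,
which cancels that of m g. -/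
theorem defect_ab (H : IsAsymptoticallyHyperbolic o B m g)
    (hm : (Finset.univ.erase o).card = m) (hm2 : 2 ≤ m) {a b : ι} (ha : a ≠ o) (hb : b ≠ o) :
    IsSymbol o B 0 (m + 2) fun y => frameMatrix o (einsteinDefect m g) y a b +
      m / 2 * euler o (deviation o g a b) y - m * (1 : Matrix ι ι ℝ) a b * deviation o g o o y +
      1 / 2 * euler o (euler o (deviation o g a b)) y +
      (1 : Matrix ι ι ℝ) a b * (-(1 / 2) * euler o (deviation o g o o) y +
      1 / 2 * ∑ c ∈ Finset.univ.erase o, euler o (deviation o g c c) y) := by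
  have hA : ∀ {a}, a ∈ Finset.univ.erase o → a ≠ o := fun h => (Finset.mem_erase.1 h).1
  have hm0 : 0 < m := by omega
  have HC := H.hasConnectionAsymptotics hm0
  have h1 := HC.ricci_ab hm hm2 ha hb
  have h2 : IsSymbol o B 0 (m + m) _ := (H.secondFundTerm_approx hm0 a b).zero.const_mul (m + 1)
  have h3 : IsSymbol o B 0 (m + m) _ := (H.secondFundTerm_approx hm0 b a).zero
  have h4 : IsSymbol o B 0 (m + m) _ := (H.secondFundTerm_approx hm0 a b).euler
  have h5 : IsSymbol o B 0 (m + m) _ := (H.radialTerm_approx hm0).zero.const_mul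
    ((1 : Matrix ι ι ℝ) a b)
  have h6 : IsSymbol o B 0 (m + m) _ := (IsSymbol.sum (s := Finset.univ.erase o) fun a ha =>
    (H.shapeTerm_approx hm0 (hA ha) a).zero).const_mul ((1 : Matrix ι ι ℝ) a b)
  have h7 : IsSymbol o B 0 (m + m) _ := (H.shapeTerm_approx hm0 ha b).zero
  have h8 : IsSymbol o B 0 (m + m) _ := (H.shapeTerm_approx hm0 hb a).zero
  have h9 : IsSymbol o B 0 (m + m) _ := ((((((h3.sub h2).sub h4).sub h5).sub h6).add h7).add h8)
  refine (h1.add (h9.mono (q := m + 2) (by omega))).congr ?_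
  filter_upwards [metric_ab (o := o) (g := g) ha hb, eventually_gt_atEnd 0,
    (HC.symbolS a b ha hb).smooth, (H.symbol a b).smooth, (H.symbol a b).euler.smooth,
    (H.symbol o o).smooth, H.deviation_symm a b, euler_congr (H.deviation_symm a b)]
    with y hg h0 hS hd hde hdo hs1 hs2
  have hr := h0.ne'
  have e1 : frameMatrix o (einsteinDefect m g) y a b =
      (y o ^ 2)⁻¹ * ricci g y a b + m * ((1 : Matrix ι ι ℝ) a b + deviation o g a b y) := by
    simp only [frameMatrix, einsteinDefect, Matrix.of_apply, frameWeight, if_neg ha, if_neg hb,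
      Matrix.add_apply, Matrix.smul_apply, smul_eq_mul, hg]
    field_simp
  have hsym : (1 : Matrix ι ι ℝ) b a = (1 : Matrix ι ι ℝ) a b := by
    simp [Matrix.one_apply, eq_comm]
  have hd' : ContDiffAt ℝ ∞ (deviation o g a b) y := hd
  have hde' : ContDiffAt ℝ ∞ (euler o (deviation o g a b)) y := hde
  have hdo' : ContDiffAt ℝ ∞ (deviation o g o o) y := hdo
  have e4 : euler o (fun z => secondFundTerm o g a b z -
      (deviation o g a b z + 1 / 2 * euler o (deviation o g a b) z -
        deviation o g o o z * (1 : Matrix ι ι ℝ) a b)) y = euler o (secondFundTerm o g a b) y -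
      (euler o (deviation o g a b) y + 1 / 2 * euler o (euler o (deviation o g a b)) y -
        (1 : Matrix ι ι ℝ) a b * euler o (deviation o g o o) y) := by
    simp only [mul_comm _ ((1 : Matrix ι ι ℝ) a b)]
    rw [euler_sub hS ((hd'.add (contDiffAt_const.mul hde')).sub (contDiffAt_const.mul hdo')),
      euler_sub (hd'.add (contDiffAt_const.mul hde')) (contDiffAt_const.mul hdo'),
      euler_add hd' (contDiffAt_const.mul hde'), euler_const_mul _ hde', euler_const_mul _ hdo']
  rw [e1, e4, hsym, Finset.sum_sub_distrib, ← Finset.mul_sum, ← hs1, ← hs2]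
  ring

/-- The frame weights r and r⁻¹ cancel and the metric has no mixed components, so these are mixed
Ricci components unchanged. -/
theorem defect_cross (H : IsAsymptoticallyHyperbolic o B m g) (hm2 : 2 ≤ m) {a : ι} (ha : a ≠ o) :
    (IsSymbol o B 0 (m + 1) fun y => frameMatrix o (einsteinDefect m g) y o a) ∧
    IsSymbol o B 0 (m + 1) fun y => frameMatrix o (einsteinDefect m g) y a o := by
  have HC := H.hasConnectionAsymptotics (by omega)
  constructor
  · refine (HC.ricci_oa hm2 ha).congr ?_
    filter_upwards [H.cross, eventually_gt_atEnd 0] with y hg h0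
    have hr := h0.ne'
    simp only [frameMatrix, einsteinDefect, Matrix.of_apply, frameWeight, if_neg ha, if_true,
      Matrix.add_apply, Matrix.smul_apply, smul_eq_mul, hg a ha]
    field_simp
    ring
  · refine (HC.ricci_ao hm2 ha).congr ?_
    filter_upwards [H.cross, H.symm, eventually_gt_atEnd 0] with y hg hs h0
    have hr := h0.ne'
    simp only [frameMatrix, einsteinDefect, Matrix.of_apply, frameWeight, if_neg ha, if_true,
      Matrix.add_apply, Matrix.smul_apply, smul_eq_mul, (hs.apply o a).trans (hg a ha)]
    field_simp
    ring

/-- The Euler operator is -m on the c-term and -(m+1) on the d-term. At order r⁻ᵐ the coefficients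
of c_oo and of Σ c_aa both come out as m - m²/2, which is why only the full trace appears. -/
theorem expansion_defect_oo (H : IsAsymptoticallyHyperbolic o B m g)
    (hm : (Finset.univ.erase o).card = m) (hm2 : 2 ≤ m)
    (hE : ∀ i j, HasExpansion o B 2 m (deviation o g i j) (c i j) (d i j)) :
    HasExpansion o B 0 m (fun y => frameMatrix o (einsteinDefect m g) y o o)
      (fun y => (m - m ^ 2 / 2) * (c o o y + ∑ a ∈ Finset.univ.erase o, c a a y))
      (fun y => (m - m * (m + 1) / 2) * d o o y +
        ((m + 1) - (m + 1) ^ 2 / 2) * ∑ a ∈ Finset.univ.erase o, d a a y) := by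
  have h0 := HasExpansion.of_isSymbol (H.defect_oo hm hm2)
  have h1 := (HasExpansion.sum (s := Finset.univ.erase o) fun a _ =>
    (hE a a).euler.euler).const_mul (-(1 / 2))
  have h2 := (hE o o).euler.lower.const_mul (m / 2)
  have h3 := (HasExpansion.sum (s := Finset.univ.erase o) fun a _ =>
    (hE a a).euler.lower).const_mul (-1)
  have h4 := (hE o o).lower.lower.const_mul m
  refine (((((h0.add h1).add h2).add h3).add h4).congr
    (Eventually.of_forall fun y => by ring)).congr_coeff (fun y => ?_) (fun y => ?_)
  · simp only [← Finset.mul_sum]; ring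
  · simp only [← Finset.mul_sum]; ring

/-- At order r⁻ᵐ the single component c_ab cancels, because (m/2) m - ½ m² = 0, and only the trace
times δ survives. -/
theorem expansion_defect_ab (H : IsAsymptoticallyHyperbolic o B m g)
    (hm : (Finset.univ.erase o).card = m) (hm2 : 2 ≤ m)
    (hE : ∀ i j, HasExpansion o B 2 m (deviation o g i j) (c i j) (d i j))
    {a b : ι} (ha : a ≠ o) (hb : b ≠ o) :
    HasExpansion o B 0 m (fun y => frameMatrix o (einsteinDefect m g) y a b)
      (fun y => m / 2 * (1 : Matrix ι ι ℝ) a b *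
        (c o o y + ∑ e ∈ Finset.univ.erase o, c e e y))
      (fun y => -((m + 1) / 2) * d a b y + (1 : Matrix ι ι ℝ) a b *
        ((m - (m + 1) / 2) * d o o y + (m + 1) / 2 * ∑ e ∈ Finset.univ.erase o, d e e y)) := by
  have h0 := HasExpansion.of_isSymbol (H.defect_ab hm hm2 ha hb)
  have h1 := (hE a b).euler.lower.const_mul (-(m / 2))
  have h2 := (hE o o).lower.lower.const_mul (m * (1 : Matrix ι ι ℝ) a b)
  have h3 := (hE a b).euler.euler.const_mul (-(1 / 2))
  have h4 := (hE o o).euler.lower.const_mul (1 / 2 * (1 : Matrix ι ι ℝ) a b)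
  have h5 := (HasExpansion.sum (s := Finset.univ.erase o) fun a _ =>
    (hE a a).euler.lower).const_mul (-(1 / 2) * (1 : Matrix ι ι ℝ) a b)
  refine ((((((h0.add h1).add h2).add h3).add h4).add h5).congr
    (Eventually.of_forall fun y => by ring)).congr_coeff (fun y => ?_) (fun y => ?_)
  · simp only [← Finset.mul_sum]; ring
  · simp only [← Finset.mul_sum]; ring

/-- In the trace of `Ric + m g` the terms of order `r⁻ᵐ⁻¹` cancel. -/
theorem expansion_defect_trace (H : IsAsymptoticallyHyperbolic o B m g)
    (hm : (Finset.univ.erase o).card = m) (hm2 : 2 ≤ m)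
    (hE : ∀ i j, HasExpansion o B 2 m (deviation o g i j) (c i j) (d i j)) :
    HasExpansion o B 0 m (fun y => ∑ i, frameMatrix o (einsteinDefect m g) y i i)
      (fun y => m * (c o o y + ∑ a ∈ Finset.univ.erase o, c a a y)) (fun _ => 0) := by
  have hA : ∀ {a}, a ∈ Finset.univ.erase o → a ≠ o := fun h => (Finset.mem_erase.1 h).1
  have h1 := (H.expansion_defect_oo hm hm2 hE).add
    (HasExpansion.sum (s := Finset.univ.erase o) fun a ha =>
      H.expansion_defect_ab hm hm2 hE (hA ha) (hA ha))
  have hcard : ∀ x : ℝ, ∑ _a ∈ Finset.univ.erase o, x = m * x := fun x => by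
    rw [Finset.sum_const, hm, nsmul_eq_mul]
  refine (h1.congr (Eventually.of_forall fun y => ?_)).congr_coeff (fun y => ?_) (fun y => ?_)
  · exact (sum_eq_add_sum_erase o fun i => frameMatrix o (einsteinDefect m g) y i i).symm
  · simp only [Matrix.one_apply_eq, hcard]; ring
  -- The coefficient of d_oo is m - m(m+1)/2 + m(m - (m+1)/2) = 0; that of Σ d_aa is (m+1)(1 -
  -- (m+1)/2 - 1/2 + m/2) = 0.
  · simp only [Matrix.one_apply_eq, Finset.sum_add_distrib, hcard, ← Finset.mul_sum]; ring

end IsAsymptoticallyHyperbolic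

end EinsteinDefect

/-! ### Scalar curvature and the norm of Ric + m g. -/

section EinsteinDefect

variable {ι : Type} [Fintype ι] [DecidableEq ι]

namespace IsAsymptoticallyHyperbolic

variable {o : ι} {B : ℝ} {m : ℕ} {g : (ι → ℝ) → Matrix ι ι ℝ}
  {c d : ι → ι → (ι → ℝ) → ℝ}

/-- The g-trace of Ric + m g; the second term contributes m times the dimension m + 1. -/
theorem scalarCurvature_eq (H : IsAsymptoticallyHyperbolic o B m g)
    (hm : (Finset.univ.erase o).card = m) : ∀ᶠ y in atEnd o,
    scalarCurvature g y + m * (m + 1) =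
      ∑ i, ∑ j, (frameMatrix o g y)⁻¹ i j * frameMatrix o (einsteinDefect m g) y i j := by
  filter_upwards [H.symm, H.det_ne, eventually_gt_atEnd 0] with y hs hdet h0
  have hr := h0.ne'
  have hcard : (Fintype.card ι : ℝ) = m + 1 := by
    have := Finset.card_erase_add_one (Finset.mem_univ o)
    rw [hm] at this
    rw [← Finset.card_univ, ← this]; push_cast; ring
  have h1 : ∑ i, ∑ j, (g y)⁻¹ i j * g y i j = m + 1 := by
    rw [sum_inv_mul_eq_trace, hs.eq, Matrix.nonsing_inv_mul _ (isUnit_iff_ne_zero.2 hdet),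
      Matrix.trace_one, hcard]
  have h2 : ∀ i j, (frameMatrix o g y)⁻¹ i j * frameMatrix o (einsteinDefect m g) y i j =
      (g y)⁻¹ i j * ricci g y i j + m * ((g y)⁻¹ i j * g y i j) := by
    intro i j
    rw [frameMatrix_inv (T := g) hr i j]
    generalize (frameMatrix o g y)⁻¹ i j = x
    simp only [frameMatrix, einsteinDefect, Matrix.of_apply, Matrix.add_apply, Matrix.smul_apply,
      smul_eq_mul]
    ring
  simp only [h2, Finset.sum_add_distrib, ← Finset.mul_sum, h1]
  rfl

theorem sum_tensorNorm_eq (T : (ι → ℝ) → Matrix ι ι ℝ) : ∀ᶠ y in atEnd o,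
    ∑ i, ∑ j, ∑ k, ∑ l, (g y)⁻¹ i k * (g y)⁻¹ j l * T y i j * T y k l =
    ∑ i, ∑ j, ∑ k, ∑ l, (frameMatrix o g y)⁻¹ i k * (frameMatrix o g y)⁻¹ j l *
      frameMatrix o T y i j * frameMatrix o T y k l := by
  filter_upwards [eventually_gt_atEnd 0] with y h0
  have hr := h0.ne'
  refine Finset.sum_congr rfl fun i _ => Finset.sum_congr rfl fun j _ =>
    Finset.sum_congr rfl fun k _ => Finset.sum_congr rfl fun l _ => ?_
  rw [frameMatrix_inv (T := g) hr i k, frameMatrix_inv (T := g) hr j l]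
  generalize (frameMatrix o g y)⁻¹ i k = x
  generalize (frameMatrix o g y)⁻¹ j l = x'
  simp only [frameMatrix, Matrix.of_apply]
  ring

variable (H : IsAsymptoticallyHyperbolic o B m g) (hm : (Finset.univ.erase o).card = m)
  (hm2 : 2 ≤ m) (hE : ∀ i j, HasExpansion o B 2 m (deviation o g i j) (c i j) (d i j))

include H hm hm2 hE

theorem symbol_defect (i j : ι) :
    IsSymbol o B 0 m fun y => frameMatrix o (einsteinDefect m g) y i j := by
  by_cases hi : i = o
  · subst hi
    by_cases hj : j = i
    · subst hj; exact (H.expansion_defect_oo hm hm2 hE).isSymbol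
    · exact (H.defect_cross hm2 hj).1.mono (by omega)
  · by_cases hj : j = o
    · subst hj; exact (H.defect_cross hm2 hi).2.mono (by omega)
    · exact (H.expansion_defect_ab hm hm2 hE hi hj).isSymbol

/-- All coefficients of order r⁻ᵐ are multiples of the trace of c, and the mixed components are
already one order smaller. -/
theorem symbol_defect_succ (h0 : ∀ y, c o o y + ∑ a ∈ Finset.univ.erase o, c a a y = 0) (i j : ι) :
    IsSymbol o B 0 (m + 1) fun y => frameMatrix o (einsteinDefect m g) y i j := by
  by_cases hi : i = o
  · subst hi
    by_cases hj : j = i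
    · subst hj
      exact (H.expansion_defect_oo hm hm2 hE).isSymbol_succ fun y => by rw [h0, mul_zero]
    · exact (H.defect_cross hm2 hj).1
  · by_cases hj : j = o
    · subst hj; exact (H.defect_cross hm2 hi).2
    · exact (H.expansion_defect_ab hm hm2 hE hi hj).isSymbol_succ fun y => by rw [h0, mul_zero]

/-- The expansion of the scalar curvature. -/
theorem scalarCurvature_expansion : IsSymbol o B 0 (m + 2) fun y =>
    scalarCurvature g y + m * (m + 1) -
      m * (c o o y + ∑ a ∈ Finset.univ.erase o, c a a y) * y o ^ (-(m : ℤ)) := by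
  have h1 := (H.expansion_defect_trace hm hm2 hE).2
  -- The error made by tracing with the identity in place of the inverse frame matrix.
  have h2 : IsSymbol o B 0 (m + m) _ := IsSymbol.sum (s := Finset.univ) fun i _ =>
    IsSymbol.sum (s := Finset.univ) fun j _ =>
      (H.symbol_inv_sub (by omega) i j).zero.mul (H.symbol_defect hm hm2 hE i j)
  refine (h1.add (h2.mono (q := m + 2) (by omega))).congr ?_
  filter_upwards [H.scalarCurvature_eq hm] with y hy
  have h3 : ∑ i, ∑ j, (1 : Matrix ι ι ℝ) i j * frameMatrix o (einsteinDefect m g) y i j =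
      ∑ i, frameMatrix o (einsteinDefect m g) y i i := by
    simp [Matrix.one_apply]
  simp only [sub_mul, Finset.sum_sub_distrib]
  rw [hy, h3]
  ring

theorem tensorNorm_isBigO (h0 : ∀ y, c o o y + ∑ a ∈ Finset.univ.erase o, c a a y = 0) :
    (fun y => tensorNorm (g y) (einsteinDefect m g y)) =O[endBox o B]
      fun y => y o ^ (-(m + 1 : ℤ)) := by
  have hD := H.symbol_defect_succ hm hm2 hE h0
  have hinv : ∀ i j, IsSymbol o B 0 0 fun y => (frameMatrix o g y)⁻¹ i j := fun i j =>
    (H.symbol_inv (by omega) i j).zero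
  have h2 : IsSymbol o B 0 ((0 + 0 + (m + 1)) + (m + 1)) _ :=
    IsSymbol.sum (s := Finset.univ) fun i _ => IsSymbol.sum (s := Finset.univ) fun j _ =>
    IsSymbol.sum (s := Finset.univ) fun k _ => IsSymbol.sum (s := Finset.univ) fun l _ =>
      (((hinv i k).mul (hinv j l)).mul (hD i j)).mul (hD k l)
  obtain ⟨C, hC0, hC⟩ := h2.isBigO.exists_nonneg
  refine IsBigO.of_bound (Real.sqrt C) ?_
  filter_upwards [hC.bound, (sum_tensorNorm_eq (o := o) (g := g)
    (einsteinDefect m g)).filter_mono endBox_le, (eventually_gt_atEnd 0).filter_mono endBox_le]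
    with y hy hs h0
  have hpos : 0 ≤ y o ^ (-(m + 1 : ℤ)) := (zpow_pos h0 _).le
  rw [tensorNorm, hs, Real.norm_of_nonneg (Real.sqrt_nonneg _), Real.norm_of_nonneg hpos]
  have e : y o ^ (-(0 + 0 + (m + 1) + (m + 1) : ℤ)) = (y o ^ (-(m + 1 : ℤ))) ^ 2 := by
    rw [← zpow_natCast, ← zpow_mul]; congr 1
  rw [e, Real.norm_of_nonneg (sq_nonneg _)] at hy
  calc _ ≤ Real.sqrt (C * (y o ^ (-(m + 1 : ℤ))) ^ 2) :=
        Real.sqrt_le_sqrt ((le_abs_self _).trans hy)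
    _ = _ := by rw [Real.sqrt_mul hC0, Real.sqrt_sq hpos]

/-- The squared g-norm differs from the sum of squares of the frame components by O(r⁻³ᵐ), and 3m ≥
2m + 2. The Cauchy–Schwarz inequality then makes the trace O(r⁻ᵐ⁻¹); comparing with m M r⁻ᵐ leaves M
= O(r⁻¹). -/
theorem mass_eq_zero_of_isBigO
    (hT : (fun y => tensorNorm (g y) (einsteinDefect m g y)) =O[endBox o B]
      fun y => y o ^ (-(m + 1 : ℤ))) :
    (fun y => c o o y + ∑ a ∈ Finset.univ.erase o, c a a y) =O[endBox o B]
      fun y => (y o)⁻¹ := by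
  set X := fun y => frameMatrix o (einsteinDefect m g) y
  have hD := H.symbol_defect hm hm2 hE
  have hinv : ∀ i j, IsSymbol o B 0 0 fun y => (frameMatrix o g y)⁻¹ i j := fun i j =>
    (H.symbol_inv (by omega) i j).zero
  have hsub : ∀ i j, IsSymbol o B 0 m fun y => (frameMatrix o g y)⁻¹ i j -
      (1 : Matrix ι ι ℝ) i j := fun i j => (H.symbol_inv_sub (by omega) i j).zero
  have hdiff : ∀ i j k l, IsSymbol o B 0 m fun y => (frameMatrix o g y)⁻¹ i k *
      (frameMatrix o g y)⁻¹ j l - (1 : Matrix ι ι ℝ) i k * (1 : Matrix ι ι ℝ) j l := by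
    intro i j k l
    have h1 := ((hsub i k).mul (hinv j l)).mono (q := m) (by omega)
    have h2 := (hsub j l).const_mul ((1 : Matrix ι ι ℝ) i k)
    exact (h1.add h2).congr (Eventually.of_forall fun y => by ring)
  have h2 : IsSymbol o B 0 (m + m + m) _ :=
    IsSymbol.sum (s := Finset.univ) fun i _ => IsSymbol.sum (s := Finset.univ) fun j _ =>
    IsSymbol.sum (s := Finset.univ) fun k _ => IsSymbol.sum (s := Finset.univ) fun l _ =>
      ((hdiff i j k l).mul (hD i j)).mul (hD k l)
  obtain ⟨C, hC0, hC⟩ := (h2.mono (q := 2 * m + 2) (by omega)).isBigO.exists_nonneg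
  obtain ⟨C', hC0', hC'⟩ := hT.exists_nonneg
  have htr : (fun y => ∑ i, X y i i) =O[endBox o B] fun y => y o ^ (-(m + 1 : ℤ)) := by
    refine IsBigO.of_bound (Real.sqrt (Fintype.card ι * (C + C' ^ 2))) ?_
    filter_upwards [hC.bound, hC'.bound, (sum_tensorNorm_eq (o := o) (g := g)
      (einsteinDefect m g)).filter_mono endBox_le, (eventually_gt_atEnd 0).filter_mono endBox_le]
      with y hy hy' hs h0
    have hpos : 0 ≤ y o ^ (-(m + 1 : ℤ)) := (zpow_pos h0 _).le
    have e : y o ^ (-(2 * m + 2 : ℤ)) = (y o ^ (-(m + 1 : ℤ))) ^ 2 := by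
      rw [← zpow_natCast, ← zpow_mul]; congr 1; push_cast; ring
    rw [e, Real.norm_of_nonneg (sq_nonneg _)] at hy
    rw [tensorNorm, hs, Real.norm_of_nonneg (Real.sqrt_nonneg _), Real.norm_of_nonneg hpos] at hy'
    set N := ∑ i, ∑ j, ∑ k, ∑ l, (frameMatrix o g y)⁻¹ i k * (frameMatrix o g y)⁻¹ j l *
      frameMatrix o (einsteinDefect m g) y i j * frameMatrix o (einsteinDefect m g) y k l with hN
    have hN2 : N ≤ C' ^ 2 * (y o ^ (-(m + 1 : ℤ))) ^ 2 := by
      -- `Real.sqrt` is 0 on negative numbers, so this holds without knowing that N ≥ 0.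
      have h3 : N ≤ Real.sqrt N ^ 2 := by
        rcases le_total 0 N with h | h
        · rw [Real.sq_sqrt h]
        · exact h.trans (sq_nonneg _)
      have h4 := pow_le_pow_left₀ (Real.sqrt_nonneg N) hy' 2
      rw [mul_pow] at h4
      exact h3.trans h4
    have hsq : ∑ i, ∑ j, X y i j ^ 2 ≤ (C + C' ^ 2) * (y o ^ (-(m + 1 : ℤ))) ^ 2 := by
      have h5 : ∑ i, ∑ j, ∑ k, ∑ l, ((frameMatrix o g y)⁻¹ i k * (frameMatrix o g y)⁻¹ j l -
          (1 : Matrix ι ι ℝ) i k * (1 : Matrix ι ι ℝ) j l) *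
          frameMatrix o (einsteinDefect m g) y i j * frameMatrix o (einsteinDefect m g) y k l =
          N - ∑ i, ∑ j, X y i j ^ 2 := by
        rw [hN, ← Finset.sum_sub_distrib]
        refine Finset.sum_congr rfl fun i _ => ?_
        rw [← Finset.sum_sub_distrib]
        refine Finset.sum_congr rfl fun j _ => ?_
        simp only [sub_mul, Finset.sum_sub_distrib]
        congr 1
        simp only [Matrix.one_apply, ite_mul, mul_ite, mul_one, one_mul, mul_zero, zero_mul,
          Finset.sum_ite_eq, Finset.mem_univ, if_true]
        simp [X, sq]
      rw [h5, Real.norm_eq_abs] at hy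
      have := (abs_le.1 hy).1
      linarith
    have hcs : (∑ i, X y i i) ^ 2 ≤ Fintype.card ι * ∑ i, ∑ j, X y i j ^ 2 := by
      have h6 := sq_sum_le_card_mul_sum_sq (s := Finset.univ) (f := fun i => X y i i)
      refine h6.trans (mul_le_mul_of_nonneg_left (Finset.sum_le_sum fun i _ => ?_)
        (Nat.cast_nonneg _))
      exact Finset.single_le_sum (f := fun j => X y i j ^ 2) (fun j _ => sq_nonneg _)
        (Finset.mem_univ i)
    rw [Real.norm_eq_abs, Real.norm_of_nonneg hpos, ← Real.sqrt_sq_eq_abs]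
    calc _ ≤ Real.sqrt (Fintype.card ι * (C + C' ^ 2) * (y o ^ (-(m + 1 : ℤ))) ^ 2) := by
          refine Real.sqrt_le_sqrt (hcs.trans ?_)
          rw [mul_assoc]
          exact mul_le_mul_of_nonneg_left hsq (Nat.cast_nonneg _)
      _ = _ := by rw [Real.sqrt_mul (by positivity), Real.sqrt_sq hpos]
  have h1 := ((H.expansion_defect_trace hm hm2 hE).2.mono (q := m + 1) (by omega)).isBigO
  have h3 := htr.sub h1
  have h4 := (h3.mul (isSymbol_pow (o := o) (B := B) (k := 0) m).isBigO).const_mul_left (m : ℝ)⁻¹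
  refine h4.congr' ?_ ?_
  · filter_upwards [(eventually_gt_atEnd 0).filter_mono endBox_le] with y h0
    have hr : y o ^ m ≠ 0 := (pow_pos h0 m).ne'
    have hm0 : (m : ℝ) ≠ 0 := by positivity
    simp only [X, zpow_neg, zpow_natCast]
    field_simp
    ring
  · filter_upwards [(eventually_gt_atEnd 0).filter_mono endBox_le] with y h0
    rw [← zpow_add₀ h0.ne', ← zpow_neg_one]
    congr 1; ring

end IsAsymptoticallyHyperbolic

end EinsteinDefect

/-! ### Products and inverses of expansions around 1. -/

section Expansions

variable {ι : Type} [Fintype ι] [DecidableEq ι] {o : ι} {B : ℝ} {k m : ℕ}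
  {f g c d c' d' : (ι → ℝ) → ℝ}

/-- fg - 1 = (f - 1) + (g - 1) + (f - 1)(g - 1), and the last product has order 2m ≥ m + 2. -/
theorem HasExpansion.mul_sub_one (hm : 2 ≤ m) (hf : HasExpansion o B k m (fun y => f y - 1) c d)
    (hg : HasExpansion o B k m (fun y => g y - 1) c' d') :
    HasExpansion o B k m (fun y => f y * g y - 1) (fun y => c y + c' y) (fun y => d y + d' y) := by
  have h := HasExpansion.of_isSymbol ((hf.isSymbol.mul hg.isSymbol).mono (q := m + 2) (by omega))
  exact (((hf.add hg).add h).congr (Eventually.of_forall fun y => by ring)).congr_coeff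
    (fun y => by ring) (fun y => by ring)

/-- 1/f - 1 = -(f - 1) + (f - 1)²/f, where 1/f is bounded and the square has order 2m ≥ m + 2. -/
theorem HasExpansion.inv_sub_one (hm : 2 ≤ m) (hf : HasExpansion o B k m (fun y => f y - 1) c d)
    (h0 : ∀ᶠ y in atEnd o, f y ≠ 0) :
    HasExpansion o B k m (fun y => (f y)⁻¹ - 1) (fun y => -1 * c y) (fun y => -1 * d y) := by
  have hlim : Tendsto f (endBox o B) (𝓝 1) := by
    simpa using (hf.isSymbol.tendsto_zero (by omega)).add_const 1
  have hf0 : IsSymbol o B k 0 f :=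
    ((hf.isSymbol.mono (q := 0) (by omega)).add (isSymbol_const 1)).congr
      (Eventually.of_forall fun y => by ring)
  have hinv := hf0.inv h0 ((hlim.inv₀ one_ne_zero).isBigO_one ℝ)
  have h := HasExpansion.of_isSymbol (((hf.isSymbol.mul hf.isSymbol).mul hinv).mono
    (q := m + 2) (by omega))
  refine (((hf.const_mul (-1)).add h).congr ?_).congr_coeff (fun y => by ring) (fun y => by ring)
  filter_upwards [h0] with y hy
  field_simp
  ring

theorem pd_eq_zero_of_update {y : ι → ℝ} {i : ι} (hf : ContDiffAt ℝ ∞ f y)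
    (h : ∀ t, f (Function.update y i t) = f y) : pd i f y = 0 := by
  have h1 : HasDerivAt (fun t => f (Function.update y i t)) (fderiv ℝ f y (Pi.single i 1)) (y i) := by
    have hc1 : HasFDerivAt f (fderiv ℝ f y) (Function.update y i (y i)) := by
      rw [Function.update_eq_self]
      exact (smooth_differentiableAt hf).hasFDerivAt
    exact hc1.comp_hasDerivAt _ (hasDerivAt_update y i (y i))
  simp only [h] at h1
  exact h1.unique (hasDerivAt_const _ _)

end Expansions

/-! ### Expansion of the given metric in polar coordinates. -/

section PolarExpansion

variable {n : ℕ}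

/-- The radial index. -/
abbrev radial (n : ℕ) : Idx n := Sum.inl 0

theorem isSymbol_of_isOType {N : ℕ} {f : (Idx n → ℝ) → ℝ} (hf : IsOType N f) (B : ℝ) :
    IsSymbol (radial n) B 2 N f := by
  obtain ⟨⟨ρ, hρ⟩, hb⟩ := hf
  have hs : ∀ᶠ y in atEnd (radial n), ContDiffAt ℝ ∞ f y := by
    refine eventually_atEnd.2 ⟨ρ, fun y hy => hρ.contDiffAt ?_⟩
    exact (isOpen_lt continuous_const (continuous_apply (radial n))).mem_nhds hy
  have big : ∀ (F : (Idx n → ℝ) → ℝ) (M : ℕ), (∃ C ρ : ℝ, ∀ y : Idx n → ℝ, ρ < y (radial n) →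
      |F y| ≤ C / y (radial n) ^ M) → F =O[endBox (radial n) B] fun y => y (radial n) ^ (-M : ℤ) := by
    rintro F M ⟨C, ρ, h⟩
    refine IsBigO.of_bound C ?_
    filter_upwards [(eventually_gt_atEnd ρ).filter_mono endBox_le,
      (eventually_gt_atEnd 0).filter_mono endBox_le] with y hy h0
    rw [Real.norm_of_nonneg (zpow_pos h0 _).le, zpow_neg, zpow_natCast, ← div_eq_mul_inv]
    exact h y hy
  have hsp : ∀ i, ∀ᶠ y in atEnd (radial n), ContDiffAt ℝ ∞ (pd i f) y := fun i =>
    hs.mono fun y hy => ContDiffAt.pd hy i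
  have hspp : ∀ i j, ∀ᶠ y in atEnd (radial n), ContDiffAt ℝ ∞ (pd j (pd i f)) y := fun i j =>
    (hsp i).mono fun y hy => ContDiffAt.pd hy j
  refine ⟨⟨hs, by simpa using big _ N (by simpa using hb 0 [] (by simp) (by simp))⟩, fun i => ?_⟩
  by_cases hi : i = radial n
  · subst hi
    refine ⟨⟨hsp _, ?_⟩, fun j => ?_⟩
    · simpa using big _ (N + 1) (by simpa using hb 1 [] (by simp) (by simp))
    · by_cases hj : j = radial n
      · subst hj
        refine ⟨hspp _ _, ?_⟩
        have := big _ (N + 2) (by simpa using hb 2 [] (by simp) (by simp))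
        refine this.congr' EventuallyEq.rfl (Eventually.of_forall fun y => ?_)
        simp only [if_true]; push_cast; congr 2
      · refine ⟨hspp _ _, ?_⟩
        have := big _ (N + 1) (by simpa using hb 1 [j] (by simpa using hj) (by simp))
        refine this.congr' ?_ (Eventually.of_forall fun y => ?_)
        -- `IsOType` controls derivatives in which the radial ones are taken last, so the order has
        -- to be exchanged in this case.
        · filter_upwards [hs.filter_mono endBox_le] with y hy using pd_comm _ _ hy
        · simp only [if_true, if_neg hj]; push_cast; congr 2
  · refine ⟨⟨hsp _, ?_⟩, fun j => ?_⟩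
    · simpa [hi] using big _ N (by simpa using hb 0 [i] (by simpa using hi) (by simp))
    · by_cases hj : j = radial n
      · subst hj
        refine ⟨hspp _ _, ?_⟩
        have := big _ (N + 1) (by simpa using hb 1 [i] (by simpa using hi) (by simp))
        refine this.congr' EventuallyEq.rfl (Eventually.of_forall fun y => ?_)
        simp only [if_true, if_neg hi]; push_cast; congr 2
      · refine ⟨hspp _ _, ?_⟩
        have := big _ N (by simpa using hb 0 [j, i] (by simp [hi, hj]) (by simp))
        simpa [hi, hj] using this

theorem potential_tendsto (hn : 3 ≤ n) (a r₀ : ℝ) :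
    Tendsto (potential n a r₀) atTop (𝓝 1) := by
  have h1 : Tendsto (fun r : ℝ => a / r ^ (n - 1)) atTop (𝓝 0) :=
    tendsto_const_nhds.div_atTop (tendsto_pow_atTop (by omega))
  have h2 : Tendsto (fun r : ℝ => r₀ ^ n / r ^ n) atTop (𝓝 0) :=
    tendsto_const_nhds.div_atTop (tendsto_pow_atTop (by omega))
  have h3 := (h1.const_add 1).sub h2
  have e : potential n a r₀ = fun x => 1 + a / x ^ (n - 1) - r₀ ^ n / x ^ n := rfl
  rw [e]
  simpa using h3

theorem potential_pos_eventually (hn : 3 ≤ n) (a r₀ : ℝ) :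
    ∀ᶠ y : Idx n → ℝ in atEnd (radial n), 0 < potential n a r₀ (y (radial n)) :=
  tendsto_atEnd.eventually ((potential_tendsto hn a r₀).eventually (lt_mem_nhds one_pos))

theorem potential_expansion (hn : 3 ≤ n) (a r₀ : ℝ) (B : ℝ) (k : ℕ) :
    HasExpansion (radial n) B k (n - 1) (fun y => potential n a r₀ (y (radial n)) - 1)
      (fun _ => a) (fun _ => -r₀ ^ n) := by
  refine ⟨⟨isAngular_const _, isAngular_const _⟩, isSymbol_zero.congr
    (Eventually.of_forall fun y => ?_)⟩
  have e : (-((n - 1 : ℕ) + 1 : ℤ)) = -(n : ℤ) := by omega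
  rw [e]
  simp only [potential, zpow_neg, zpow_natCast]
  ring

theorem expansion_of_isOType (hn : 3 ≤ n) {f c d : (Idx n → ℝ) → ℝ}
    (hf : IsOType (n + 1) fun y => f y - (c y / y (radial n) ^ (n - 1) + d y / y (radial n) ^ n))
    (hc : IsAngular (radial n) c) (hd : IsAngular (radial n) d) (B : ℝ) :
    HasExpansion (radial n) B 2 (n - 1) f c d := by
  refine ⟨⟨hc, hd⟩, ((isSymbol_of_isOType hf B).mono (by push_cast; omega)).congr
    (Eventually.of_forall fun y => ?_)⟩
  have e : (-((n - 1 : ℕ) + 1 : ℤ)) = -(n : ℤ) := by omega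
  simp only [e, zpow_neg, zpow_natCast, div_eq_mul_inv]

theorem exp_two_radial {r f u : ℝ} (hr : 0 < r) (hf : 0 < f) :
    Real.exp (2 * (-Real.log r - (1 / 2) * Real.log f + u)) =
      (r ^ 2)⁻¹ * (f⁻¹ * (Real.exp u * Real.exp u)) := by
  have : 2 * (-Real.log r - (1 / 2) * Real.log f + u) =
      -(Real.log r + Real.log r) + (-Real.log f + (u + u)) := by ring
  rw [this, Real.exp_add, Real.exp_add, Real.exp_add, Real.exp_neg, Real.exp_neg, Real.exp_add,
    Real.exp_log hr, Real.exp_log hf, sq]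

theorem exp_two_angular {r f v : ℝ} (hr : 0 < r) (hf : 0 < f) :
    Real.exp (2 * (Real.log r + (1 / 2) * Real.log f + v)) =
      r ^ 2 * (f * (Real.exp v * Real.exp v)) := by
  have : 2 * (Real.log r + (1 / 2) * Real.log f + v) =
      (Real.log r + Real.log r) + (Real.log f + (v + v)) := by ring
  rw [this, Real.exp_add, Real.exp_add, Real.exp_add, Real.exp_add,
    Real.exp_log hr, Real.exp_log hf, sq]

variable {a r₀ rp : ℝ} {uhat : ℝ → ℝ} {vhat : ℝ → ℝ → ℝ}
    {what : ℝ → ℝ → (Fin (n - 2) → ℝ) → Matrix (Fin (n - 2)) (Fin (n - 2)) ℝ}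
    {g : (Idx n → ℝ) → Matrix (Idx n) (Idx n) ℝ}

theorem polar_oo (hn : 3 ≤ n)
    (hform : ∀ y : Idx n → ℝ, rp < y (Sum.inl 0) → g y = polarMetric n a r₀ uhat vhat what y) :
    ∀ᶠ y in atEnd (radial n), g y (Sum.inl 0) (Sum.inl 0) = (y (radial n) ^ 2)⁻¹ *
      ((potential n a r₀ (y (radial n)))⁻¹ *
      (Real.exp (uhat (y (radial n))) * Real.exp (uhat (y (radial n))))) := by
  filter_upwards [eventually_gt_atEnd rp, eventually_gt_atEnd 0, potential_pos_eventually hn a r₀]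
    with y hy h0 hp
  rw [hform y hy, ← exp_two_radial h0 hp]
  simp [polarMetric]

theorem isAngular_vector {n : ℕ} {w : ℝ → (Fin (n - 2) → ℝ) → ℝ}
    (hw : ContDiff ℝ ∞ fun p : ℝ × (Fin (n - 2) → ℝ) => w p.1 p.2) :
    IsAngular (radial n) fun y => w (y (Sum.inl 1)) (fun k => y (Sum.inr k)) := by
  refine ⟨hw.comp (f := fun y : Idx n → ℝ => (y (Sum.inl 1), fun k => y (Sum.inr k)))
    (by fun_prop), fun y t => by simp⟩

/-- Leading coefficients: -a + 2u₁ for dr², a + 2v₁ for dξ², and 2w₁ on the torus, so that a drops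
out of the trace. They are fixed before `B`; only the error constants depend on the size of the box.
-/
theorem polar_deviation_expansion (hn : 3 ≤ n)
    (hform : ∀ y : Idx n → ℝ, rp < y (Sum.inl 0) → g y = polarMetric n a r₀ uhat vhat what y)
    {u₁ u₂ : ℝ} {v₁ v₂ : ℝ → ℝ}
    {w₁ w₂ : ℝ → (Fin (n - 2) → ℝ) → Matrix (Fin (n - 2)) (Fin (n - 2)) ℝ}
    (hv₁ : ContDiff ℝ ∞ v₁) (hv₂ : ContDiff ℝ ∞ v₂)
    (hw₁ : ∀ i j, ContDiff ℝ ∞ fun p : ℝ × (Fin (n - 2) → ℝ) => w₁ p.1 p.2 i j)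
    (hw₂ : ∀ i j, ContDiff ℝ ∞ fun p : ℝ × (Fin (n - 2) → ℝ) => w₂ p.1 p.2 i j)
    (hu : IsOType (n := n) (n + 1) fun y => Real.exp (uhat (y (Sum.inl 0))) -
        (1 + u₁ / y (Sum.inl 0) ^ (n - 1) + u₂ / y (Sum.inl 0) ^ n))
    (hv : IsOType (n := n) (n + 1) fun y => Real.exp (vhat (y (Sum.inl 0)) (y (Sum.inl 1))) -
        (1 + v₁ (y (Sum.inl 1)) / y (Sum.inl 0) ^ (n - 1) +
          v₂ (y (Sum.inl 1)) / y (Sum.inl 0) ^ n))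
    (hw : ∀ i j, IsOType (n := n) (n + 1) fun y =>
      what (y (Sum.inl 0)) (y (Sum.inl 1)) (fun k => y (Sum.inr k)) i j -
        (2 * w₁ (y (Sum.inl 1)) (fun k => y (Sum.inr k)) i j / y (Sum.inl 0) ^ (n - 1) +
          2 * w₂ (y (Sum.inl 1)) (fun k => y (Sum.inr k)) i j / y (Sum.inl 0) ^ n)) :
    ∃ c d : Idx n → Idx n → (Idx n → ℝ) → ℝ, ∀ B i j, HasExpansion (radial n) B 2 (n - 1)
      (IsAsymptoticallyHyperbolic.deviation (radial n) g i j) (c i j) (d i j) := by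
  have hm : 2 ≤ n - 1 := by omega
  have hpot := fun B => potential_expansion hn a r₀ B 2
  have hpos := potential_pos_eventually hn a r₀
  have hξ : ∀ {φ : ℝ → ℝ}, ContDiff ℝ ∞ φ → IsAngular (radial n) fun y => φ (y (Sum.inl 1)) :=
    fun hφ => ⟨hφ.comp (contDiff_apply ℝ ℝ _), fun y t => by simp⟩
  have hU : ∀ B, HasExpansion (radial n) B 2 (n - 1) (fun y => Real.exp (uhat (y (radial n))) - 1)
      (fun _ => u₁) (fun _ => u₂) := fun B => expansion_of_isOType hn
    (by convert hu using 2 with y; ring) (isAngular_const _) (isAngular_const _) B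
  have hV : ∀ B, HasExpansion (radial n) B 2 (n - 1)
      (fun y => Real.exp (vhat (y (radial n)) (y (Sum.inl 1))) - 1)
      (fun y => v₁ (y (Sum.inl 1))) (fun y => v₂ (y (Sum.inl 1))) := fun B =>
    expansion_of_isOType hn (by convert hv using 2 with y; ring) (hξ hv₁) (hξ hv₂) B
  have hW : ∀ B i j, HasExpansion (radial n) B 2 (n - 1)
      (fun y => what (y (Sum.inl 0)) (y (Sum.inl 1)) (fun k => y (Sum.inr k)) i j)
      (fun y => 2 * w₁ (y (Sum.inl 1)) (fun k => y (Sum.inr k)) i j)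
      (fun y => 2 * w₂ (y (Sum.inl 1)) (fun k => y (Sum.inr k)) i j) := fun B i j =>
    expansion_of_isOType hn (hw i j) ((isAngular_vector (w := fun x p => w₁ x p i j) (hw₁ i j)).const_mul 2)
      ((isAngular_vector (w := fun x p => w₂ x p i j) (hw₂ i j)).const_mul 2) B
  have hzero : ∀ i j : Idx n, i ≠ j → (∀ᶠ y in atEnd (radial n), g y i j = 0) → ∀ B,
      HasExpansion (radial n) B 2 (n - 1)
      (IsAsymptoticallyHyperbolic.deviation (radial n) g i j) (fun _ => 0) (fun _ => 0) := by
    intro i j hij h B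
    refine HasExpansion.of_isSymbol (isSymbol_zero.congr ?_)
    filter_upwards [h] with y hy
    simp [IsAsymptoticallyHyperbolic.deviation, frameMatrix, hy, hij]
  suffices h : ∀ i j, ∃ c d : (Idx n → ℝ) → ℝ, ∀ B, HasExpansion (radial n) B 2 (n - 1)
      (IsAsymptoticallyHyperbolic.deviation (radial n) g i j) c d by
    choose c d h using h
    exact ⟨c, d, fun B i j => h i j B⟩
  rintro (i | i) (j | j)
  · by_cases hij : i = j
    · subst hij
      fin_cases i
      · refine ⟨_, _, fun B => (((hpot B).inv_sub_one hm (hpos.mono fun y hy => hy.ne')).mul_sub_one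
          hm ((hU B).mul_sub_one hm (hU B))).congr ?_⟩
        filter_upwards [polar_oo hn hform, eventually_gt_atEnd 0] with y hg h0
        have hr := h0.ne'
        simp [IsAsymptoticallyHyperbolic.deviation, frameMatrix, frameWeight, hg]
        field_simp
      · refine ⟨_, _, fun B => ((hpot B).mul_sub_one hm ((hV B).mul_sub_one hm (hV B))).congr ?_⟩
        filter_upwards [eventually_gt_atEnd rp, eventually_gt_atEnd 0, hpos] with y hy h0 hp
        have hr := h0.ne'
        simp [IsAsymptoticallyHyperbolic.deviation, frameMatrix, frameWeight, hform y hy,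
          polarMetric]
        have hE := exp_two_angular (v := vhat (y (Sum.inl 0)) (y (Sum.inl 1))) h0 hp
        rw [one_div] at hE
        rw [hE]
        field_simp
    · refine ⟨_, _, hzero _ _ (by simpa using hij) ?_⟩
      filter_upwards [eventually_gt_atEnd rp] with y hy
      simp [hform y hy, polarMetric, hij]
  · refine ⟨_, _, hzero _ _ (by simp) ?_⟩
    filter_upwards [eventually_gt_atEnd rp] with y hy
    simp [hform y hy, polarMetric]
  · refine ⟨_, _, hzero _ _ (by simp) ?_⟩
    filter_upwards [eventually_gt_atEnd rp] with y hy
    simp [hform y hy, polarMetric]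
  · refine ⟨_, _, fun B => (hW B i j).congr ?_⟩
    filter_upwards [eventually_gt_atEnd rp, eventually_gt_atEnd 0] with y hy h0
    have hr := h0.ne'
    have hone : (1 : Matrix (Idx n) (Idx n) ℝ) (Sum.inr i) (Sum.inr j) =
      (1 : Matrix (Fin (n - 2)) (Fin (n - 2)) ℝ) i j := by simp [Matrix.one_apply]
    simp [IsAsymptoticallyHyperbolic.deviation, frameMatrix, frameWeight, hform y hy,
      polarMetric, hone]
    field_simp
    ring

theorem polar_isAsymptoticallyHyperbolic (hn : 3 ≤ n)
    (hform : ∀ y : Idx n → ℝ, rp < y (Sum.inl 0) → g y = polarMetric n a r₀ uhat vhat what y)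
    (hsymm : ∀ y, (g y).IsSymm) (hdet : ∀ y : Idx n → ℝ, rp < y (Sum.inl 0) → (g y).det ≠ 0)
    {B : ℝ} {c d : Idx n → Idx n → (Idx n → ℝ) → ℝ}
    (hE : ∀ i j, HasExpansion (radial n) B 2 (n - 1)
      (IsAsymptoticallyHyperbolic.deviation (radial n) g i j) (c i j) (d i j)) :
    IsAsymptoticallyHyperbolic (radial n) B (n - 1) g := by
  refine ⟨Eventually.of_forall hsymm, (eventually_gt_atEnd rp).mono hdet, ?_, ?_,
    fun i j => (hE i j).isSymbol⟩
  · filter_upwards [eventually_gt_atEnd rp] with y hy a ha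
    rw [hform y hy]
    rcases a with a | a
    · have ha' : a ≠ 0 := fun h => ha (by rw [h])
      simp [polarMetric, Ne.symm ha']
    · simp [polarMetric]
  · have hs : ∀ᶠ y in atEnd (radial n), ContDiffAt ℝ ∞ (fun z => g z (Sum.inl 0) (Sum.inl 0)) y := by
      have h1 := ((isSymbol_inv_pow (o := radial n) (B := B) (k := 2) 2).mul
        ((isSymbol_const 1).add ((hE (radial n) (radial n)).isSymbol.mono (q := 0) (by omega)))).congr
        ((IsAsymptoticallyHyperbolic.metric_oo (o := radial n) (g := g)).mono fun y hy => hy.symm)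
      exact h1.smooth
    obtain ⟨ρ, hρ⟩ := eventually_atEnd.1 (polar_oo hn hform)
    filter_upwards [hs, eventually_gt_atEnd ρ] with y hy hy' a ha
    refine pd_eq_zero_of_update hy fun t => ?_
    have e : Function.update y a t (radial n) = y (radial n) := by
      rw [Function.update_of_ne (Ne.symm ha)]
    rw [hρ y hy', hρ (Function.update y a t) (by rw [e]; exact hy'), e]

end PolarExpansion

/-! ### The polar coordinate map. -/

section PolarMap

variable {n : ℕ} {rp β : ℝ}

theorem radius_polarMap {y : Idx n → ℝ} (hy : rp ≤ y (Sum.inl 0)) :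
    radius rp (polarMap rp β y) = y (Sum.inl 0) := by
  have h1 : Real.sqrt (y (Sum.inl 0) - rp) ^ 2 = y (Sum.inl 0) - rp :=
    Real.sq_sqrt (by linarith)
  have h2 := Real.sin_sq_add_cos_sq (2 * Real.pi * y (Sum.inl 1) / β)
  simp only [radius, polarMap, Sum.elim_inl, Matrix.cons_val_zero, Matrix.cons_val_one, mul_pow, h1]
  linear_combination (y (Sum.inl 0) - rp) * h2

theorem contDiffAt_radialSqrt {y : Idx n → ℝ} (hy : rp < y (Sum.inl 0)) :
    ContDiffAt ℝ ∞ (fun z : Idx n → ℝ => Real.sqrt (z (Sum.inl 0) - rp)) y :=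
  ((contDiffAt_coord _ y).sub contDiffAt_const).sqrt (by linarith)

theorem contDiffAt_angle (y : Idx n → ℝ) :
    ContDiffAt ℝ ∞ (fun z : Idx n → ℝ => 2 * Real.pi * z (Sum.inl 1) / β) y :=
  (contDiffAt_const.mul (contDiffAt_coord _ y)).div_const _

theorem contDiffAt_polarMap {y : Idx n → ℝ} (hy : rp < y (Sum.inl 0)) :
    ContDiffAt ℝ ∞ (polarMap (n := n) rp β) y := by
  rw [contDiffAt_pi]
  rintro (i | i)
  · fin_cases i
    · exact (contDiffAt_radialSqrt hy).mul (Real.contDiff_cos.contDiffAt.comp y (contDiffAt_angle y))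
    · exact (contDiffAt_radialSqrt hy).mul (Real.contDiff_sin.contDiffAt.comp y (contDiffAt_angle y))
  · exact contDiffAt_coord _ y

/-- With s = √(r - r₊) and θ = 2πξ/β, s ds dθ = (π/β) dr dξ: taking the square root as Cartesian
distance makes the Jacobian determinant constant. -/
theorem det_jacobian_polarMap {y : Idx n → ℝ} (hy : rp < y (Sum.inl 0)) :
    (jacobian (polarMap (n := n) rp β) y).det = Real.pi / β := by
  set s := Real.sqrt (y (Sum.inl 0) - rp) with hs
  have hs0 : s ≠ 0 := (Real.sqrt_pos.2 (by linarith)).ne'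
  set θ := 2 * Real.pi * y (Sum.inl 1) / β with hθ
  have hds : ∀ i, pd i (fun z : Idx n → ℝ => Real.sqrt (z (Sum.inl 0) - rp)) y =
      if i = Sum.inl 0 then 1 / (2 * s) else 0 := by
    intro i
    have hd : HasDerivAt (fun t : ℝ => Real.sqrt (t - rp)) (1 / (2 * s)) (y (Sum.inl 0)) :=
      ((hasDerivAt_id _).sub_const rp).sqrt (by simp only [id]; linarith)
    exact pd_comp_coord hd i
  have hdθ : HasDerivAt (fun t : ℝ => 2 * Real.pi * t / β) (2 * Real.pi / β) (y (Sum.inl 1)) := by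
    simpa using ((hasDerivAt_id (y (Sum.inl 1))).const_mul (2 * Real.pi)).div_const β
  have hdc : ∀ i, pd i (fun z : Idx n → ℝ => Real.cos (2 * Real.pi * z (Sum.inl 1) / β)) y =
      if i = Sum.inl 1 then -Real.sin θ * (2 * Real.pi / β) else 0 :=
    fun i => pd_comp_coord hdθ.cos i
  have hdn : ∀ i, pd i (fun z : Idx n → ℝ => Real.sin (2 * Real.pi * z (Sum.inl 1) / β)) y =
      if i = Sum.inl 1 then Real.cos θ * (2 * Real.pi / β) else 0 :=
    fun i => pd_comp_coord hdθ.sin i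
  have hcs : ContDiffAt ℝ ∞ (fun z : Idx n → ℝ => Real.cos (2 * Real.pi * z (Sum.inl 1) / β)) y :=
    Real.contDiff_cos.contDiffAt.comp y (contDiffAt_angle y)
  have hsn : ContDiffAt ℝ ∞ (fun z : Idx n → ℝ => Real.sin (2 * Real.pi * z (Sum.inl 1) / β)) y :=
    Real.contDiff_sin.contDiffAt.comp y (contDiffAt_angle y)
  have h0 : ∀ i, jacobian (polarMap (n := n) rp β) y (Sum.inl 0) i =
      (if i = Sum.inl 0 then 1 / (2 * s) else 0) * Real.cos θ +
      s * (if i = Sum.inl 1 then -Real.sin θ * (2 * Real.pi / β) else 0) := by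
    intro i
    rw [← hds, ← hdc]
    exact pd_mul i (contDiffAt_radialSqrt hy) hcs
  have h1 : ∀ i, jacobian (polarMap (n := n) rp β) y (Sum.inl 1) i =
      (if i = Sum.inl 0 then 1 / (2 * s) else 0) * Real.sin θ +
      s * (if i = Sum.inl 1 then Real.cos θ * (2 * Real.pi / β) else 0) := by
    intro i
    rw [← hds, ← hdn]
    exact pd_mul i (contDiffAt_radialSqrt hy) hsn
  have h2 : ∀ j i, jacobian (polarMap (n := n) rp β) y (Sum.inr j) i =
      if i = Sum.inr j then 1 else 0 := fun j i => pd_coord i _ y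
  have hblock : jacobian (polarMap (n := n) rp β) y = Matrix.fromBlocks
      !![1 / (2 * s) * Real.cos θ, s * (-Real.sin θ * (2 * Real.pi / β));
        1 / (2 * s) * Real.sin θ, s * (Real.cos θ * (2 * Real.pi / β))] 0 0 1 := by
    ext i j
    rcases i with i | i
    · fin_cases i <;> rcases j with j | j
      · fin_cases j <;> simp [h0]
      · simp [h0]
      · fin_cases j <;> simp [h1]
      · simp [h1]
    · rcases j with j | j
      · simp [h2]
      · simp [h2, Matrix.one_apply, eq_comm]
  rw [hblock, Matrix.det_fromBlocks_zero₂₁, Matrix.det_one, mul_one, Matrix.det_fin_two_of]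
  have h3 := Real.sin_sq_add_cos_sq θ
  rw [mul_div_assoc]
  generalize Real.pi / β = q
  field_simp
  linear_combination q * h3

/-- The angle is a rescaled principal argument, hence bounded. On the core torus the square root
vanishes and the angle is immaterial. -/
theorem polarMap_surj (rp : ℝ) (hβ : 0 < β) (z : Idx n → ℝ) :
    ∃ y : Idx n → ℝ, polarMap rp β y = z ∧ y (Sum.inl 0) = radius rp z ∧
      |y (Sum.inl 1)| ≤ β ∧ ∀ i, y (Sum.inr i) = z (Sum.inr i) := by
  set w : ℂ := ⟨z (Sum.inl 0), z (Sum.inl 1)⟩ with hw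
  refine ⟨Sum.elim ![radius rp z, β * w.arg / (2 * Real.pi)] fun i => z (Sum.inr i), ?_, rfl, ?_,
    fun i => rfl⟩
  · have hnorm : Real.sqrt (radius rp z - rp) = ‖w‖ := by
      rw [Complex.norm_def, Complex.normSq_apply]
      congr 1
      simp only [radius, hw]; ring
    have hang : 2 * Real.pi * (β * w.arg / (2 * Real.pi)) / β = w.arg := by
      have := Real.pi_pos
      field_simp
    funext i
    rcases i with i | i
    · fin_cases i
      · simp only [polarMap, Sum.elim_inl, Matrix.cons_val_zero, Matrix.cons_val_one, hnorm, hang]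
        exact Complex.norm_mul_cos_arg w
      · simp only [polarMap, Sum.elim_inl, Matrix.cons_val_zero, Matrix.cons_val_one, hnorm, hang]
        exact Complex.norm_mul_sin_arg w
    · rfl
  · simp only [Sum.elim_inl, Matrix.cons_val_one, Matrix.cons_val_zero]
    have := Real.pi_pos
    rw [abs_div, abs_mul, abs_of_pos hβ, abs_of_pos (by positivity : 0 < 2 * Real.pi),
      div_le_iff₀ (by positivity)]
    have h2 := Complex.abs_arg_le_pi w
    nlinarith

theorem polarMap_injOn (hβ : 0 < β) : Set.InjOn (polarMap (n := n) rp β)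
    {y | rp < y (Sum.inl 0) ∧ |y (Sum.inl 1)| < β / 2} := by
  intro y hy y' hy' h
  have hmem : ∀ {y : Idx n → ℝ}, rp < y (Sum.inl 0) ∧ |y (Sum.inl 1)| < β / 2 →
      (Real.sqrt (y (Sum.inl 0) - rp), 2 * Real.pi * y (Sum.inl 1) / β) ∈
        polarCoord.target := by
    intro y hy
    rw [polarCoord_target]
    have hpi := Real.pi_pos
    have h1 := abs_lt.1 hy.2
    refine ⟨Real.sqrt_pos.2 (by linarith [hy.1]), ?_, ?_⟩
    · simp only
      rw [lt_div_iff₀ hβ]; nlinarith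
    · simp only
      rw [div_lt_iff₀ hβ]; nlinarith
  have h0 := congrFun h (Sum.inl 0)
  have h1 := congrFun h (Sum.inl 1)
  have hinj := polarCoord.symm.injOn (hmem hy) (hmem hy') (by
    rw [polarCoord_symm_apply, polarCoord_symm_apply]
    exact Prod.ext h0 h1)
  have e1 := congrArg Prod.fst hinj
  have e2 := congrArg Prod.snd hinj
  simp only at e1 e2
  have e3 : y (Sum.inl 0) = y' (Sum.inl 0) := by
    have := (Real.sqrt_inj (by linarith [hy.1]) (by linarith [hy'.1])).1 e1
    linarith
  have e4 : y (Sum.inl 1) = y' (Sum.inl 1) := by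
    have hpi := Real.pi_pos
    field_simp at e2
    exact e2
  funext i
  rcases i with i | i
  · fin_cases i
    · exact e3
    · exact e4
  · exact congrFun h (Sum.inr i)

theorem eventually_contDiffAt_polarMap {y : Idx n → ℝ} (hy : rp < y (Sum.inl 0)) :
    ∀ᶠ z in 𝓝 y, ContDiffAt ℝ ∞ (polarMap (n := n) rp β) z := by
  filter_upwards [(isOpen_lt continuous_const (continuous_apply (radial n))).mem_nhds hy] with z hz
    using contDiffAt_polarMap hz

theorem eventually_det_jacobian_polarMap (hβ : 0 < β) {y : Idx n → ℝ} (hy : rp < y (Sum.inl 0)) :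
    ∀ᶠ z in 𝓝 y, (jacobian (polarMap (n := n) rp β) z).det ≠ 0 := by
  filter_upwards [(isOpen_lt continuous_const (continuous_apply (radial n))).mem_nhds hy] with z hz
  rw [det_jacobian_polarMap hz]
  exact (div_pos Real.pi_pos hβ).ne'

end PolarMap

/-! ### Curvature in polar coordinates, and deck transformations. -/

section Metric

variable {n : ℕ} {rp β : ℝ} {lam : Fin (n - 2) → ℝ} {G : (Idx n → ℝ) → Matrix (Idx n) (Idx n) ℝ}

theorem IsSmoothMetric.smoothAt (hG : IsSmoothMetric lam G) (z : Idx n → ℝ) :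
    SmoothMatrixAt G z := fun i j => (hG.smooth i j).contDiffAt

theorem IsSmoothMetric.isSymm (hG : IsSmoothMetric lam G) (z : Idx n → ℝ) : (G z).IsSymm := by
  have := (hG.posDef z).isHermitian
  rwa [Matrix.IsHermitian, Matrix.conjTranspose_eq_transpose_of_trivial] at this

theorem IsSmoothMetric.det_pos (hG : IsSmoothMetric lam G) (z : Idx n → ℝ) : 0 < (G z).det :=
  (hG.posDef z).det_pos

theorem IsSmoothMetric.pullback_isSymm (hG : IsSmoothMetric lam G) (Φ : (Idx n → ℝ) → (Idx n → ℝ))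
    (y : Idx n → ℝ) : (pullback Φ G y).IsSymm := by
  rw [Matrix.IsSymm, pullback_eq]
  simp only [Matrix.transpose_mul, Matrix.transpose_transpose, (hG.isSymm (Φ y)).eq,
    Matrix.mul_assoc]

theorem IsSmoothMetric.pullback_det {y : Idx n → ℝ}
    (hy : rp < y (Sum.inl 0)) : (pullback (polarMap rp β) G y).det =
      (Real.pi / β) ^ 2 * (G (polarMap rp β y)).det := by
  rw [pullback_eq, Matrix.det_mul, Matrix.det_mul, Matrix.det_transpose, det_jacobian_polarMap hy]
  ring

theorem IsSmoothMetric.scalarCurvature_polar (hG : IsSmoothMetric lam G) (hβ : 0 < β)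
    {y : Idx n → ℝ} (hy : rp < y (Sum.inl 0)) :
    scalarCurvature (pullback (polarMap rp β) G) y = scalarCurvature G (polarMap rp β y) :=
  scalarCurvature_pullback (eventually_contDiffAt_polarMap hy) hG.smoothAt hG.isSymm
    (fun z => (hG.det_pos z).ne') (eventually_det_jacobian_polarMap hβ hy)

theorem IsSmoothMetric.tensorNorm_polar (hG : IsSmoothMetric lam G) (hβ : 0 < β)
    {y : Idx n → ℝ} (hy : rp < y (Sum.inl 0)) (m : ℕ) :
    tensorNorm (pullback (polarMap rp β) G y) (einsteinDefect m (pullback (polarMap rp β) G) y) =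
      tensorNorm (G (polarMap rp β y)) (einsteinDefect m G (polarMap rp β y)) :=
  tensorNorm_ricci_pullback (eventually_contDiffAt_polarMap hy) hG.smoothAt hG.isSymm
    (fun z => (hG.det_pos z).ne') (eventually_det_jacobian_polarMap hβ hy) _

/-- Functions on `ℝ² × ℝⁿ⁻²` that descend to `ℝ² × 𝕋ⁿ⁻²`. -/
def IsTorusPeriodic {X : Type} (lam : Fin (n - 2) → ℝ) (F : (Idx n → ℝ) → X) : Prop :=
  ∀ (i : Fin (n - 2)) (z : Idx n → ℝ), F (z + Pi.single (Sum.inr i) (lam i)) = F z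

theorem IsTorusPeriodic.zsmul {X : Type} {F : (Idx n → ℝ) → X} (hF : IsTorusPeriodic lam F)
    (i : Fin (n - 2)) (k : ℤ) (z : Idx n → ℝ) :
    F (z + Pi.single (Sum.inr i) (k * lam i)) = F z := by
  have hp : Function.Periodic (fun t : ℝ => F (z + Pi.single (Sum.inr i) t)) (lam i) := by
    intro t
    simp only
    rw [Pi.single_add, ← add_assoc]
    exact hF i _
  have := hp.int_mul k 0
  simpa using this

/-- Every point can be moved into the fundamental domain by the deck transformations. -/
theorem IsTorusPeriodic.exists_fundamental {X : Type} {F : (Idx n → ℝ) → X}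
    (hF : IsTorusPeriodic lam F) (hlam : ∀ i, 0 < lam i) (z : Idx n → ℝ) :
    ∃ z' : Idx n → ℝ, z' ∈ fundamentalDomain lam ∧ (∀ i, z' (Sum.inl i) = z (Sum.inl i)) ∧
      F z' = F z := by
  have key : ∀ s : Finset (Fin (n - 2)), ∃ z' : Idx n → ℝ,
      (∀ i ∈ s, z' (Sum.inr i) ∈ Set.Ico 0 (lam i)) ∧ (∀ i, z' (Sum.inl i) = z (Sum.inl i)) ∧
      F z' = F z := by
    intro s
    induction s using Finset.induction_on with
    | empty => exact ⟨z, by simp, fun _ => rfl, rfl⟩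
    | insert a s ha ih =>
      obtain ⟨z', h1, h2, h3⟩ := ih
      obtain ⟨k, hk, -⟩ := existsUnique_add_zsmul_mem_Ico (hlam a) (z' (Sum.inr a)) 0
      refine ⟨z' + Pi.single (Sum.inr a) (k * lam a), ?_, ?_, ?_⟩
      · intro i hi
        by_cases h : i = a
        · subst h
          simpa using hk
        · have h' : i ∈ s := (Finset.mem_insert.1 hi).resolve_left h
          have e : (Sum.inr i : Idx n) ≠ Sum.inr a := fun h'' => h (Sum.inr_injective h'')
          simpa [e] using h1 i h'
      · intro i; simpa using h2 i
      · rw [hF.zsmul, h3]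
  obtain ⟨z', h1, h2, h3⟩ := key Finset.univ
  exact ⟨z', fun i => h1 i (Finset.mem_univ i), h2, h3⟩

theorem IsSmoothMetric.isTorusPeriodic_ricci (hG : IsSmoothMetric lam G) :
    IsTorusPeriodic lam fun z => (G z, ricci G z) := fun i z => by
  simp only
  rw [hG.periodic, ricci_translate]
  exact hG.periodic i

end Metric

/-! ### From bounded boxes in polar coordinates to uniform bounds at infinity. -/

section Transfer

variable {n : ℕ} {rp β : ℝ} {lam : Fin (n - 2) → ℝ}

theorem tendsto_polarMap (B : ℝ) :
    Tendsto (polarMap (n := n) rp β) (endBox (radial n) B) (atInfinity n rp) := by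
  rw [atInfinity, tendsto_comap_iff]
  refine Tendsto.congr' ?_ (tendsto_atEnd.mono_left (endBox_le (o := radial n) (B := B)))
  filter_upwards [(eventually_gt_atEnd rp).filter_mono endBox_le] with y hy
  exact (radius_polarMap hy.le).symm

/-- Bounds in polar coordinates with bounded angles give bounds near infinity, for periodic
functions. -/
theorem isBigO_of_polar (hβ : 0 < β) (hlam : ∀ i, 0 < lam i) {F : (Idx n → ℝ) → ℝ}
    (hF : IsTorusPeriodic lam F) {p : ℤ}
    (h : ∀ B, (fun y => F (polarMap rp β y)) =O[endBox (radial n) B] fun y => y (radial n) ^ p) :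
    F =O[atInfinity n rp] fun z => radius rp z ^ p := by
  -- Large enough for the box to contain a polar preimage of every point of the fundamental domain
  -- near infinity: |ξ| ≤ β and 0 ≤ φⁱ < `lam i`.
  set B := β + ∑ i, lam i with hB
  obtain ⟨C, hC⟩ := (h B).bound
  have h1 := eventually_inf_principal.1 hC
  obtain ⟨ρ, hρ⟩ := eventually_atEnd.1 h1
  refine IsBigO.of_bound C ?_
  have h2 : ∀ᶠ z in atInfinity n rp, ρ < radius rp z :=
    tendsto_comap.eventually_gt_atTop _
  filter_upwards [h2] with z hz
  obtain ⟨z', hz1, hz2, hz3⟩ := hF.exists_fundamental hlam z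
  have hrad : radius rp z' = radius rp z := by simp only [radius, hz2]
  rw [← hz3, ← hrad]
  rw [← hrad] at hz
  obtain ⟨y, rfl, hy0, hy1, hyi⟩ := polarMap_surj rp hβ z'
  rw [← hy0]
  refine hρ y (by rw [hy0]; exact hz) fun i hi => ?_
  have hsum : ∀ i, lam i ≤ ∑ i, lam i := fun i =>
    Finset.single_le_sum (f := lam) (fun i _ => (hlam i).le) (Finset.mem_univ i)
  rcases i with i | i
  · have hi1 : i = 1 := by
      have : i ≠ 0 := fun h => hi (by rw [h])
      omega
    subst hi1
    have : 0 ≤ ∑ i, lam i := Finset.sum_nonneg fun i _ => (hlam i).le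
    linarith
  · rw [hyi, abs_of_nonneg (hz1 i).1]
    have := (hz1 i).2
    have := hsum i
    linarith

end Transfer

/-! ### The radial equation of the special defining function. -/

section RadialODE

/-- The solution of `X' = - X √Ψ / t` with `t X → 1`, where `Ψ = 1 + O(t⁻²)`. -/
theorem exists_radial_solution {Ψ : ℝ → ℝ} (hs : ∀ᶠ t in atTop, ContDiffAt ℝ ∞ Ψ t)
    (hb : (fun t => Ψ t - 1) =O[atTop] fun t => t ^ (-2 : ℤ)) (hpos : ∀ᶠ t in atTop, 0 < Ψ t) :
    ∃ X : ℝ → ℝ, (∃ ρ : ℝ, ∀ t, ρ < t → ContDiffAt ℝ ∞ X t ∧ 0 < X t ∧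
      HasDerivAt X (-(X t * Real.sqrt (Ψ t) * t⁻¹)) t) ∧
      Tendsto (fun t => X t * t) atTop (𝓝 1) := by
  obtain ⟨C, hC⟩ := hb.bound
  obtain ⟨ρ, hρ⟩ := (eventually_atTop.1 (hs.and (hpos.and (hC.and (eventually_gt_atTop 0)))))
  -- For X = t⁻¹ exp(c - L) the equation becomes L' = η. Since |√Ψ - 1| ≤ |Ψ - 1|, η is O(t⁻³) and
  -- integrable at infinity.
  set η : ℝ → ℝ := fun t => (Real.sqrt (Ψ t) - 1) * t⁻¹ with hη
  have hη_smooth : ∀ t, ρ < t → ContDiffAt ℝ ∞ η t := fun t ht => by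
    obtain ⟨h1, h2, -, h4⟩ := hρ t ht.le
    exact ((h1.sqrt h2.ne').sub contDiffAt_const).mul (contDiffAt_id.inv h4.ne')
  have hη_cont : ContinuousOn η (Set.Ioi ρ) := fun t ht =>
    (hη_smooth t ht).continuousAt.continuousWithinAt
  have hη_bound : ∀ t, ρ < t → ‖η t‖ ≤ C * t ^ (-3 : ℝ) := by
    intro t ht
    obtain ⟨-, h2, h3, h4⟩ := hρ t ht.le
    have h5 : |Real.sqrt (Ψ t) - 1| ≤ |Ψ t - 1| := by
      have h6 : Ψ t - 1 = (Real.sqrt (Ψ t) - 1) * (Real.sqrt (Ψ t) + 1) := by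
        have := Real.sq_sqrt h2.le
        linear_combination -this
      rw [h6, abs_mul]
      have h7 : 1 ≤ |Real.sqrt (Ψ t) + 1| := by
        rw [abs_of_pos (by positivity)]; linarith [Real.sqrt_nonneg (Ψ t)]
      nlinarith [abs_nonneg (Real.sqrt (Ψ t) - 1)]
    have h8 : t ^ (-3 : ℝ) = t ^ (-2 : ℤ) * t⁻¹ := by
      rw [← zpow_sub_one₀ h4.ne', ← Real.rpow_intCast]; norm_num
    rw [Real.norm_of_nonneg (zpow_pos h4 _).le, Real.norm_eq_abs] at h3
    rw [hη, Real.norm_eq_abs, abs_mul, abs_of_pos (inv_pos.2 h4), h8, ← mul_assoc]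
    exact mul_le_mul_of_nonneg_right (h5.trans h3) (inv_pos.2 h4).le
  set ρ₁ := ρ + 1 with hρ₁
  have hρ₁0 : 0 < ρ₁ := (hρ ρ₁ (by linarith)).2.2.2
  have hint : IntegrableOn η (Set.Ioi ρ₁) := by
    refine Integrable.mono' ((integrableOn_Ioi_rpow_of_lt (by norm_num : (-3 : ℝ) < -1)
      hρ₁0).const_mul C) ?_ ?_
    · exact (hη_cont.mono (Set.Ioi_subset_Ioi (by linarith))).aestronglyMeasurable measurableSet_Ioi
    · refine (ae_restrict_iff' measurableSet_Ioi).2 (Eventually.of_forall fun t ht => ?_)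
      exact hη_bound t (by have : ρ₁ < t := ht; linarith)
  set L : ℝ → ℝ := fun t => ∫ s in ρ₁..t, η s with hL
  have hLlim : Tendsto L atTop (𝓝 (∫ s in Set.Ioi ρ₁, η s)) :=
    intervalIntegral_tendsto_integral_Ioi ρ₁ hint tendsto_id
  have hLd : ∀ t, ρ < t → HasDerivAt L (η t) t := by
    intro t ht
    have hsub : Set.uIcc ρ₁ t ⊆ Set.Ioi ρ := by
      intro s hs'
      rw [Set.mem_uIcc] at hs'
      rcases hs' with h | h
      · exact lt_of_lt_of_le (by linarith) h.1
      · exact lt_of_lt_of_le ht h.1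
    exact intervalIntegral.integral_hasDerivAt_right ((hη_cont.mono hsub).intervalIntegrable)
      (hη_cont.stronglyMeasurableAtFilter isOpen_Ioi t ht) (hη_smooth t ht).continuousAt
  have hLs : ContDiffOn ℝ ∞ L (Set.Ioi ρ) := by
    rw [contDiffOn_infty_iff_deriv_of_isOpen isOpen_Ioi]
    refine ⟨fun t ht => (hLd t ht).differentiableAt.differentiableWithinAt, ?_⟩
    refine ContDiffOn.congr (f := η) (fun t ht => (hη_smooth t ht).contDiffWithinAt) ?_
    exact fun t ht => (hLd t ht).deriv
  -- The limit of L; this choice gives t X(t) = exp(c - L(t)) → 1.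
  set c := ∫ s in Set.Ioi ρ₁, η s
  refine ⟨fun t => t⁻¹ * Real.exp (c - L t), ⟨ρ, fun t ht => ⟨?_, ?_, ?_⟩⟩, ?_⟩
  · have h4 := (hρ t ht.le).2.2.2
    exact (contDiffAt_id.inv h4.ne').mul ((contDiffAt_const.sub
      (hLs.contDiffAt (isOpen_Ioi.mem_nhds ht))).exp)
  · have h4 := (hρ t ht.le).2.2.2
    positivity
  · have h4 := (hρ t ht.le).2.2.2
    have h5 := (hasDerivAt_inv h4.ne').mul ((hLd t ht).const_sub c).exp
    refine h5.congr_deriv ?_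
    simp only [hη]
    field_simp
    ring
  · have h1 : Tendsto (fun t => Real.exp (c - L t)) atTop (𝓝 1) := by
      have := (Real.continuous_exp.tendsto _).comp (hLlim.const_sub c)
      rw [sub_self, Real.exp_zero] at this
      exact this
    refine h1.congr' ?_
    filter_upwards [eventually_gt_atTop 0] with t ht
    field_simp

/-- Restriction to the axis on which all other coordinates vanish; it lies in every box with B ≥ 0.
-/
theorem radial_of_isSymbol {ι : Type} [Fintype ι] [DecidableEq ι] {o : ι} {B : ℝ} (hB : 0 ≤ B)
    {k : ℕ} {p : ℤ} {Ψ : ℝ → ℝ} (h : IsSymbol o B k p fun y => Ψ (y o)) :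
    (∀ᶠ t in atTop, ContDiffAt ℝ ∞ Ψ t) ∧ Ψ =O[atTop] fun t => t ^ (-p) := by
  have hs : ∀ t : ℝ, (Pi.single o t : ι → ℝ) o = t := fun t => by simp
  constructor
  · obtain ⟨ρ, hρ⟩ := eventually_atEnd.1 h.smooth
    filter_upwards [eventually_gt_atTop ρ] with t ht
    have h1 := hρ (Pi.single o t) (by rwa [hs])
    have h2 : ContDiffAt ℝ ∞ (fun t : ℝ => (Pi.single o t : ι → ℝ)) t :=
      (ContinuousLinearMap.single ℝ (fun _ : ι => ℝ) o).contDiff.contDiffAt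
    have h3 := h1.comp t h2
    simpa [Function.comp_def] using h3
  · have ht : Tendsto (fun t : ℝ => (Pi.single o t : ι → ℝ)) atTop (endBox o B) := by
      refine tendsto_inf.2 ⟨?_, tendsto_principal.2 (Eventually.of_forall fun t i hi => ?_)⟩
      · rw [atEnd, tendsto_comap_iff]
        simp only [Function.comp_def, hs]
        exact tendsto_id
      · simpa [hi] using hB
    have := h.isBigO.comp_tendsto ht
    simpa [Function.comp_def] using this

end RadialODE

/-! ### Existence of a special defining function. -/

section SpecialDefiningFunction

variable {n : ℕ} {rp β : ℝ} {lam : Fin (n - 2) → ℝ} {G : (Idx n → ℝ) → Matrix (Idx n) (Idx n) ℝ}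

theorem contDiff_radius : ContDiff ℝ ∞ (radius (n := n) rp) := by
  unfold radius; fun_prop

theorem covectorNormSq_smul {ι : Type} [Fintype ι] [DecidableEq ι] {c : ℝ} (hc : c ≠ 0)
    {h : Matrix ι ι ℝ} (hh : h.det ≠ 0) (α : ι → ℝ) :
    covectorNormSq (c • h) α = c⁻¹ * covectorNormSq h α := by
  have : (c • h)⁻¹ = c⁻¹ • h⁻¹ := by
    refine Matrix.inv_eq_left_inv ?_
    rw [Matrix.smul_mul, Matrix.mul_smul, smul_smul, inv_mul_cancel₀ hc, one_smul,
      Matrix.nonsing_inv_mul _ (isUnit_iff_ne_zero.2 hh)]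
  rw [covectorNormSq_eq, covectorNormSq_eq, this, Matrix.smul_mulVec, dotProduct_smul, smul_eq_mul]

/-- For x = X(r), the inverse metric component gᵒᵒ = r²/Ψ gives |dx|² = X'² r² / (X² Ψ) in the
metric x² g. Thus |dx| = 1 reduces to the radial equation X' = -X √Ψ / r. -/
theorem exists_specialDefiningFunction (hG : IsSmoothMetric lam G) (hβ : 0 < β) {Ψ : ℝ → ℝ}
    (hs : ∀ᶠ t in atTop, ContDiffAt ℝ ∞ Ψ t)
    (hb : (fun t => Ψ t - 1) =O[atTop] fun t => t ^ (-2 : ℤ)) (hpos : ∀ᶠ t in atTop, 0 < Ψ t)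
    (hΨ : ∀ᶠ y in atEnd (radial n), pullback (polarMap rp β) G y (radial n) (radial n) =
      (y (radial n) ^ 2)⁻¹ * Ψ (y (radial n)))
    (hinv : ∀ᶠ y in atEnd (radial n), pullback (polarMap rp β) G y (radial n) (radial n) *
      (pullback (polarMap rp β) G y)⁻¹ (radial n) (radial n) = 1) :
    ∃ x, IsSpecialDefiningFunction lam rp G x := by
  obtain ⟨X, ⟨ρ, hX⟩, hlim⟩ := exists_radial_solution hs hb hpos
  obtain ⟨ρ', hρ'⟩ := eventually_atTop.1 hpos
  obtain ⟨ρ'', hρ''⟩ := eventually_atEnd.1 (hΨ.and hinv)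
  set σ := max (max ρ ρ') (max ρ'' (max rp 0)) with hσ
  have hσ1 : ρ ≤ σ := (le_max_left _ _).trans (le_max_left _ _)
  have hσ2 : ρ' ≤ σ := (le_max_right _ _).trans (le_max_left _ _)
  have hσ3 : ρ'' ≤ σ := (le_max_left _ _).trans (le_max_right _ _)
  have hσ4 : rp ≤ σ := (le_max_left _ _).trans ((le_max_right _ _).trans (le_max_right _ _))
  have hσ5 : 0 ≤ σ := (le_max_right _ _).trans ((le_max_right _ _).trans (le_max_right _ _))
  have hxs : ∀ z : Idx n → ℝ, σ < radius rp z → ContDiffAt ℝ ∞ (fun z => X (radius rp z)) z :=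
    fun z hz => ((hX _ (hσ1.trans_lt hz)).1).comp z contDiff_radius.contDiffAt
  refine ⟨fun z => X (radius rp z), ⟨σ, ?_, ?_, ?_, ?_⟩, ?_⟩
  · exact fun z hz => (hxs z hz).contDiffWithinAt
  · intro z _ i
    simp [radius]
  · exact fun z hz => (hX _ (hσ1.trans_lt hz)).2.1
  · intro z hz
    obtain ⟨y, rfl, hy0, -, -⟩ := polarMap_surj rp hβ z
    set r := y (radial n) with hr
    have hy0' : r = radius rp (polarMap rp β y) := hy0
    rw [← hy0'] at hz
    have hyrp : rp < y (Sum.inl 0) := hσ4.trans_lt hz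
    obtain ⟨-, hXpos, hXd⟩ := hX r (hσ1.trans_lt hz)
    obtain ⟨hgoo, hgi⟩ := hρ'' y (hσ3.trans_lt hz)
    have hΨpos := hρ' r (hσ2.trans hz.le)
    have hr0 : 0 < r := hσ5.trans_lt hz
    have hJ : IsUnit (jacobian (polarMap (n := n) rp β) y).det := by
      rw [det_jacobian_polarMap hyrp]
      exact isUnit_iff_ne_zero.2 (div_pos Real.pi_pos hβ).ne'
    -- In polar coordinates dx has only a radial component, given by the ODE.
    have hα : (jacobian (polarMap (n := n) rp β) y).transpose.mulVec
        (fun i => pd i (fun z => X (radius rp z)) (polarMap rp β y)) =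
        Pi.single (radial n) (-(X r * Real.sqrt (Ψ r) * r⁻¹)) := by
      funext i
      have h1 := pd_comp i (hxs _ (by rw [← hy0']; exact hz)) (contDiffAt_polarMap (β := β) hyrp)
      have h2 : pd i (fun z => X (radius rp (polarMap rp β z))) y =
          pd i (fun z => X (z (radial n))) y := by
        refine pd_congr i ?_
        filter_upwards [(isOpen_lt continuous_const (continuous_apply (radial n))).mem_nhds hyrp]
          with z hz
        rw [radius_polarMap (le_of_lt hz)]
      rw [h2, pd_comp_coord hXd] at h1
      rw [Matrix.mulVec, dotProduct, Pi.single_apply, h1]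
      refine Finset.sum_congr rfl fun k _ => ?_
      rw [mul_comm]; rfl
    change covectorNormSq (X (radius rp (polarMap rp β y)) ^ 2 • G (polarMap rp β y)) _ = 1
    rw [← hy0', covectorNormSq_smul (pow_pos hXpos 2).ne' (hG.det_pos _).ne',
      ← covectorNormSq_congruence hJ, hα, ← pullback_eq, covectorNormSq_eq]
    simp only [Matrix.mulVec_single, single_dotProduct]
    have hgi' : (pullback (polarMap rp β) G y)⁻¹ (radial n) (radial n) = r ^ 2 * (Ψ r)⁻¹ := by
      rw [hgoo] at hgi
      have := hΨpos.ne'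
      have := hr0.ne'
      rw [← hr] at hgi
      field_simp at hgi ⊢
      linarith
    simp only [Pi.smul_apply, Matrix.col_apply, hgi']
    have h3 := Real.mul_self_sqrt hΨpos.le
    have := hXpos.ne'
    have := hr0.ne'
    have := hΨpos.ne'
    have h4 : ∀ s : ℝ, s * s = Ψ r → (X r ^ 2)⁻¹ * (-(X r * s * r⁻¹) *
        (r ^ 2 * (Ψ r)⁻¹ * -(X r * s * r⁻¹))) = 1 := by
      intro s hs
      field_simp
      rw [pow_two, hs]
    simpa using h4 _ h3
  · exact hlim.comp tendsto_comap

end SpecialDefiningFunction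

/-! ### Asymptotics of the volume and curvature densities. -/

section DensityAsymptotics

variable {ι : Type} [Fintype ι] [DecidableEq ι] {o : ι} {B : ℝ} {m : ℕ}
  {g : (ι → ℝ) → Matrix ι ι ℝ}

/-- The frame weights multiply to r¹⁻ᵐ, and the frame matrix tends to the identity. -/
theorem IsAsymptoticallyHyperbolic.tendsto_volumeDensity (H : IsAsymptoticallyHyperbolic o B m g)
    (hm : (Finset.univ.erase o).card = m) (hm1 : 1 ≤ m) :
    Tendsto (fun y => Real.sqrt (g y).det * y o ^ (1 - m : ℤ)) (endBox o B) (𝓝 1) := by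
  have h1 : Tendsto (fun y => (frameMatrix o g y).det) (endBox o B) (𝓝 1) := by
    refine tendsto_det_one fun i j => ?_
    have := ((H.symbol i j).tendsto_zero (by omega)).add_const ((1 : Matrix ι ι ℝ) i j)
    simpa using this
  have h2 := (Real.continuous_sqrt.tendsto _).comp h1
  rw [Real.sqrt_one] at h2
  refine h2.congr' ?_
  filter_upwards [(eventually_gt_atEnd (o := o) 0).filter_mono endBox_le] with y hy
  have h3 : ∏ i, frameWeight o i (y o) = y o ^ (1 - m : ℤ) := by
    rw [← Finset.mul_prod_erase _ _ (Finset.mem_univ o), Finset.prod_congr rfl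
      (g := fun _ => (y o)⁻¹) (fun i hi => by simp [frameWeight, Finset.ne_of_mem_erase hi]),
      Finset.prod_const, hm, sub_eq_add_neg, zpow_add₀ hy.ne', zpow_one, zpow_neg, zpow_natCast,
      inv_pow]
    simp [frameWeight]
  rw [Function.comp_apply, frameMatrix_eq, Matrix.det_mul, Matrix.det_mul, Matrix.det_diagonal, h3,
    mul_right_comm, ← sq, Real.sqrt_mul (sq_nonneg _), Real.sqrt_sq (zpow_pos hy _).le, mul_comm]

theorem IsAngular.isBigO_one {M : (ι → ℝ) → ℝ} (hM : IsAngular o M) :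
    M =O[endBox o B] fun _ => (1 : ℝ) := by
  have hK : IsCompact (Set.pi Set.univ fun _ : ι => Set.Icc (-|B|) |B|) :=
    isCompact_univ_pi fun _ => isCompact_Icc
  obtain ⟨C, hC⟩ := hK.exists_bound_of_continuousOn hM.1.continuous.continuousOn
  refine IsBigO.of_bound C ?_
  have h : ∀ᶠ y in endBox o B, y ∈ {y : ι → ℝ | ∀ i, i ≠ o → |y i| ≤ B} :=
    eventually_inf_principal.2 (Eventually.of_forall fun y hy => hy)
  filter_upwards [h] with y hy
  rw [norm_one, mul_one, ← hM.2 y 0]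
  refine hC _ fun i _ => ?_
  by_cases hi : i = o
  · subst hi; simp
  · rw [Function.update_of_ne hi]
    exact abs_le.1 ((hy i hi).trans (le_abs_self B))

/-- An angular function is recovered by radial limits from any function asymptotic to it. -/
theorem IsAngular.tendsto_update {M : (ι → ℝ) → ℝ} (hM : IsAngular o M) {F : (ι → ℝ) → ℝ}
    (h : Tendsto (fun y => F y - M y) (endBox o B) (𝓝 0)) {y : ι → ℝ}
    (hy : ∀ i, i ≠ o → |y i| ≤ B) :
    Tendsto (fun t => F (Function.update y o t)) atTop (𝓝 (M y)) := by
  have ht : Tendsto (fun t : ℝ => Function.update y o t) atTop (endBox o B) := by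
    refine tendsto_inf.2 ⟨?_, tendsto_principal.2 (Eventually.of_forall fun t i hi => ?_)⟩
    · rw [atEnd, tendsto_comap_iff]
      simp only [Function.comp_def, Function.update_self]
      exact tendsto_id
    · rw [Function.update_of_ne hi]; exact hy i hi
  have h1 := (h.comp ht).add_const (M y)
  rw [zero_add] at h1
  refine h1.congr fun t => ?_
  simp [hM.2]

/-- The factor r · rᵐ⁻¹ turns m M r⁻ᵐ into m M and the error r⁻ᵐ⁻² into r⁻². The limit of the volume
density is used without a rate, so the r⁻² bound is claimed only when M vanishes. -/
theorem tendsto_scalar_mul_volumeDensity (H : IsAsymptoticallyHyperbolic o B m g)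
    (hm : (Finset.univ.erase o).card = m) (hm1 : 1 ≤ m) {S M : (ι → ℝ) → ℝ} (hM : IsAngular o M)
    (hS : (fun y => S y - m * M y * y o ^ (-(m : ℤ))) =O[endBox o B] fun y => y o ^ (-(m + 2 : ℤ))) :
    Tendsto (fun y => S y * y o * Real.sqrt (g y).det - m * M y) (endBox o B) (𝓝 0) ∧
    ((∀ y, M y = 0) → (fun y => S y * y o * Real.sqrt (g y).det) =O[endBox o B]
      fun y => y o ^ (-2 : ℤ)) := by
  have hD := H.tendsto_volumeDensity hm hm1
  have hpos := (eventually_gt_atEnd (o := o) 0).filter_mono (endBox_le (B := B))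
  have h1 : (fun y => (S y - m * M y * y o ^ (-(m : ℤ))) * y o ^ (m : ℤ) *
      (Real.sqrt (g y).det * y o ^ (1 - m : ℤ))) =O[endBox o B] fun y => y o ^ (-2 : ℤ) := by
    have := (hS.mul (isBigO_refl (fun y : ι → ℝ => y o ^ (m : ℤ)) (endBox o B))).mul
      (hD.isBigO_one ℝ)
    refine this.congr' EventuallyEq.rfl ?_
    filter_upwards [hpos] with y hy
    rw [mul_one, ← zpow_add₀ hy.ne']
    congr 1; ring
  have h2 : ∀ᶠ y in endBox o B, S y * y o * Real.sqrt (g y).det =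
      (S y - m * M y * y o ^ (-(m : ℤ))) * y o ^ (m : ℤ) *
      (Real.sqrt (g y).det * y o ^ (1 - m : ℤ)) +
      m * M y * (Real.sqrt (g y).det * y o ^ (1 - m : ℤ)) := by
    filter_upwards [hpos] with y hy
    have := hy.ne'
    rw [sub_eq_add_neg 1, zpow_add₀ this, zpow_neg, zpow_one]
    have : y o ^ (m : ℤ) ≠ 0 := zpow_ne_zero _ this
    field_simp
    ring
  constructor
  · have h3 : Tendsto (fun y : ι → ℝ => y o ^ (-2 : ℤ)) (endBox o B) (𝓝 0) :=
      (tendsto_zpow_atTop_zero (by norm_num)).comp (tendsto_atEnd.mono_left endBox_le)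
    have h4 := h1.trans_tendsto h3
    have h5 : Tendsto (fun y => Real.sqrt (g y).det * y o ^ (1 - m : ℤ) - 1) (endBox o B) (𝓝 0) := by
      simpa using hD.sub_const 1
    have h6 : Tendsto (fun y => (m * M y) * (Real.sqrt (g y).det * y o ^ (1 - m : ℤ) - 1))
        (endBox o B) (𝓝 0) :=
      ((hM.const_mul m).isBigO_one.mul (isBigO_refl _ _)).trans_tendsto (by simpa using h5)
    have h7 := h4.add h6
    rw [add_zero] at h7
    refine h7.congr' ?_
    filter_upwards [h2] with y hy
    rw [hy]; ring
  · intro h0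
    refine h1.congr' ?_ EventuallyEq.rfl
    filter_upwards [h2] with y hy
    rw [hy, h0]; ring

end DensityAsymptotics

/-! ### The integrand against Lebesgue measure. -/

section CurvatureDensity

variable {n : ℕ} {rp β : ℝ} {lam : Fin (n - 2) → ℝ} {G : (Idx n → ℝ) → Matrix (Idx n) (Idx n) ℝ}

/-- The density of `(R + n (n - 1)) r` with respect to the coordinate volume. -/
def curvatureDensity (rp : ℝ) (G : (Idx n → ℝ) → Matrix (Idx n) (Idx n) ℝ) (z : Idx n → ℝ) : ℝ :=
  (scalarCurvature G z + (n : ℝ) * ((n : ℝ) - 1)) * radius rp z * Real.sqrt (G z).det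

theorem IsSmoothMetric.continuous_det (hG : IsSmoothMetric lam G) :
    Continuous fun z => (G z).det :=
  (continuous_pi fun i => continuous_pi fun j => (hG.smooth i j).continuous).matrix_det

theorem IsSmoothMetric.continuous_curvatureDensity (hG : IsSmoothMetric lam G) :
    Continuous (curvatureDensity rp G) := by
  refine ((Continuous.add ?_ continuous_const).mul contDiff_radius.continuous).mul
    hG.continuous_det.sqrt
  refine continuous_finsetSum _ fun i _ => continuous_finsetSum _ fun j _ => ?_
  refine continuous_iff_continuousAt.2 fun z => ?_
  exact (contDiffAt_matrix_inv (hG.smoothAt z) (hG.det_pos z).ne' i j).continuousAt.mul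
    (contDiffAt_ricci (hG.smoothAt z) (hG.det_pos z).ne' i j).continuousAt

theorem IsSmoothMetric.isTorusPeriodic_curvatureDensity (hG : IsSmoothMetric lam G) :
    IsTorusPeriodic lam (curvatureDensity rp G) := fun i z => by
  have h1 := hG.isTorusPeriodic_ricci i z
  simp only [Prod.mk.injEq] at h1
  simp only [curvatureDensity, scalarCurvature, h1.1, h1.2]
  simp [radius]

theorem integrableOn_riemannianVolume_iff (hG : IsSmoothMetric lam G) :
    IntegrableOn (fun z => (scalarCurvature G z + (n : ℝ) * ((n : ℝ) - 1)) * radius rp z)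
      (fundamentalDomain lam) (riemannianVolume G) ↔
    IntegrableOn (curvatureDensity rp G) (fundamentalDomain lam) volume := by
  have hm : Measurable fun z => ENNReal.ofReal (Real.sqrt (G z).det) :=
    hG.continuous_det.sqrt.measurable.ennreal_ofReal
  rw [IntegrableOn, riemannianVolume, restrict_withDensity', integrable_withDensity_iff_integrable_smul'
    hm (Eventually.of_forall fun _ => ENNReal.ofReal_lt_top), IntegrableOn]
  refine integrable_congr (Eventually.of_forall fun z => ?_)
  simp only [smul_eq_mul, ENNReal.toReal_ofReal (Real.sqrt_nonneg _), curvatureDensity]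
  ring

/-- The factor β/π is the inverse of the constant Jacobian determinant of the polar map. -/
theorem curvatureDensity_polarMap (hG : IsSmoothMetric lam G) (hβ : 0 < β) {y : Idx n → ℝ}
    (hy : rp < y (Sum.inl 0)) : curvatureDensity rp G (polarMap rp β y) = β / Real.pi *
      ((scalarCurvature (pullback (polarMap rp β) G) y + (n : ℝ) * ((n : ℝ) - 1)) *
        y (radial n) * Real.sqrt (pullback (polarMap rp β) G y).det) := by
  have hpi := Real.pi_pos
  rw [curvatureDensity, hG.scalarCurvature_polar hβ hy, radius_polarMap hy.le,
    IsSmoothMetric.pullback_det hy, Real.sqrt_mul (sq_nonneg _),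
    Real.sqrt_sq (div_pos hpi hβ).le]
  field_simp

end CurvatureDensity

/-! ### Integrability of densities of order r⁻². -/

section Integrability

variable {n : ℕ} {rp β : ℝ} {lam : Fin (n - 2) → ℝ} {h : (Idx n → ℝ) → ℝ}

theorem polarMap_translate_torus (y : Idx n → ℝ) (i : Fin (n - 2)) (t : ℝ) :
    polarMap rp β (y + Pi.single (Sum.inr i) t) = polarMap rp β y + Pi.single (Sum.inr i) t := by
  funext j
  rcases j with j | j
  · fin_cases j <;> simp [polarMap]
  · simp [polarMap, Pi.single_apply]

theorem polarMap_translate_xi (hβ : 0 < β) (y : Idx n → ℝ) (k : ℤ) :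
    polarMap rp β (y + Pi.single (Sum.inl 1) (k * β)) = polarMap rp β y := by
  have h1 : 2 * Real.pi * (y (Sum.inl 1) + k * β) / β =
      2 * Real.pi * y (Sum.inl 1) / β + k * (2 * Real.pi) := by
    field_simp
  funext j
  rcases j with j | j
  · fin_cases j <;> simp [polarMap, h1]
  · simp [polarMap]

theorem measurableSet_fundamentalDomain : MeasurableSet (fundamentalDomain lam) := by
  have : fundamentalDomain lam =
      ⋂ i, (fun z : Idx n → ℝ => z (Sum.inr i)) ⁻¹' Set.Ico 0 (lam i) := by
    ext z; simp [fundamentalDomain]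
  rw [this]
  exact MeasurableSet.iInter fun i => measurable_pi_apply _ measurableSet_Ico

/-- In Cartesian coordinates r² dominates a multiple of (1 + z₁²)(1 + z₂²), so over the fundamental
domain r⁻² is bounded by a product of integrable functions of one variable. -/
theorem integrableOn_of_isBigO (hrp : 0 < rp) (hc : Continuous h)
    (hO : h =O[atInfinity n rp] fun z => radius rp z ^ (-2 : ℤ)) :
    IntegrableOn h (fundamentalDomain lam) := by
  obtain ⟨C, hC⟩ := hO.bound
  obtain ⟨ρ, hρ⟩ : ∃ ρ, ∀ z : Idx n → ℝ, ρ < radius rp z →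
      ‖h z‖ ≤ C * ‖radius rp z ^ (-2 : ℤ)‖ := by
    have := hC
    rw [atInfinity, ((atTop_basis_Ioi (α := ℝ)).comap _).eventually_iff] at this
    simpa using this
  have hrad : ∀ z : Idx n → ℝ, 0 < radius rp z := fun z => by unfold radius; positivity
  have hK : IsCompact {z : Idx n → ℝ | radius rp z ≤ ρ ∧
      ∀ i, z (Sum.inr i) ∈ Set.Icc 0 (lam i)} := by
    refine IsCompact.of_isClosed_subset (s := Set.pi Set.univ
      (Sum.elim (fun _ => Set.Icc (-(ρ + 1)) (ρ + 1)) fun i => Set.Icc 0 (lam i)))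
      (isCompact_univ_pi fun i => ?_) ?_ ?_
    · cases i <;> exact isCompact_Icc
    · refine (isClosed_le contDiff_radius.continuous continuous_const).inter ?_
      have : {z : Idx n → ℝ | ∀ i, z (Sum.inr i) ∈ Set.Icc 0 (lam i)} =
          ⋂ i, (fun z : Idx n → ℝ => z (Sum.inr i)) ⁻¹' Set.Icc 0 (lam i) := by
        ext z; simp
      change IsClosed {z : Idx n → ℝ | ∀ i, z (Sum.inr i) ∈ Set.Icc 0 (lam i)}
      rw [this]
      exact isClosed_iInter fun i => isClosed_Icc.preimage (continuous_apply _)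
    · rintro z ⟨h1, h2⟩ (i | i) -
      · have h3 : z (Sum.inl i) ^ 2 ≤ ρ := by
          unfold radius at h1
          fin_cases i <;> simp only [Fin.zero_eta, Fin.mk_one] <;>
            linarith [sq_nonneg (z (Sum.inl 0)), sq_nonneg (z (Sum.inl 1))]
        change z (Sum.inl i) ∈ Set.Icc (-(ρ + 1)) (ρ + 1)
        constructor <;> nlinarith
      · exact h2 i
  obtain ⟨C₁, hC₁⟩ := hK.exists_bound_of_continuousOn hc.continuousOn
  -- One constant for the compact part {r ≤ ρ} and for the end.
  set C₂ := max C (C₁ * ρ ^ 2) with hC₂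
  have hb : ∀ z ∈ fundamentalDomain lam, ‖h z‖ ≤ |C₂| * (radius rp z ^ 2)⁻¹ := by
    intro z hz
    have hp : 0 < radius rp z ^ 2 := pow_pos (hrad z) 2
    rw [← div_eq_mul_inv, le_div_iff₀ hp]
    refine le_trans ?_ (le_abs_self C₂)
    by_cases hzr : radius rp z ≤ ρ
    · have h1 := hC₁ z ⟨hzr, fun i => ⟨(hz i).1, (hz i).2.le⟩⟩
      refine le_trans ?_ (le_max_right _ _)
      have h2 : radius rp z ^ 2 ≤ ρ ^ 2 := pow_le_pow_left₀ (hrad z).le hzr 2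
      exact mul_le_mul h1 h2 hp.le ((norm_nonneg _).trans h1)
    · have h1 := hρ z (not_le.1 hzr)
      refine le_trans ?_ (le_max_left _ _)
      rw [Real.norm_of_nonneg (zpow_pos (hrad z) _).le, zpow_neg, ← div_eq_mul_inv] at h1
      exact (le_div_iff₀ hp).1 (by exact_mod_cast h1)
  -- From c ≤ 1 and c ≤ r₊ follows c (1 + s²) ≤ r₊ + s² + t². The cases (s, t) = (z₁, z₂) and (z₂,
  -- z₁) are multiplied.
  set c := min 1 rp with hcdef
  have hc0 : 0 < c := lt_min one_pos hrp
  set F : (Idx n) → ℝ → ℝ := Sum.elim (fun _ t => (1 + t ^ 2)⁻¹)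
    fun i => (Set.Ico 0 (lam i)).indicator fun _ => 1 with hF
  have hFint : Integrable (fun z : Idx n → ℝ => ∏ i, F i (z i)) := by
    refine Integrable.fintype_prod (𝕜 := ℝ) fun i => ?_
    rcases i with i | i
    · exact integrable_inv_one_add_sq
    · exact (integrable_indicator_iff measurableSet_Ico).2 (by simp)
  refine Integrable.mono' ((hFint.const_mul (|C₂| * (c ^ 2)⁻¹)).integrableOn)
    hc.aestronglyMeasurable ?_
  refine (ae_restrict_iff' measurableSet_fundamentalDomain).2 (Eventually.of_forall fun z hz => ?_)
  refine (hb z hz).trans ?_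
  rw [mul_assoc]
  refine mul_le_mul_of_nonneg_left ?_ (abs_nonneg _)
  have h1 : ∏ i, F i (z i) = (1 + z (Sum.inl 0) ^ 2)⁻¹ * (1 + z (Sum.inl 1) ^ 2)⁻¹ := by
    rw [Fintype.prod_sum_type, Fin.prod_univ_two]
    have : ∏ i, F (Sum.inr i) (z (Sum.inr i)) = 1 :=
      Finset.prod_eq_one fun i _ => by simp [hF, Set.indicator_of_mem (hz i)]
    rw [this, mul_one]
    simp [hF]
  rw [h1, ← mul_inv, ← mul_inv]
  have hc1 : c ≤ 1 := min_le_left _ _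
  have hc2 : c ≤ rp := min_le_right _ _
  refine inv_anti₀ (by positivity) ?_
  have key : ∀ s t : ℝ, c * (1 + s ^ 2) ≤ rp + s ^ 2 + t ^ 2 := fun s t => by
    nlinarith [sq_nonneg s, sq_nonneg t, mul_nonneg (sub_nonneg.2 hc1) (sq_nonneg s)]
  have k1 := key (z (Sum.inl 0)) (z (Sum.inl 1))
  have k2 := key (z (Sum.inl 1)) (z (Sum.inl 0))
  have : radius rp z = rp + z (Sum.inl 0) ^ 2 + z (Sum.inl 1) ^ 2 := rfl
  calc c ^ 2 * ((1 + z (Sum.inl 0) ^ 2) * (1 + z (Sum.inl 1) ^ 2))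
      = (c * (1 + z (Sum.inl 0) ^ 2)) * (c * (1 + z (Sum.inl 1) ^ 2)) := by ring
    _ ≤ radius rp z * radius rp z :=
      mul_le_mul (k1.trans_eq this.symm) (k2.trans (by rw [this]; linarith)) (by positivity)
        (hrad z).le
    _ = radius rp z ^ 2 := (sq _).symm

end Integrability

/-! ### Integrability forces the limiting coefficient to vanish. -/

section NonIntegrability

variable {n : ℕ} {rp β : ℝ} {lam : Fin (n - 2) → ℝ} {h M : (Idx n → ℝ) → ℝ}

theorem det_fderiv_polarMap {y : Idx n → ℝ} (hy : rp < y (Sum.inl 0)) :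
    (fderiv ℝ (polarMap (n := n) rp β) y).det = Real.pi / β := by
  have hd := (contDiffAt_polarMap (β := β) hy).differentiableAt (by simp)
  rw [← det_jacobian_polarMap hy, ContinuousLinearMap.det, ← LinearMap.det_toMatrix']
  congr 1
  ext k i
  rw [LinearMap.toMatrix'_apply, jacobian, Matrix.of_apply, pd, fderiv_apply hd]
  rfl

/-- The domain of polar coordinates, over the fundamental domain and away from a slit. -/
def polarDomain (rp β : ℝ) (lam : Fin (n - 2) → ℝ) : Set (Idx n → ℝ) :=
  {y | (rp < y (Sum.inl 0) ∧ |y (Sum.inl 1)| < β / 2) ∧ y ∈ fundamentalDomain lam}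

theorem integrableOn_polarMap (hβ : 0 < β) (hint : IntegrableOn h (fundamentalDomain lam)) :
    IntegrableOn (fun y => h (polarMap rp β y)) (polarDomain rp β lam) := by
  have hms : MeasurableSet (polarDomain rp β lam) := by
    refine MeasurableSet.inter (MeasurableSet.inter ?_ ?_) measurableSet_fundamentalDomain
    · exact measurableSet_lt measurable_const (measurable_pi_apply _)
    · exact measurableSet_lt (measurable_pi_apply (Sum.inl 1)).abs measurable_const
  have himg : polarMap rp β '' polarDomain rp β lam ⊆ fundamentalDomain lam := by
    rintro _ ⟨y, hy, rfl⟩ i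
    exact hy.2 i
  have h1 := (integrableOn_image_iff_integrableOn_abs_det_fderiv_smul volume hms
    (fun y hy => ((contDiffAt_polarMap hy.1.1).differentiableAt
      (by simp)).hasFDerivAt.hasFDerivWithinAt)
    ((polarMap_injOn hβ).mono fun y hy => hy.1) h).1 (hint.mono_set himg)
  have h2 : IntegrableOn (fun y => Real.pi / β * h (polarMap rp β y)) (polarDomain rp β lam) := by
    refine h1.congr_fun (fun y hy => ?_) hms
    simp only [det_fderiv_polarMap hy.1.1, abs_of_pos (div_pos Real.pi_pos hβ), smul_eq_mul]
  have h3 : IntegrableOn (fun y => (Real.pi / β)⁻¹ * (Real.pi / β * h (polarMap rp β y)))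
      (polarDomain rp β lam) := h2.const_mul (Real.pi / β)⁻¹
  exact h3.congr_fun (fun y _ => inv_mul_cancel_left₀ (div_pos Real.pi_pos hβ).ne' _) hms

variable (hM : IsAngular (radial n) M)
  (hlim : ∀ B, Tendsto (fun y => h (polarMap rp β y) - M y) (endBox (radial n) B) (𝓝 0))

include hM hlim

/-- M is a radial limit of h in polar coordinates, so it inherits every angular translation symmetry
of h; no periodicity of M has to be assumed. -/
theorem coefficient_translate {v : Idx n → ℝ} (hv : v (radial n) = 0)
    (hh : ∀ y, h (polarMap rp β (y + v)) = h (polarMap rp β y)) (y : Idx n → ℝ) :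
    M (y + v) = M y := by
  have hb : ∀ (w : Idx n → ℝ) (i : Idx n), i ≠ radial n → |w i| ≤ ∑ j, |w j| := fun w i _ =>
    Finset.single_le_sum (f := fun j => |w j|) (fun j _ => abs_nonneg _) (Finset.mem_univ i)
  refine tendsto_nhds_unique (hM.tendsto_update (hlim _) (hb (y + v)))
    ((hM.tendsto_update (hlim _) (hb y)).congr fun t => ?_)
  rw [← hh]
  congr 2
  funext i
  by_cases hi : i = radial n
  · subst hi; simp [hv]
  · simp [hi]

/-- If M ≠ 0 somewhere, periodicity and continuity provide such a point in the interior of a cell of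
angles. Near it |h| ≥ ε on a half-line in r times a small angular cube, a set of infinite volume,
which is impossible for an integrable function. -/
theorem coefficient_eq_zero_of_integrableOn (hβ : 0 < β) (hlam : ∀ i, 0 < lam i)
    (hper : IsTorusPeriodic lam h) (hint : IntegrableOn h (fundamentalDomain lam))
    (y : Idx n → ℝ) : M y = 0 := by
  have hMper : IsTorusPeriodic lam M := fun i => coefficient_translate hM hlim (by simp)
    fun y => by rw [polarMap_translate_torus, hper]
  by_contra hy
  obtain ⟨y', hy', -, hMy'⟩ := hMper.exists_fundamental hlam y
  obtain ⟨y₁, hy₁, hξ, hMy₁⟩ : ∃ y₁ : Idx n → ℝ, y₁ ∈ fundamentalDomain lam ∧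
      |y₁ (Sum.inl 1)| ≤ β / 2 ∧ M y₁ ≠ 0 := by
    -- Rounding moves ξ into [-β/2, β/2]; periodicity of M in ξ comes from that of the polar map.
    set k : ℤ := -round (y' (Sum.inl 1) / β)
    refine ⟨y' + Pi.single (Sum.inl 1) (k * β), fun i => by simpa using hy' i, ?_, ?_⟩
    · have h1 := abs_sub_round (y' (Sum.inl 1) / β)
      have h2 : (y' + Pi.single (Sum.inl 1) (k * β) : Idx n → ℝ) (Sum.inl 1) =
          (y' (Sum.inl 1) / β - round (y' (Sum.inl 1) / β)) * β := by
        simp [k]; field_simp; ring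
      rw [h2, abs_mul, abs_of_pos hβ]
      nlinarith
    · rwa [coefficient_translate hM hlim (by simp)
        fun y => by rw [polarMap_translate_xi hβ], hMy']
  set s : Idx n → Set ℝ := Sum.elim ![Set.univ, Set.Ioo (-(β / 2)) (β / 2)]
    fun i => Set.Ioo 0 (lam i) with hs
  have hso : ∀ i, IsOpen (s i) := by
    rintro (i | i)
    · fin_cases i
      · exact isOpen_univ
      · exact isOpen_Ioo
    · exact isOpen_Ioo
  have hcl : y₁ ∈ closure (Set.univ.pi s) := by
    rw [closure_pi_set]
    rintro (i | i) -
    · fin_cases i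
      · simp [hs]
      · change y₁ (Sum.inl 1) ∈ closure (Set.Ioo (-(β / 2)) (β / 2))
        rw [closure_Ioo (by linarith)]
        exact abs_le.1 hξ
    · change y₁ (Sum.inr i) ∈ closure (Set.Ioo 0 (lam i))
      rw [closure_Ioo (hlam i).ne]
      exact Set.Ico_subset_Icc_self (hy₁ i)
  -- The point may lie on the boundary of the cell. As M ≠ 0 is an open condition, an interior point
  -- nearby also satisfies it.
  have hcont : Continuous M := hM.1.continuous
  obtain ⟨y₂, hMy₂, hy₂⟩ := mem_closure_iff.1 hcl {y | M y ≠ 0}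
    (isOpen_ne_fun hcont continuous_const) hMy₁
  -- Chosen so that |M| > 2ε near y₂, while |h - M| < ε for large r; together these give |h| ≥ ε.
  set ε := |M y₂| / 4 with hε
  have hM₂ : 0 < |M y₂| := abs_pos.2 hMy₂
  have hε0 : 0 < ε := by positivity
  obtain ⟨δ, hδ, hball⟩ := Metric.isOpen_iff.1
    ((isOpen_lt continuous_const hcont.abs).inter (isOpen_set_pi Set.finite_univ fun i _ => hso i))
    y₂ (show y₂ ∈ {y | 2 * ε < |M y|} ∩ Set.univ.pi s from
      ⟨by change 2 * ε < |M y₂|; rw [hε]; linarith, hy₂⟩)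
  set B := β + ∑ i, lam i with hB
  obtain ⟨R, hR⟩ : ∃ R, ∀ y : Idx n → ℝ, R < y (radial n) → (∀ i, i ≠ radial n → |y i| ≤ B) →
      |h (polarMap rp β y) - M y| < ε := by
    have h1 := (hlim B).eventually (Metric.ball_mem_nhds 0 hε0)
    obtain ⟨R, hR⟩ := eventually_atEnd.1 (eventually_inf_principal.1 h1)
    exact ⟨R, fun y h1 h2 => by simpa using hR y h1 h2⟩
  set Q : Set (Idx n → ℝ) := Set.univ.pi fun i =>
    if i = radial n then Set.Ioi (max R rp) else Metric.ball (y₂ i) δ with hQ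
  have hQmem : ∀ y ∈ Q, y ∈ polarDomain rp β lam ∧ ε ≤ ‖h (polarMap rp β y)‖ := by
    intro y hyQ
    have hyo : max R rp < y (radial n) := by simpa using hyQ (radial n) trivial
    have hmem : Function.update y (radial n) (y₂ (radial n)) ∈ Metric.ball y₂ δ := by
      rw [Metric.mem_ball, dist_pi_lt_iff hδ]
      intro i
      by_cases hi : i = radial n
      · subst hi; simpa using hδ
      · rw [Function.update_of_ne hi]
        have := hyQ i trivial
        simpa [hi] using this
    obtain ⟨h1, h2⟩ := hball hmem
    have h1' : 2 * ε < |M y| := by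
      rw [← hM.2 y (y₂ (radial n))]; exact h1
    have hξ' : y (Sum.inl 1) ∈ Set.Ioo (-(β / 2)) (β / 2) := by
      have := h2 (Sum.inl 1) trivial
      rw [Function.update_of_ne (by simp)] at this
      exact this
    have hφ : ∀ i, y (Sum.inr i) ∈ Set.Ioo 0 (lam i) := fun i => by
      have := h2 (Sum.inr i) trivial
      rw [Function.update_of_ne (by simp)] at this
      exact this
    have hlamB : 0 ≤ ∑ i, lam i := Finset.sum_nonneg fun i _ => (hlam i).le
    refine ⟨⟨⟨(le_max_right _ _).trans_lt hyo, abs_lt.2 hξ'⟩,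
      fun i => Set.Ioo_subset_Ico_self (hφ i)⟩, ?_⟩
    have h3 := hR y ((le_max_left _ _).trans_lt hyo) (by
      rintro (i | i) hi
      · fin_cases i
        · exact absurd rfl hi
        · change |y (Sum.inl 1)| ≤ B
          have := abs_lt.2 hξ'
          linarith
      · rw [abs_of_pos (hφ i).1]
        have := Finset.single_le_sum (f := lam) (fun j _ => (hlam j).le) (Finset.mem_univ i)
        linarith [(hφ i).2])
    have h4 := abs_sub_abs_le_abs_sub (M y) (h (polarMap rp β y))
    rw [abs_sub_comm] at h4
    rw [Real.norm_eq_abs]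
    linarith
  have hvol : volume Q = ⊤ := by
    rw [hQ, volume_pi_pi, ← Finset.mul_prod_erase _ _ (Finset.mem_univ (radial n))]
    rw [if_pos rfl, Real.volume_Ioi]
    refine ENNReal.top_mul (Finset.prod_ne_zero_iff.2 fun i hi => ?_)
    rw [if_neg (Finset.ne_of_mem_erase hi)]
    exact (Metric.measure_ball_pos volume _ hδ).ne'
  have hlt := (integrableOn_polarMap (rp := rp) hβ hint).measure_norm_ge_lt_top hε0
  have hle : volume Q ≤ (volume.restrict (polarDomain rp β lam))
      {y | ε ≤ ‖h (polarMap rp β y)‖} := by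
    calc volume Q ≤ volume ({y | ε ≤ ‖h (polarMap rp β y)‖} ∩ polarDomain rp β lam) :=
          measure_mono fun y hyQ => ⟨(hQmem y hyQ).2, (hQmem y hyQ).1⟩
      _ ≤ _ := Measure.le_restrict_apply _ _
  rw [hvol, top_le_iff] at hle
  exact hlt.ne hle

end NonIntegrability

/-! ### Decay in terms of a special defining function. -/

section APE

variable {n : ℕ} {rp β : ℝ} {lam : Fin (n - 2) → ℝ} {G : (Idx n → ℝ) → Matrix (Idx n) (Idx n) ℝ}
  {x : (Idx n → ℝ) → ℝ}

/-- The normalisation x r → 1 makes xⁿ and r⁻ⁿ interchangeable in bounds, whichever special defining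
function is used. -/
theorem IsSpecialDefiningFunction.isTheta (hx : IsSpecialDefiningFunction lam rp G x) :
    x =Θ[atInfinity n rp] fun z => (radius rp z)⁻¹ := by
  have hr : ∀ᶠ z in atInfinity n rp, radius rp z ≠ 0 := by
    filter_upwards [(tendsto_comap (f := radius (n := n) rp)).eventually_gt_atTop 0] with z hz
      using hz.ne'
  have h1 : (fun z => x z * radius rp z) =Θ[atInfinity n rp] fun _ => (1 : ℝ) :=
    ⟨hx.2.isBigO_one ℝ, IsBigO.of_bound 2 (by
      filter_upwards [hx.2.eventually (lt_mem_nhds (by norm_num : (1 / 2 : ℝ) < 1))] with z hz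
      rw [norm_one, Real.norm_eq_abs, abs_of_pos (by linarith)]
      linarith)⟩
  have h2 := h1.mul (isTheta_refl (fun z => (radius rp z)⁻¹) (atInfinity n rp))
  simp only [one_mul] at h2
  refine EventuallyEq.trans_isTheta ?_ h2
  filter_upwards [hr] with z hz
  field_simp

theorem IsSpecialDefiningFunction.isTheta_pow (hx : IsSpecialDefiningFunction lam rp G x) :
    (fun z => x z ^ n) =Θ[atInfinity n rp] fun z => radius rp z ^ (-n : ℤ) := by
  simpa using hx.isTheta.pow n

theorem xiPeriod_pos {r₀ : ℝ} (hn : 3 ≤ n) (hr₀ : 0 < r₀) (hrp : 0 < rp) : 0 < xiPeriod n r₀ rp := by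
  have h1 : (3 : ℝ) ≤ n := by exact_mod_cast hn
  have h2 : 0 < r₀ ^ n / rp ^ n := by positivity
  exact div_pos (by positivity) (mul_pos hrp (by linarith))

theorem card_erase_radial (hn : 3 ≤ n) : (Finset.univ.erase (radial n)).card = n - 1 := by
  rw [Finset.card_erase_of_mem (Finset.mem_univ _), Finset.card_univ, Fintype.card_sum,
    Fintype.card_fin, Fintype.card_fin]
  omega

theorem isTorusPeriodic_tensorNorm (hG : IsSmoothMetric lam G) (m : ℕ) :
    IsTorusPeriodic lam fun z => tensorNorm (G z) (einsteinDefect m G z) := fun i z => by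
  have h1 := hG.isTorusPeriodic_ricci i z
  simp only [Prod.mk.injEq] at h1
  simp only [einsteinDefect, h1.1, h1.2]

end APE

end AHM

/-! ### The equivalence. -/

open AHM

theorem proposition2p3 (n : ℕ) (hn : 3 ≤ n)
    -- the parameters of the model metric and the lengths of the circles
    (a r₀ rp : ℝ) (hr₀ : 0 < r₀)
    (hrp : IsGreatest {r : ℝ | 0 < r ∧ AHM.potential n a r₀ r = 0} rp)
    (lam : Fin (n - 2) → ℝ) (hlam : ∀ i, 0 < lam i)
    -- a smooth metric on the whole manifold
    (G : (AHM.Idx n → ℝ) → Matrix (AHM.Idx n) (AHM.Idx n) ℝ)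
    (hG : AHM.IsSmoothMetric lam G)
    -- its form in polar coordinates
    (uhat : ℝ → ℝ) (vhat : ℝ → ℝ → ℝ)
    (what : ℝ → ℝ → (Fin (n - 2) → ℝ) → Matrix (Fin (n - 2)) (Fin (n - 2)) ℝ)
    (hform : ∀ y : AHM.Idx n → ℝ, rp < y (Sum.inl 0) →
      AHM.pullback (AHM.polarMap rp (AHM.xiPeriod n r₀ rp)) G y =
        AHM.polarMetric n a r₀ uhat vhat what y)
    -- the asymptotic expansions
    (u₁ u₂ : ℝ) (v₁ v₂ : ℝ → ℝ)
    (w₁ w₂ : ℝ → (Fin (n - 2) → ℝ) → Matrix (Fin (n - 2)) (Fin (n - 2)) ℝ)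
    (hv₁ : ContDiff ℝ ∞ v₁) (hv₂ : ContDiff ℝ ∞ v₂)
    (hw₁ : ∀ i j, ContDiff ℝ ∞ fun p : ℝ × (Fin (n - 2) → ℝ) => w₁ p.1 p.2 i j)
    (hw₂ : ∀ i j, ContDiff ℝ ∞ fun p : ℝ × (Fin (n - 2) → ℝ) => w₂ p.1 p.2 i j)
    (hu : AHM.IsOType (n := n) (n + 1) fun y =>
      Real.exp (uhat (y (Sum.inl 0))) -
        (1 + u₁ / y (Sum.inl 0) ^ (n - 1) + u₂ / y (Sum.inl 0) ^ n))
    (hv : AHM.IsOType (n := n) (n + 1) fun y =>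
      Real.exp (vhat (y (Sum.inl 0)) (y (Sum.inl 1))) -
        (1 + v₁ (y (Sum.inl 1)) / y (Sum.inl 0) ^ (n - 1) +
          v₂ (y (Sum.inl 1)) / y (Sum.inl 0) ^ n))
    (hw : ∀ i j, AHM.IsOType (n := n) (n + 1) fun y =>
      what (y (Sum.inl 0)) (y (Sum.inl 1)) (fun k => y (Sum.inr k)) i j -
        (2 * w₁ (y (Sum.inl 1)) (fun k => y (Sum.inr k)) i j / y (Sum.inl 0) ^ (n - 1) +
          2 * w₂ (y (Sum.inl 1)) (fun k => y (Sum.inr k)) i j / y (Sum.inl 0) ^ n)) :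
    IntegrableOn
        (fun z => (AHM.scalarCurvature G z + (n : ℝ) * ((n : ℝ) - 1)) * AHM.radius rp z)
        (AHM.fundamentalDomain lam) (AHM.riemannianVolume G) ↔
      AHM.IsAPE lam rp G := by
  have hrp0 : 0 < rp := hrp.1.1
  set β := xiPeriod n r₀ rp
  have hβ : 0 < β := xiPeriod_pos hn hr₀ hrp0
  set g := pullback (polarMap rp β) G
  have hsymm : ∀ y, (g y).IsSymm := fun y => hG.pullback_isSymm _ y
  have hdet : ∀ y : Idx n → ℝ, rp < y (Sum.inl 0) → (g y).det ≠ 0 := fun y hy => by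
    rw [IsSmoothMetric.pullback_det hy]
    exact (mul_pos (pow_pos (div_pos Real.pi_pos hβ) 2) (hG.det_pos _)).ne'
  obtain ⟨c, d, hE⟩ := polar_deviation_expansion hn hform hv₁ hv₂ hw₁ hw₂ hu hv hw
  have H : ∀ B, IsAsymptoticallyHyperbolic (radial n) B (n - 1) g := fun B =>
    polar_isAsymptoticallyHyperbolic hn hform hsymm hdet (hE B)
  have hm := card_erase_radial hn
  have hm2 : 2 ≤ n - 1 := by omega
  have hcast : ((n - 1 : ℕ) : ℝ) = (n : ℝ) - 1 := by
    rw [Nat.cast_sub (by omega), Nat.cast_one]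
  have hneg : -(((n - 1 : ℕ) : ℤ) + 1) = -(n : ℤ) := by omega
  -- The trace of the leading coefficient; both directions pass through its vanishing.
  set M : (Idx n → ℝ) → ℝ := fun y =>
    c (radial n) (radial n) y + ∑ b ∈ Finset.univ.erase (radial n), c b b y with hM
  have hMang : IsAngular (radial n) M :=
    (hE 0 _ _).1.1.add (IsAngular.sum fun b _ => (hE 0 b b).1.1)
  set S : (Idx n → ℝ) → ℝ := fun y => scalarCurvature g y + (n : ℝ) * ((n : ℝ) - 1) with hS
  have hSB : ∀ B, (fun y => S y - ((n - 1 : ℕ) : ℝ) * M y * y (radial n) ^ (-((n - 1 : ℕ) : ℤ)))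
      =O[endBox (radial n) B] fun y => y (radial n) ^ (-(((n - 1 : ℕ) : ℤ) + 2)) := fun B => by
    refine ((H B).scalarCurvature_expansion hm hm2 (hE B)).isBigO.congr_left fun y => ?_
    simp only [hS, hM, hcast]
    ring
  have hdens := fun B => tendsto_scalar_mul_volumeDensity (H B) hm (by omega) hMang (hSB B)
  have hpolar : ∀ B, ∀ᶠ y in endBox (radial n) B, curvatureDensity rp G (polarMap rp β y) =
      β / Real.pi * (S y * y (radial n) * Real.sqrt (g y).det) := fun B => by
    filter_upwards [(eventually_gt_atEnd rp).filter_mono endBox_le] with y hy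
      using curvatureDensity_polarMap hG hβ hy
  have hκ : β / Real.pi * ((n - 1 : ℕ) : ℝ) ≠ 0 :=
    mul_ne_zero (div_pos hβ Real.pi_pos).ne' (Nat.cast_ne_zero.2 (by omega))
  rw [integrableOn_riemannianVolume_iff hG]
  constructor
  · intro hint
    have hM0 : ∀ y, M y = 0 := fun y => by
      have h1 := coefficient_eq_zero_of_integrableOn
        (hMang.const_mul (β / Real.pi * ((n - 1 : ℕ) : ℝ))) (fun B => by
          have h2 := (hdens B).1.const_mul (β / Real.pi)
          rw [mul_zero] at h2
          refine h2.congr' ?_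
          filter_upwards [hpolar B] with y hy
          rw [hy]; ring) hβ hlam hG.isTorusPeriodic_curvatureDensity hint y
      exact (mul_eq_zero.1 h1).resolve_left hκ
    -- The lapse is Ψ(r)/r², so Ψ - 1 is the radial deviation. It has order m ≥ 2, as the ODE
    -- requires.
    have hΨ : ∀ᶠ y in atEnd (radial n),
        IsAsymptoticallyHyperbolic.deviation (radial n) g (radial n) (radial n) y =
          (potential n a r₀ (y (radial n)))⁻¹ *
          (Real.exp (uhat (y (radial n))) * Real.exp (uhat (y (radial n)))) - 1 := by
      filter_upwards [polar_oo hn hform, eventually_gt_atEnd 0,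
        IsAsymptoticallyHyperbolic.metric_oo (o := radial n) (g := g)] with y h1 h2 h3
      rw [h3] at h1
      have := mul_left_cancel₀ (inv_ne_zero (pow_ne_zero 2 h2.ne')) h1
      linarith
    obtain ⟨hs, hb⟩ := radial_of_isSymbol (o := radial n) (le_refl (0 : ℝ))
      (Ψ := fun t => (potential n a r₀ t)⁻¹ * (Real.exp (uhat t) * Real.exp (uhat t)) - 1)
      ((((H 0).symbol (radial n) (radial n)).mono (q := 2) (by omega)).congr hΨ)
    obtain ⟨x, hx⟩ := exists_specialDefiningFunction hG hβ
      (Ψ := fun t => (potential n a r₀ t)⁻¹ * (Real.exp (uhat t) * Real.exp (uhat t)))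
      (hs.mono fun t ht => by simpa using ht.add (contDiffAt_const (c := (1 : ℝ)))) hb
      (((potential_tendsto hn a r₀).eventually (lt_mem_nhds one_pos)).mono fun t ht => by positivity)
      (polar_oo hn hform) ((H 0).inv_cross.mono fun y hy => hy.1)
    refine ⟨x, hx, IsBigO.trans ?_ hx.isTheta_pow.2⟩
    have h1 := isBigO_of_polar (p := -n) hβ hlam (isTorusPeriodic_tensorNorm hG (n - 1)) fun B => by
      have h2 := (H B).tensorNorm_isBigO hm hm2 (hE B) hM0
      rw [hneg] at h2
      refine h2.congr' ?_ EventuallyEq.rfl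
      filter_upwards [(eventually_gt_atEnd rp).filter_mono endBox_le] with y hy
        using hG.tensorNorm_polar hβ hy _
    simpa only [einsteinDefect, hcast] using h1
  · rintro ⟨x, hx, hO⟩
    have h1 : (fun z => tensorNorm (G z) (einsteinDefect (n - 1) G z)) =O[atInfinity n rp]
        fun z => radius rp z ^ (-n : ℤ) := by
      simpa only [einsteinDefect, hcast] using hO.trans hx.isTheta_pow.1
    have h2 : ∀ B, (fun y => tensorNorm (g y) (einsteinDefect (n - 1) g y))
        =O[endBox (radial n) B] fun y => y (radial n) ^ (-(((n - 1 : ℕ) : ℤ) + 1)) := fun B => by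
      rw [hneg]
      refine (h1.comp_tendsto (tendsto_polarMap (β := β) B)).congr' ?_ ?_
      all_goals filter_upwards [(eventually_gt_atEnd rp).filter_mono endBox_le] with y hy
      · exact (hG.tensorNorm_polar hβ hy _).symm
      · simp only [Function.comp_apply, radius_polarMap (le_of_lt hy)]
    -- Every y lies in a box adapted to it. M does not depend on r, so its O(r⁻¹) decay along the
    -- ray through y gives M y = 0.
    have hM0 : ∀ y, M y = 0 := fun y => by
      have hb : ∀ i : Idx n, i ≠ radial n → |y i| ≤ ∑ j, |y j| := fun i _ =>
        Finset.single_le_sum (f := fun j => |y j|) (fun j _ => abs_nonneg _) (Finset.mem_univ i)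
      have h3 := ((H (∑ j, |y j|)).mass_eq_zero_of_isBigO hm hm2 (hE _) (h2 _)).trans_tendsto
        (tendsto_inv_atTop_zero.comp (tendsto_atEnd.mono_left endBox_le))
      have h3' : Tendsto (fun y => 0 - M y) (endBox (radial n) (∑ j, |y j|)) (𝓝 0) := by
        simpa only [zero_sub, neg_zero] using h3.neg
      have h4 := hMang.tendsto_update (F := fun _ => 0) h3' hb
      exact (tendsto_nhds_unique tendsto_const_nhds h4).symm
    refine integrableOn_of_isBigO hrp0 hG.continuous_curvatureDensity
      (isBigO_of_polar hβ hlam hG.isTorusPeriodic_curvatureDensity fun B => ?_)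
    exact (((hdens B).2 hM0).const_mul_left (β / Real.pi)).congr'
      ((hpolar B).mono fun y hy => hy.symm) EventuallyEq.rfl

end
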